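/- Identify the plane $\mathbb R^2$ with $\mathbb C$. A *regular network* is a finite union of branches in the plane. Each branch is a smooth embedded regular curve (smooth up to its end points) of one of three kinds: a compact arc with two end points, an arc with one end point running to infinity, or an arc without end points running to infinity in both directions. Different branches meet only at end points. At each end point of a branch (a *triple junction*) exactly three ends of branches meet, and their exterior unit tangent vectors satisfy $T_1+T_2+T_3=0$. Each non-compact branch has bounded curvature and, in each direction in which it runs to infinity (an *end*), its distance to some half-line tends to $0$. A regular network is a *self-expander* if $\vec k(x)=x^{\perp}$ at every point $x$ of each branch, where $\vec k$ is the curvature vector and $x^\perp$ is the component of the position vector $x$ normal to the branch. An end is *asymptotic to the half-line* $\{xe^{i\alpha}: x\ge 0\}$ if, for some $R>0$, a tail of it equals $\{xe^{i\alpha}+u(x)e^{i(\alpha+\pi/2)} : x\ge R\}$ with $\lim_{x\to\infty}u(x)=0$. Two networks are *asymptotic to each other* if each end of either network is asymptotic to a half-line from the origin to which some end of the other network is also asymptotic. Two networks $\psi_0,\psi_1$ are *in the same topological class* if there is a family of maps $F_t:\psi_0\to\mathbb R^2$, $0\le t\le 1$, smooth in $(t,x)$ on $[0,1]\times b$ for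 each closed branch $b$ of $\psi_0$, such that - $F_0$ is the identity, and $F_1$ maps $\psi_0$ bijectively onto $\psi_1$; - there is $\delta>0$ with $|F_t(a)-F_t(a')|\ge\delta$ for all $t\in[0,1]$ and all triple junctions $a\ne a'$ of $\psi_0$; - $\displaystyle\lim_{r\to\infty}\,\sup\Big\{\Big|\frac{\partial F_t}{\partial t}(x)\Big| : x\in\psi_0,\ |x|\ge r,\ 0\le t\le 1\Big\}=0$. **Theorem.** If $\psi_0$ and $\psi_1$ are two regular self-expanders that are asymptotic to each other and in the same topological class, then they coincide, i.e. $\psi_0=\psi_1$ as subsets of the plane. -/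

import Mathlib

open Set Filter Topology
open scoped ContDiff

noncomputable section

/-- The three kinds of branches of a planar network: a compact arc between two triple points,
an arc that starts at a triple point and runs to infinity, and an arc without triple points
that runs to infinity in both directions. -/
inductive BranchKind where
  | segment
  | ray
  | line

namespace BranchKind

/-- The parameter interval of a branch. -/
def dom : BranchKind → Set ℝ
  | segment => Icc 0 1
  | ray => Ici 0
  | line => univ

/-- The parameters of the end points of a branch. -/
def endpoints : BranchKind → Set ℝ
  | segment => {0, 1}
  | ray => {0}
  | line => ∅

/-- The directions (`1` for `+∞`, `-1` for `-∞`) in which a branch runs to infinity. -/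
def directions : BranchKind → Set ℝ
  | segment => ∅
  | ray => {1}
  | line => {1, -1}

end BranchKind

/-- Unit tangent vector at parameter `s` of a curve `c` defined on the interval `D`. -/
def unitTangent (c : ℝ → ℂ) (D : Set ℝ) (s : ℝ) : ℂ :=
  ‖derivWithin c D s‖⁻¹ • derivWithin c D s

/-- The component of the vector `v` that is normal to the curve `c` at parameter `s`. -/
def normalPart (c : ℝ → ℂ) (D : Set ℝ) (s : ℝ) (v : ℂ) : ℂ :=
  v - (inner ℝ (unitTangent c D s) v) • unitTangent c D s

/-- The curvature vector at parameter `s` of a regular curve `c` defined on the interval `D`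
(in an arbitrary regular parametrization). -/
def curvatureVector (c : ℝ → ℂ) (D : Set ℝ) (s : ℝ) : ℂ :=
  (‖derivWithin c D s‖ ^ 2)⁻¹ • normalPart c D s (derivWithin (derivWithin c D) D s)

/-- The exterior unit tangent vector of a branch at its end point with parameter `e ∈ {0, 1}`. -/
def exteriorTangent (c : ℝ → ℂ) (D : Set ℝ) (e : ℝ) : ℂ :=
  if e = 0 then -unitTangent c D e else unitTangent c D e

/-- A regular network in the plane `ℂ = ℝ²`: finitely many smoothly embedded branches which meet
only at their end points, and at each end point of a branch exactly three ends of branches meet,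
with exterior unit tangent vectors that sum to zero.  Each non-compact branch has bounded curvature
and approaches, in each direction in which it runs to infinity, a half-line. -/
structure RegularNetwork where
  /-- the number of branches -/
  n : ℕ
  kind : Fin n → BranchKind
  /-- the parametrization of the branches -/
  curve : Fin n → ℝ → ℂ
  smooth : ∀ b, ContDiffOn ℝ ∞ (curve b) (kind b).dom
  immersed : ∀ b, ∀ s ∈ (kind b).dom, derivWithin (curve b) (kind b).dom s ≠ 0
  /-- a point of a branch other than its end points is passed only once by the whole network -/
  embedded : ∀ b b', ∀ s ∈ (kind b).dom \ (kind b).endpoints, ∀ s' ∈ (kind b').dom,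
    curve b s = curve b' s' → b = b' ∧ s = s'
  /-- the three ends at a triple point -/
  triple : ∀ b, ∀ e ∈ (kind b).endpoints,
    ∃ p q r : (j : Fin n) × (kind j).endpoints, p ≠ q ∧ p ≠ r ∧ q ≠ r ∧
      (∀ x : (j : Fin n) × (kind j).endpoints,
        curve x.1 x.2 = curve b e ↔ x = p ∨ x = q ∨ x = r) ∧
      exteriorTangent (curve p.1) (kind p.1).dom p.2 +
        exteriorTangent (curve q.1) (kind q.1).dom q.2 +
        exteriorTangent (curve r.1) (kind r.1).dom r.2 = 0
  approaches : ∀ b, ∀ σ ∈ (kind b).directions,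
    Tendsto (fun s : ℝ => ‖curve b (σ * s)‖) atTop atTop ∧
    ∃ p v : ℂ, v ≠ 0 ∧
      Tendsto (fun s : ℝ => Metric.infDist (curve b (σ * s)) {z | ∃ x : ℝ, 0 ≤ x ∧ z = p + x * v})
        atTop (𝓝 0)
  bounded_curvature : ∀ b, (kind b).directions.Nonempty →
    ∃ C : ℝ, ∀ s ∈ (kind b).dom, ‖curvatureVector (curve b) (kind b).dom s‖ ≤ C

namespace RegularNetwork

/-- The network as a subset of the plane. -/
def carrier (N : RegularNetwork) : Set ℂ :=
  ⋃ b, N.curve b '' (N.kind b).dom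

/-- The set of triple junctions. -/
def junctions (N : RegularNetwork) : Set ℂ :=
  ⋃ b, N.curve b '' (N.kind b).endpoints

/-- The self-expander equation `k = x^⊥` on each branch. -/
def IsSelfExpander (N : RegularNetwork) : Prop :=
  ∀ b, ∀ s ∈ (N.kind b).dom,
    curvatureVector (N.curve b) (N.kind b).dom s =
      normalPart (N.curve b) (N.kind b).dom s (N.curve b s)

/-- The end of the branch `b` in the direction `σ` is asymptotic to the half-line
`{x e^{iα} | x ≥ 0}`: a tail of it is the graph of a function over `{x e^{iα} | x ≥ R}` that
tends to `0`. -/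
def EndAsymptotic (N : RegularNetwork) (b : Fin N.n) (σ : ℝ) (α : ℝ) : Prop :=
  ∃ R > 0, ∃ s₀ ≥ 0, ∃ u : ℝ → ℝ,
    (fun s : ℝ => N.curve b (σ * s)) '' Ici s₀ =
      (fun x : ℝ => x * Complex.exp (Complex.I * α) +
        u x * Complex.exp (Complex.I * (α + Real.pi / 2))) '' Ici R ∧
    Tendsto u atTop (𝓝 0)

/-- The ends of `N` are asymptotic to half-lines, and each of these is also the asymptotic
half-line of an end of `M`. -/
def EndsAsymptoticToEndsOf (N M : RegularNetwork) : Prop :=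
  ∀ b, ∀ σ ∈ (N.kind b).directions, ∃ α : ℝ, N.EndAsymptotic b σ α ∧
    ∃ b', ∃ σ' ∈ (M.kind b').directions, M.EndAsymptotic b' σ' α

/-- The ends of the two networks are asymptotic to the same half-lines. -/
def AsymptoticToEachOther (N M : RegularNetwork) : Prop :=
  N.EndsAsymptoticToEndsOf M ∧ M.EndsAsymptoticToEndsOf N

/-- The network `M` is obtained from `N` by a smooth family of maps `F t : N → ℝ²`, `0 ≤ t ≤ 1`,
that starts at the identity, keeps the triple junctions at a distance bounded below, and has a
velocity that tends to zero at infinity, uniformly in `t`. -/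
def SameTopologicalClass (N M : RegularNetwork) : Prop :=
  ∃ F : ℝ → ℂ → ℂ,
    (∀ b, ContDiffOn ℝ ∞ (fun p : ℝ × ℝ => F p.1 (N.curve b p.2)) (Icc 0 1 ×ˢ (N.kind b).dom)) ∧
    EqOn (F 0) id N.carrier ∧
    BijOn (F 1) N.carrier M.carrier ∧
    (∃ δ > 0, ∀ t ∈ Icc (0 : ℝ) 1, ∀ a ∈ N.junctions, ∀ a' ∈ N.junctions, a ≠ a' →
      δ ≤ dist (F t a) (F t a')) ∧
    (∀ ε > 0, ∃ r : ℝ, ∀ t ∈ Icc (0 : ℝ) 1, ∀ x ∈ N.carrier, r ≤ ‖x‖ →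
      ‖derivWithin (fun τ => F τ x) (Icc 0 1) t‖ ≤ ε)

end RegularNetwork

end

open Set Filter Topology
open scoped ContDiff

noncomputable section

/-! ### Ordinary differential equations: existence, Grönwall, differentiability of flows. -/

section ODETools

variable {E : Type*} [NormedAddCommGroup E] [NormedSpace ℝ E]

/-! The equation `k = x^⊥` is the geodesic equation of the conformal metric `e^{|z|²} |dz|²`. This
metric is complete and its Gauss curvature `-2 e^{-|z|²}` is negative, so any two points are joined
by exactly one geodesic (`bijective_geodesicEndpoints`, a Cartan–Hadamard argument), and half the
squared distance between points of two geodesics is convex. In infinitesimal form, its derivative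
when the two points move along their arcs at unit speed (`firstVariation`) is monotone in either
parameter. If it is constant along one arc, the connecting geodesics are tangent to that arc
(`ExpanderArc.exists_hasDerivWithinAt_firstVariation`,
`ExpanderArc.im_eq_zero_of_firstVariation_eq`).

The time-one map of the given family is a homeomorphism of the networks that approaches the identity
at infinity. It maps triple junctions to triple junctions and branches to branches of the same kind,
and corresponding ends run along the same half-line (`CarrierHomeo.exists_equiv`,
`CarrierHomeo.matched`). For a pair of corresponding branches, consider the field at the end points
of either branch that points along the geodesic towards the corresponding end point of the other,
paired with the exterior tangents. By monotonicity the total for the pair is nonpositive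
(`ExpanderArc.conclusion_of_matched`). At infinity nothing is lost: an expander approaches its
half-line faster than `e^{-|x|²/2}` (`tendsto_exp_mul_abs_im`), which is the rate at which the
metric grows, so the first variation becomes arbitrarily small there.

Summed over all branches, these totals give zero, because the three tangents at a junction add up to
zero (`RegularNetwork.sum_endSum_eq_zero`). Hence every pair contributes exactly zero. The equality
case makes the geodesic from a junction to its image tangent to all three branches there. Three unit
vectors with sum zero are not collinear, so that geodesic is constant and the junction is fixed.
Corresponding branches then lie on the same geodesic and fill the same part of it. -/

theorem exists_ode_solution_of_bounded [CompleteSpace E] {f : ℝ → E → E} {K L : NNReal}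
    (hcont : ∀ x, Continuous fun t => f t x) (hlip : ∀ t, LipschitzWith K (f t))
    (hL : ∀ t x, ‖f t x‖ ≤ L) (x₀ : E) :
    ∃ y : ℝ → E, y 0 = x₀ ∧ ∀ t ∈ Icc (0 : ℝ) 1, HasDerivAt y (f t (y t)) t := by
  -- Solving on the larger interval `[-1, 2]` makes the derivatives at `0` and `1` two-sided.
  have h0 : (0 : ℝ) ∈ Icc (-1 : ℝ) 2 := by constructor <;> norm_num
  have hpl : IsPicardLindelof f (⟨0, h0⟩ : Icc (-1 : ℝ) 2) x₀ (L * 2) 0 L K :=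
    { lipschitzOnWith := fun t _ => (hlip t).lipschitzOnWith
      continuousOn := fun x _ => (hcont x).continuousOn
      norm_le := fun t _ x _ => hL t x
      mul_max_le := by norm_num }
  obtain ⟨y, hy0, hy⟩ := hpl.exists_eq_forall_mem_Icc_hasDerivWithinAt₀
  exact ⟨y, hy0, fun t ht => (hy t ⟨by linarith [ht.1], by linarith [ht.2]⟩).hasDerivAt
    (Icc_mem_nhds (by linarith [ht.1]) (by linarith [ht.2]))⟩

/-- Grönwall's inequality on the unit interval. -/
theorem norm_le_of_norm_deriv_le {y y' : ℝ → E} {K ε : ℝ} (hK : 0 ≤ K) (hε : 0 ≤ ε)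
    (hy : ∀ t ∈ Icc (0 : ℝ) 1, HasDerivAt y (y' t) t)
    (hb : ∀ t ∈ Icc (0 : ℝ) 1, ‖y' t‖ ≤ K * ‖y t‖ + ε) {t : ℝ} (ht : t ∈ Icc (0 : ℝ) 1) :
    ‖y t‖ ≤ (‖y 0‖ + ε) * Real.exp (K + 1) := by
  -- Replacing `K` by `K + 1` avoids the separate formula for the Grönwall bound at `K = 0`.
  have h := norm_le_gronwallBound_of_norm_deriv_right_le (K := K + 1) (ε := ε) (δ := ‖y 0‖)
    (fun s hs => (hy s hs).continuousAt.continuousWithinAt)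
    (fun s hs => (hy s (Ico_subset_Icc_self hs)).hasDerivWithinAt) le_rfl
    (fun s hs => (hb s (Ico_subset_Icc_self hs)).trans (by nlinarith [norm_nonneg (y s)])) t ht
  refine h.trans ?_
  rw [gronwallBound_of_K_ne_0 (by positivity), sub_zero]
  have h1 : Real.exp ((K + 1) * t) ≤ Real.exp (K + 1) :=
    Real.exp_le_exp.2 (by nlinarith [ht.1, ht.2])
  have h2 : ε / (K + 1) ≤ ε := div_le_self hε (by linarith)
  have h3 : 1 ≤ Real.exp (K + 1) := Real.one_le_exp (by positivity)
  have h4 : ε / (K + 1) * (Real.exp ((K + 1) * t) - 1) ≤ ε * Real.exp (K + 1) := by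
    have : 0 ≤ Real.exp ((K + 1) * t) - 1 := by
      have : 1 ≤ Real.exp ((K + 1) * t) := Real.one_le_exp (mul_nonneg (by linarith) ht.1)
      linarith
    exact mul_le_mul h2 (by linarith) this hε
  nlinarith [norm_nonneg (y 0)]

/-- A linear field is unbounded, so it is cut off outside a ball of radius `R` larger than the a
priori bound of Grönwall. That bound holds for the truncated equation too, so its solution stays
where the cutoff equals one. -/
theorem exists_linear_ode_solution [FiniteDimensional ℝ E] {B : ℝ → E →L[ℝ] E}
    (hB : ContinuousOn B (Icc 0 1)) (x₀ : E) :
    ∃ y : ℝ → E, y 0 = x₀ ∧ ∀ t ∈ Icc (0 : ℝ) 1, HasDerivAt y (B t (y t)) t := by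
  have := FiniteDimensional.complete ℝ E
  obtain ⟨M, hM⟩ := isCompact_Icc.exists_bound_of_continuousOn hB
  have hM0 : 0 ≤ M := (norm_nonneg _).trans (hM 0 (by simp))
  set R : ℝ := (‖x₀‖ + 0) * Real.exp (M + 1) + 1
  have hR : 0 < R := by positivity
  let χ : ContDiffBump (0 : E) := ⟨R, R + 1, hR, by linarith⟩
  let r : E → E := fun y => χ y • y
  have hrc : HasCompactSupport r := χ.hasCompactSupport.smul_right
  have hrd : ContDiff ℝ 1 r := χ.contDiff.smul contDiff_id
  obtain ⟨C, hC⟩ := ContDiff.lipschitzWith_of_hasCompactSupport hrc hrd (by simp)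
  obtain ⟨D, hD⟩ := hrd.continuous.bounded_above_of_compact_support hrc
  have hrn : ∀ y, ‖r y‖ ≤ ‖y‖ := fun y => by
    rw [norm_smul, Real.norm_of_nonneg χ.nonneg]
    exact mul_le_of_le_one_left (norm_nonneg _) χ.le_one
  let p : ℝ → ℝ := fun t => projIcc (0 : ℝ) 1 zero_le_one t
  have hp : ∀ t, p t ∈ Icc (0 : ℝ) 1 := fun t => (projIcc (0 : ℝ) 1 zero_le_one t).2
  have hpc : Continuous p := continuous_subtype_val.comp continuous_projIcc
  have hpe : ∀ t ∈ Icc (0 : ℝ) 1, p t = t := fun t ht => by simp [p, projIcc_of_mem _ ht]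
  have hBp : Continuous fun t => B (p t) :=
    continuousOn_univ.1 (hB.comp hpc.continuousOn fun t _ => hp t)
  obtain ⟨y, hy0, hy⟩ := exists_ode_solution_of_bounded (f := fun t y => B (p t) (r y))
    (K := ⟨M, hM0⟩ * C) (L := ⟨M * |D|, by positivity⟩)
    (fun x => hBp.clm_apply continuous_const)
    (fun t => ((B (p t)).lipschitz.weaken (by exact_mod_cast hM _ (hp t))).comp hC)
    (fun t x => ((B (p t)).le_opNorm _).trans
      (mul_le_mul (hM _ (hp t)) ((hD x).trans (le_abs_self D)) (norm_nonneg _) hM0)) x₀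
  refine ⟨y, hy0, fun t ht => ?_⟩
  have hle := norm_le_of_norm_deriv_le (K := M) (ε := 0) hM0 le_rfl hy (fun s _ => by
    rw [add_zero]
    exact ((B (p s)).le_opNorm _).trans (mul_le_mul (hM _ (hp s)) (hrn _) (norm_nonneg _) hM0)) ht
  have hry : r (y t) = y t := by
    have : χ (y t) = 1 := χ.one_of_mem_closedBall (by
      rw [mem_closedBall_zero_iff]
      change _ ≤ R
      rw [hy0] at hle; linarith)
    simp [r, this]
  have := hy t ht
  simpa only [hry, hpe t ht] using this

/-- On bounded sets a `C¹` vector field is Lipschitz. -/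
theorem exists_lipschitzOnWith_closedBall [FiniteDimensional ℝ E] {f : E → E}
    (hf : ContDiff ℝ 1 f) (R : ℝ) :
    ∃ K : NNReal, LipschitzOnWith K f (Metric.closedBall 0 R) := by
  have := FiniteDimensional.proper ℝ E
  obtain ⟨C, hC⟩ := (isCompact_closedBall (0 : E) R).exists_bound_of_continuousOn
    (hf.continuous_fderiv one_ne_zero).continuousOn
  exact ⟨C.toNNReal, (convex_closedBall _ _).lipschitzOnWith_of_nnnorm_fderiv_le
    (fun x _ => (hf.differentiable one_ne_zero) x)
    fun x hx => by
      rw [← NNReal.coe_le_coe]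
      exact (hC x hx).trans (Real.le_coe_toNNReal C)⟩

/-- A uniform version of strict differentiability along a compact set. -/
theorem exists_forall_norm_sub_sub_fderiv_le [FiniteDimensional ℝ E] {f : E → E}
    (hf : ContDiff ℝ 1 f) (R : ℝ) {ε : ℝ} (hε : 0 < ε) :
    ∃ η > 0, η ≤ 1 ∧ ∀ x, ‖x‖ ≤ R → ∀ a ∈ Metric.ball x η, ∀ b ∈ Metric.ball x η,
      ‖f a - f b - fderiv ℝ f x (a - b)‖ ≤ ε * ‖a - b‖ := by
  have := FiniteDimensional.proper ℝ E
  have huc := (isCompact_closedBall (0 : E) (R + 1)).uniformContinuousOn_of_continuous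
    (hf.continuous_fderiv one_ne_zero).continuousOn
  obtain ⟨η, hη, h⟩ := Metric.uniformContinuousOn_iff.1 huc ε hε
  refine ⟨min η 1, by positivity, min_le_right _ _, fun x hx a ha b hb => ?_⟩
  refine (convex_ball x (min η 1)).norm_image_sub_le_of_norm_hasFDerivWithin_le'
    (f' := fderiv ℝ f) (fun z _ => (hf.differentiable one_ne_zero z).hasFDerivAt.hasFDerivWithinAt)
    (fun z hz => ?_) hb ha
  rw [Metric.mem_ball] at hz
  have hz1 := hz.trans_le (min_le_left _ _)
  have hz2 := hz.trans_le (min_le_right _ _)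
  rw [← dist_eq_norm]
  refine (h z ?_ x ?_ hz1).le
  · rw [mem_closedBall_zero_iff]
    have := norm_le_norm_add_norm_sub' z x
    rw [dist_eq_norm] at hz2; linarith
  · rw [mem_closedBall_zero_iff]; linarith

/-- Strict differentiability of the time-one map of a flow, the derivative being given by the
solution of the linearized equation. -/
theorem hasStrictFDerivAt_flow [FiniteDimensional ℝ E] {f : E → E} (hf : ContDiff ℝ 1 f)
    {φ : E → ℝ → E} (h0 : ∀ q, φ q 0 = q)
    (hφ : ∀ q, ∀ t ∈ Icc (0 : ℝ) 1, HasDerivAt (φ q) (f (φ q t)) t)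
    (hbd : ∀ r, ∃ R, ∀ q, ‖q‖ ≤ r → ∀ t ∈ Icc (0 : ℝ) 1, ‖φ q t‖ ≤ R) (q₀ : E) :
    ∃ L : ℝ → E →L[ℝ] E, L 0 = ContinuousLinearMap.id ℝ E ∧
      (∀ t ∈ Icc (0 : ℝ) 1, HasDerivAt L ((fderiv ℝ f (φ q₀ t)).comp (L t)) t) ∧
      HasStrictFDerivAt (fun q => φ q 1) (L 1) q₀ := by
  have hcont : ContinuousOn (fun t => fderiv ℝ f (φ q₀ t)) (Icc 0 1) :=
    (hf.continuous_fderiv one_ne_zero).comp_continuousOn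
      fun t ht => (hφ q₀ t ht).continuousAt.continuousWithinAt
  obtain ⟨L, hL0, hL⟩ := exists_linear_ode_solution (E := E →L[ℝ] E)
    (B := fun t => ContinuousLinearMap.compL ℝ E E E (fderiv ℝ f (φ q₀ t)))
    ((ContinuousLinearMap.compL ℝ E E E).continuous.comp_continuousOn hcont)
    (ContinuousLinearMap.id ℝ E)
  refine ⟨L, hL0, hL, ?_⟩
  obtain ⟨R, hR⟩ := hbd (‖q₀‖ + 1)
  obtain ⟨K, hK⟩ := exists_lipschitzOnWith_closedBall hf R
  have hR0 := hR q₀ (by linarith)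
  -- Lipschitz dependence on the initial value
  have hlip : ∀ a ∈ Metric.ball q₀ 1, ∀ b ∈ Metric.ball q₀ 1, ∀ t ∈ Icc (0 : ℝ) 1,
      ‖φ a t - φ b t‖ ≤ ‖a - b‖ * Real.exp (K + 1) := by
    intro a ha b hb t ht
    have hn : ∀ c ∈ Metric.ball q₀ 1, ‖c‖ ≤ ‖q₀‖ + 1 := fun c hc => by
      have := norm_le_norm_add_norm_sub' c q₀
      rw [Metric.mem_ball, dist_eq_norm] at hc; linarith
    have := norm_le_of_norm_deriv_le (y := fun t => φ a t - φ b t) K.coe_nonneg le_rfl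
      (fun s hs => (hφ a s hs).sub (hφ b s hs)) (fun s hs => by
        rw [add_zero, ← dist_eq_norm, ← dist_eq_norm]
        exact hK.dist_le_mul _ (mem_closedBall_zero_iff.2 (hR a (hn a ha) s hs)) _
          (mem_closedBall_zero_iff.2 (hR b (hn b hb) s hs))) ht
    simpa [h0] using this
  obtain ⟨M, hM⟩ := isCompact_Icc.exists_bound_of_continuousOn hcont
  have hM0 : 0 ≤ M := (norm_nonneg _).trans (hM 0 (by simp))
  rw [hasStrictFDerivAt_iff_isLittleO, Asymptotics.isLittleO_iff]
  intro c hc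
  set e₁ := Real.exp (K + 1)
  set e₂ := Real.exp (M + 1)
  have he₁ : 0 < e₁ := Real.exp_pos _
  have he₂ : 0 < e₂ := Real.exp_pos _
  -- Grönwall is used twice, for the difference of two trajectories (factor `e₁`) and for the
  -- linearization error (factor `e₂`); dividing by both leaves the constant `c`.
  obtain ⟨η, hη, -, hst⟩ := exists_forall_norm_sub_sub_fderiv_le hf R
    (ε := c / (e₁ * e₂)) (by positivity)
  have hnear : ∀ᶠ q in 𝓝 q₀, q ∈ Metric.ball q₀ 1 ∧ ‖q - q₀‖ * e₁ < η := by
    refine (Metric.ball_mem_nhds q₀ one_pos |> fun h => Filter.eventually_of_mem h fun _ h => h).and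
      (ContinuousAt.eventually_lt (by fun_prop) continuousAt_const (by simpa using hη))
  rw [nhds_prod_eq]
  filter_upwards [hnear.prod_mk hnear] with ⟨a, b⟩ ⟨⟨ha, ha'⟩, hb, hb'⟩
  have hball : ∀ q ∈ Metric.ball q₀ 1, ‖q - q₀‖ * e₁ < η → ∀ t ∈ Icc (0 : ℝ) 1,
      φ q t ∈ Metric.ball (φ q₀ t) η := fun q hq hq' t ht => by
    rw [Metric.mem_ball, dist_eq_norm]
    exact (hlip q hq q₀ (Metric.mem_ball_self one_pos) t ht).trans_lt hq'
  -- The error vanishes at time zero and solves the linearized equation up to the remainder of the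
  -- uniform strict differentiability of `f`.
  have key := norm_le_of_norm_deriv_le (y := fun t => φ a t - φ b t - L t (a - b))
    (K := M) (ε := c / (e₁ * e₂) * (‖a - b‖ * e₁)) hM0 (by positivity)
    (fun t ht => ((hφ a t ht).sub (hφ b t ht)).sub ((hL t ht).clm_apply (hasDerivAt_const t (a - b))))
    (fun t ht => by
      have h1 := hst _ (hR0 t ht) _ (hball a ha ha' t ht) _ (hball b hb hb' t ht)
      have h2 := hlip a ha b hb t ht
      have h3 : ‖fderiv ℝ f (φ q₀ t) (φ a t - φ b t - L t (a - b))‖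
          ≤ M * ‖φ a t - φ b t - L t (a - b)‖ :=
        ((fderiv ℝ f (φ q₀ t)).le_opNorm _).trans
          (mul_le_mul_of_nonneg_right (hM t ht) (norm_nonneg _))
      have h4 : f (φ a t) - f (φ b t) -
          (((ContinuousLinearMap.compL ℝ E E E) (fderiv ℝ f (φ q₀ t))) (L t) (a - b) + L t 0)
          = fderiv ℝ f (φ q₀ t) (φ a t - φ b t - L t (a - b)) +
            (f (φ a t) - f (φ b t) - fderiv ℝ f (φ q₀ t) (φ a t - φ b t)) := by
        simp [map_sub]
      rw [h4]
      refine (norm_add_le _ _).trans (add_le_add h3 (h1.trans ?_))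
      gcongr)
    (right_mem_Icc.2 zero_le_one)
  refine key.trans (le_of_eq ?_)
  simp only [h0, hL0, ContinuousLinearMap.id_apply, sub_self, norm_zero, zero_add]
  field_simp
  exact mul_comm _ _

end ODETools

/-! ### The geodesic flow of the metric `e^{|z|²} |dz|²`. -/

open ComplexConjugate

/-- The geodesic vector field of the metric `e^{|z|²} |dz|²` on the tangent bundle of the plane:
geodesics are the solutions of `z'' = -conj z * z' ^ 2`. -/
def geodesicField (q : ℂ × ℂ) : ℂ × ℂ := (q.2, -(conj q.1 * q.2 ^ 2))

/-- Geodesics of the metric `e^{|z|²} |dz|²`, together with their velocity. -/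
def IsGeodesic (c : ℝ → ℂ × ℂ) : Prop :=
  ∀ t ∈ Icc (0 : ℝ) 1, HasDerivAt c (geodesicField (c t)) t

theorem contDiff_geodesicField : ContDiff ℝ 1 geodesicField := by
  have h : ContDiff ℝ 1 fun q : ℂ × ℂ => conj q.1 :=
    Complex.conjCLE.contDiff.comp contDiff_fst
  exact contDiff_snd.prodMk (h.mul (contDiff_snd.pow 2)).neg

theorem fderiv_geodesicField_apply (q v : ℂ × ℂ) :
    fderiv ℝ geodesicField q v = (v.2, -(conj v.1 * q.2 ^ 2 + 2 * conj q.1 * q.2 * v.2)) := by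
  have h1 := ((contDiff_geodesicField.differentiable one_ne_zero) q).hasFDerivAt.hasLineDerivAt v
  have e1 : HasDerivAt (fun t : ℝ => q.2 + t • v.2) v.2 0 := by
    simpa using ((hasDerivAt_id (0 : ℝ)).smul_const v.2).const_add q.2
  have e2 : HasDerivAt (fun t : ℝ => q.1 + t • v.1) v.1 0 := by
    simpa using ((hasDerivAt_id (0 : ℝ)).smul_const v.1).const_add q.1
  have e3 : HasDerivAt (fun t : ℝ => conj (q.1 + t • v.1)) (conj v.1) 0 :=
    Complex.conjCLE.hasFDerivAt.comp_hasDerivAt (0 : ℝ) e2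
  have h2 := e1.prodMk (e3.mul (e1.pow 2)).neg
  refine (HasDerivAt.unique h1 h2).trans ?_
  ext1
  · rfl
  · simp; ring

theorem HasDerivAt.fst_comp {c : ℝ → ℂ × ℂ} {c' : ℂ × ℂ} {t : ℝ} (h : HasDerivAt c c' t) :
    HasDerivAt (fun t => (c t).1) c'.1 t :=
  (ContinuousLinearMap.fst ℝ ℂ ℂ).hasFDerivAt.comp_hasDerivAt t h

theorem HasDerivAt.snd_comp {c : ℝ → ℂ × ℂ} {c' : ℂ × ℂ} {t : ℝ} (h : HasDerivAt c c' t) :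
    HasDerivAt (fun t => (c t).2) c'.2 t :=
  (ContinuousLinearMap.snd ℝ ℂ ℂ).hasFDerivAt.comp_hasDerivAt t h

/-- Squared speed in the metric `e^{|z|²} |dz|²`. -/
def speedSq (q : ℂ × ℂ) : ℝ := Real.exp (‖q.1‖ ^ 2) * ‖q.2‖ ^ 2

/-- The derivative of the speed along the geodesic field is zero, hence also along any scalar
multiple of it. The factor `a` is there to cover the truncated field used for existence. -/
theorem speedSq_eq_of_hasDerivAt {c : ℝ → ℂ × ℂ} {a : ℝ → ℝ}
    (hc : ∀ t ∈ Icc (0 : ℝ) 1, HasDerivAt c (a t • geodesicField (c t)) t) {t : ℝ}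
    (ht : t ∈ Icc (0 : ℝ) 1) : speedSq (c t) = speedSq (c 0) := by
  have hd : ∀ t ∈ Icc (0 : ℝ) 1, HasDerivAt (fun t => speedSq (c t)) 0 t := fun t ht => by
    have h := ((hc t ht).fst_comp.norm_sq.exp).mul (hc t ht).snd_comp.norm_sq
    refine h.congr_deriv ?_
    simp only [Complex.sq_norm, Complex.normSq_apply]
    simp only [geodesicField, Complex.inner, Prod.smul_mk, Complex.real_smul, pow_two, Complex.mul_re, Complex.mul_im, Complex.conj_re, Complex.conj_im,
      Complex.ofReal_re, Complex.ofReal_im, Complex.neg_re, Complex.neg_im]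
    ring
  exact constant_of_has_deriv_right_zero
    (fun s hs => (hd s hs).continuousAt.continuousWithinAt)
    (fun s hs => (hd s (Ico_subset_Icc_self hs)).hasDerivWithinAt) t ht

theorem norm_snd_le_sqrt_speedSq (q : ℂ × ℂ) : ‖q.2‖ ≤ √(speedSq q) := by
  apply Real.le_sqrt_of_sq_le
  have : 1 ≤ Real.exp (‖q.1‖ ^ 2) := Real.one_le_exp (by positivity)
  unfold speedSq
  nlinarith [sq_nonneg ‖q.2‖]

/-- Since `e^{|z|²} ≥ 1`, the conserved Riemannian speed bounds the Euclidean speed, so trajectories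
cannot escape in unit time. This is where completeness comes from. -/
theorem norm_le_of_hasDerivAt {c : ℝ → ℂ × ℂ} {a : ℝ → ℝ} (ha : ∀ t, |a t| ≤ 1)
    (hc : ∀ t ∈ Icc (0 : ℝ) 1, HasDerivAt c (a t • geodesicField (c t)) t) {t : ℝ}
    (ht : t ∈ Icc (0 : ℝ) 1) : ‖c t‖ ≤ ‖c 0‖ + √(speedSq (c 0)) := by
  have hp : ∀ t ∈ Icc (0 : ℝ) 1, ‖(c t).2‖ ≤ √(speedSq (c 0)) := fun t ht => by
    rw [← speedSq_eq_of_hasDerivAt hc ht]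
    exact norm_snd_le_sqrt_speedSq _
  rw [Prod.norm_def]
  refine max_le ?_ ((hp t ht).trans (by linarith [norm_nonneg (c 0)]))
  have h := (convex_Icc (0 : ℝ) 1).norm_image_sub_le_of_norm_hasDerivWithin_le
    (f := fun t => (c t).1) (C := √(speedSq (c 0)))
    (fun s hs => (hc s hs).fst_comp.hasDerivWithinAt)
    (fun s hs => by
      simp only [geodesicField, Prod.smul_mk, norm_smul, Real.norm_eq_abs]
      exact (mul_le_of_le_one_left (norm_nonneg _) (ha s)).trans (hp s hs))
    (left_mem_Icc.2 zero_le_one) ht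
  have h1 : ‖t - 0‖ ≤ 1 := by rw [sub_zero, Real.norm_of_nonneg ht.1]; exact ht.2
  have h2 := norm_le_norm_add_norm_sub' (c t).1 (c 0).1
  have h3 := norm_fst_le (c 0)
  have h4 : √(speedSq (c 0)) * ‖t - 0‖ ≤ √(speedSq (c 0)) :=
    mul_le_of_le_one_right (Real.sqrt_nonneg _) h1
  linarith

/-- The geodesic field times a cutoff is bounded and Lipschitz. Its trajectories obey the same a
priori bound as geodesics, so the one from `q` never reaches the region where the cutoff differs
from one. -/
theorem exists_isGeodesic (q : ℂ × ℂ) : ∃ c, c 0 = q ∧ IsGeodesic c := by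
  set R := ‖q‖ + √(speedSq q) + 1
  have hR : 0 < R := by positivity
  let χ : ContDiffBump (0 : ℂ × ℂ) := ⟨R, R + 1, hR, by linarith⟩
  let F : ℂ × ℂ → ℂ × ℂ := fun q => χ q • geodesicField q
  have hFc : HasCompactSupport F := χ.hasCompactSupport.smul_right
  have hFd : ContDiff ℝ 1 F := χ.contDiff.smul contDiff_geodesicField
  obtain ⟨K, hK⟩ := ContDiff.lipschitzWith_of_hasCompactSupport hFc hFd (by simp)
  obtain ⟨D, hD⟩ := hFd.continuous.bounded_above_of_compact_support hFc
  obtain ⟨c, hc0, hc⟩ := exists_ode_solution_of_bounded (f := fun _ => F) (K := K)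
    (L := D.toNNReal) (fun _ => continuous_const) (fun _ => hK)
    (fun _ x => (hD x).trans (Real.le_coe_toNNReal D)) q
  refine ⟨c, hc0, fun t ht => ?_⟩
  have hle := norm_le_of_hasDerivAt (a := fun t => χ (c t))
    (fun t => by rw [abs_of_nonneg χ.nonneg]; exact χ.le_one) hc ht
  have hχ : χ (c t) = 1 := χ.one_of_mem_closedBall (by
    rw [mem_closedBall_zero_iff]
    change _ ≤ R
    rw [hc0] at hle; linarith)
  simpa [F, hχ] using hc t ht

theorem IsGeodesic.speedSq_eq {c : ℝ → ℂ × ℂ} (hc : IsGeodesic c) {t : ℝ}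
    (ht : t ∈ Icc (0 : ℝ) 1) : speedSq (c t) = speedSq (c 0) :=
  speedSq_eq_of_hasDerivAt (a := fun _ => 1) (by simp only [one_smul]; exact hc) ht

theorem IsGeodesic.norm_le {c : ℝ → ℂ × ℂ} (hc : IsGeodesic c) {t : ℝ}
    (ht : t ∈ Icc (0 : ℝ) 1) : ‖c t‖ ≤ ‖c 0‖ + √(speedSq (c 0)) :=
  norm_le_of_hasDerivAt (a := fun _ => 1) (by simp) (by simp only [one_smul]; exact hc) ht

theorem IsGeodesic.eq_of_eq {c d : ℝ → ℂ × ℂ} (hc : IsGeodesic c) (hd : IsGeodesic d)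
    (h : c 0 = d 0) {t : ℝ} (ht : t ∈ Icc (0 : ℝ) 1) : c t = d t := by
  obtain ⟨K, hK⟩ := exists_lipschitzOnWith_closedBall contDiff_geodesicField
    (‖c 0‖ + √(speedSq (c 0)))
  have := norm_le_of_norm_deriv_le (y := fun t => c t - d t) K.coe_nonneg le_rfl
    (fun s hs => (hc s hs).sub (hd s hs)) (fun s hs => by
      rw [add_zero, ← dist_eq_norm, ← dist_eq_norm]
      refine hK.dist_le_mul _ (mem_closedBall_zero_iff.2 (hc.norm_le hs)) _
          (mem_closedBall_zero_iff.2 ?_)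
      rw [h]; exact hd.norm_le hs) ht
  simp only [h, sub_self, norm_zero, add_zero, zero_mul] at this
  exact sub_eq_zero.1 (norm_le_zero_iff.1 this)

/-- The geodesic flow. -/
def geodesicFlow (q : ℂ × ℂ) : ℝ → ℂ × ℂ := (exists_isGeodesic q).choose

@[simp] theorem geodesicFlow_zero (q : ℂ × ℂ) : geodesicFlow q 0 = q :=
  (exists_isGeodesic q).choose_spec.1

theorem isGeodesic_geodesicFlow (q : ℂ × ℂ) : IsGeodesic (geodesicFlow q) :=
  (exists_isGeodesic q).choose_spec.2

theorem IsGeodesic.eq_geodesicFlow {c : ℝ → ℂ × ℂ} (hc : IsGeodesic c) :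
    c 1 = geodesicFlow (c 0) 1 :=
  hc.eq_of_eq (isGeodesic_geodesicFlow _) (by simp) (right_mem_Icc.2 zero_le_one)

/-- Time reversal of a geodesic. -/
theorem IsGeodesic.reverse {c : ℝ → ℂ × ℂ} (hc : IsGeodesic c) :
    IsGeodesic fun t => ((c (1 - t)).1, -(c (1 - t)).2) := by
  intro t ht
  have h := (hc (1 - t) ⟨by linarith [ht.2], by linarith [ht.1]⟩).comp_const_sub 1 t
  refine (h.fst_comp.prodMk h.snd_comp.neg).congr_deriv ?_
  simp [geodesicField]

theorem geodesicFlow_reverse (q : ℂ × ℂ) :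
    geodesicFlow ((geodesicFlow q 1).1, -(geodesicFlow q 1).2) 1 = (q.1, -q.2) := by
  have := (isGeodesic_geodesicFlow q).reverse.eq_geodesicFlow
  simpa using this.symm

theorem exists_hasStrictFDerivAt_geodesicFlow (q₀ : ℂ × ℂ) :
    ∃ L : ℝ → ℂ × ℂ →L[ℝ] ℂ × ℂ, L 0 = ContinuousLinearMap.id ℝ (ℂ × ℂ) ∧
      (∀ t ∈ Icc (0 : ℝ) 1,
        HasDerivAt L ((fderiv ℝ geodesicField (geodesicFlow q₀ t)).comp (L t)) t) ∧
      HasStrictFDerivAt (fun q => geodesicFlow q 1) (L 1) q₀ := by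
  refine hasStrictFDerivAt_flow contDiff_geodesicField geodesicFlow_zero
    (fun q => isGeodesic_geodesicFlow q) (fun r => ⟨r + √(Real.exp (r ^ 2) * r ^ 2),
      fun q hq t ht => ((isGeodesic_geodesicFlow q).norm_le ht).trans ?_⟩) q₀
  have h1 := (norm_fst_le q).trans hq
  have h2 := (norm_snd_le q).trans hq
  rw [geodesicFlow_zero, speedSq]
  gcongr

/-! ### Jacobi fields and the effect of negative curvature. -/

/-- Jacobi fields `J` along a geodesic with velocity `p`, with covariant derivative `K`. -/
structure IsJacobi (c : ℝ → ℂ × ℂ) (J K : ℝ → ℂ) : Prop where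
  geodesic : IsGeodesic c
  deriv_fst : ∀ t ∈ Icc (0 : ℝ) 1, HasDerivAt J (K t - conj (c t).1 * (c t).2 * J t) t
  deriv_snd : ∀ t ∈ Icc (0 : ℝ) 1, HasDerivAt K (-(conj (c t).1 * (c t).2 * K t) +
    conj (c t).2 * (c t).2 * J t - (c t).2 ^ 2 * conj (J t)) t

/-- Differentiating a family of geodesics in its initial data gives a Jacobi field. The added term
`conj z * p * J` is the Christoffel term that turns the ordinary derivative into the covariant one.
-/
theorem isJacobi_of_linearization {q₀ : ℂ × ℂ} {L : ℝ → ℂ × ℂ →L[ℝ] ℂ × ℂ}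
    (hL : ∀ t ∈ Icc (0 : ℝ) 1,
      HasDerivAt L ((fderiv ℝ geodesicField (geodesicFlow q₀ t)).comp (L t)) t) (δ : ℂ × ℂ) :
    IsJacobi (geodesicFlow q₀) (fun t => (L t δ).1) (fun t => (L t δ).2 +
      conj (geodesicFlow q₀ t).1 * (geodesicFlow q₀ t).2 * (L t δ).1) := by
  have hψ : ∀ t ∈ Icc (0 : ℝ) 1, HasDerivAt (fun t => L t δ)
      (fderiv ℝ geodesicField (geodesicFlow q₀ t) (L t δ)) t := fun t ht => by
    simpa using (hL t ht).clm_apply (hasDerivAt_const t δ)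
  refine ⟨isGeodesic_geodesicFlow q₀, fun t ht => ?_, fun t ht => ?_⟩
  · refine (hψ t ht).fst_comp.congr_deriv ?_
    rw [fderiv_geodesicField_apply]; ring
  · have hc := isGeodesic_geodesicFlow q₀ t ht
    have hconj : HasDerivAt (fun t => conj (geodesicFlow q₀ t).1)
        (conj (geodesicFlow q₀ t).2) t :=
      Complex.conjCLE.hasFDerivAt.comp_hasDerivAt t hc.fst_comp
    refine ((hψ t ht).snd_comp.add
      ((hconj.mul hc.snd_comp).mul (hψ t ht).fst_comp)).congr_deriv ?_
    rw [fderiv_geodesicField_apply]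
    simp only [geodesicField, Pi.mul_apply]
    ring

/-- If `√n` is convex in the sense of the differential inequality `n'² ≤ 2 n n''` and `n 1 = 0`,
then `√n` lies below its chord. -/
theorem le_sq_mul_of_sq_deriv_le {n n₁ n₂ : ℝ → ℝ}
    (h₁ : ∀ t ∈ Icc (0 : ℝ) 1, HasDerivAt n (n₁ t) t)
    (h₂ : ∀ t ∈ Icc (0 : ℝ) 1, HasDerivAt n₁ (n₂ t) t)
    (hn : ∀ t ∈ Icc (0 : ℝ) 1, 0 ≤ n t) (hn₂ : ∀ t ∈ Icc (0 : ℝ) 1, 0 ≤ n₂ t)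
    (hcs : ∀ t ∈ Icc (0 : ℝ) 1, n₁ t ^ 2 ≤ 2 * n t * n₂ t) (h1 : n 1 = 0) {t : ℝ}
    (ht : t ∈ Icc (0 : ℝ) 1) : n t ≤ (1 - t) ^ 2 * n 0 := by
  -- The square root is not differentiable at zeros of `n`; the inequality `n'² ≤ 2 n n''` survives
  -- adding `ε` because `n'' ≥ 0`.
  have key : ∀ ε > 0, √(n t + ε) ≤ (1 - t) * √(n 0 + ε) + t * √(0 + ε) := by
    intro ε hε
    have hpos : ∀ t ∈ Icc (0 : ℝ) 1, 0 < n t + ε := fun t ht => by linarith [hn t ht]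
    have hd : ∀ t ∈ Icc (0 : ℝ) 1, HasDerivAt (fun t => √(n t + ε)) (n₁ t / (2 * √(n t + ε))) t :=
      fun t ht => ((h₁ t ht).add_const ε).sqrt (hpos t ht).ne'
    have hconv : ConvexOn ℝ (Icc (0 : ℝ) 1) fun t => √(n t + ε) := by
      refine convexOn_of_hasDerivWithinAt2_nonneg (convex_Icc 0 1)
        (fun t ht => (hd t ht).continuousAt.continuousWithinAt)
        (fun t ht => (hd t (interior_subset ht)).hasDerivWithinAt)
        (fun t ht => ((h₂ t (interior_subset ht)).div ((hd t (interior_subset ht)).const_mul 2)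
          ?_).hasDerivWithinAt) fun t ht => ?_
      · have := Real.sqrt_pos.2 (hpos t (interior_subset ht)); positivity
      · have ht' := interior_subset ht
        have hs := Real.sqrt_pos.2 (hpos t ht')
        apply div_nonneg _ (sq_nonneg _)
        have h3 := Real.sq_sqrt (hpos t ht').le
        have h4 : n₂ t * (2 * √(n t + ε)) - n₁ t * (2 * (n₁ t / (2 * √(n t + ε))))
            = (2 * (n t + ε) * n₂ t - n₁ t ^ 2) / √(n t + ε) := by
          field_simp; rw [h3]
        rw [h4]
        apply div_nonneg _ hs.le
        nlinarith [hcs t ht', hn₂ t ht']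
    have := hconv.2 (left_mem_Icc.2 zero_le_one) (right_mem_Icc.2 zero_le_one)
      (sub_nonneg.2 ht.2) ht.1 (by ring)
    simpa [h1] using this
  have lim : √(n t + 0) ≤ (1 - t) * √(n 0 + 0) + t * √(0 + 0) := by
    refine le_of_tendsto_of_tendsto
      (f := fun ε => √(n t + ε)) (g := fun ε => (1 - t) * √(n 0 + ε) + t * √(0 + ε))
      (b := 𝓝[>] (0 : ℝ)) (ContinuousAt.tendsto ?_ |>.mono_left inf_le_left)
      (ContinuousAt.tendsto ?_ |>.mono_left inf_le_left)
      (eventually_nhdsWithin_of_forall fun ε hε => key ε hε)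
    all_goals fun_prop
  simp only [add_zero, Real.sqrt_zero, mul_zero] at lim
  have h0 := hn 0 (left_mem_Icc.2 zero_le_one)
  calc n t = √(n t) ^ 2 := (Real.sq_sqrt (hn t ht)).symm
    _ ≤ ((1 - t) * √(n 0)) ^ 2 := by gcongr
    _ = (1 - t) ^ 2 * n 0 := by rw [mul_pow, Real.sq_sqrt h0]

/-- A function which is nonnegative on `[0, 1]` and vanishes at `0` has nonnegative derivative
there. -/
theorem deriv_nonneg_of_forall_nonneg {f : ℝ → ℝ} {f' : ℝ} (hf : HasDerivAt f f' 0) (h0 : f 0 = 0)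
    (h : ∀ t ∈ Icc (0 : ℝ) 1, 0 ≤ f t) : 0 ≤ f' := by
  have := (hasDerivAt_iff_tendsto_slope.1 hf).mono_left
    (nhdsWithin_mono 0 (fun t (ht : t ∈ Ioi (0 : ℝ)) => (ne_of_gt ht : t ≠ 0)))
  refine ge_of_tendsto this ?_
  filter_upwards [Ioo_mem_nhdsGT (zero_lt_one (α := ℝ))] with t ht
  rw [slope_def_field, h0]
  have := h t (Ioo_subset_Icc_self ht)
  exact div_nonneg (by linarith) (by linarith [ht.1])

/-- Second order version of `deriv_nonneg_of_forall_nonneg`. -/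
theorem deriv2_nonneg_of_forall_nonneg {f f₁ : ℝ → ℝ} {f₂ : ℝ}
    (hf : ∀ t ∈ Icc (0 : ℝ) 1, HasDerivAt f (f₁ t) t) (hf₁ : HasDerivAt f₁ f₂ 0) (h0 : f 0 = 0)
    (h0' : f₁ 0 = 0) (h : ∀ t ∈ Icc (0 : ℝ) 1, 0 ≤ f t) : 0 ≤ f₂ := by
  by_contra! hneg
  have hs := (hasDerivAt_iff_tendsto_slope.1 hf₁).mono_left
    (nhdsWithin_mono 0 (fun t (ht : t ∈ Ioi (0 : ℝ)) => (ne_of_gt ht : t ≠ 0)))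
  have hev := (hs.eventually (gt_mem_nhds hneg)).and (Ioo_mem_nhdsGT (zero_lt_one (α := ℝ)))
  obtain ⟨δ, hδ, hI⟩ := mem_nhdsGT_iff_exists_Ioo_subset.1 hev
  set r := min δ 1 / 2
  have hδ' : 0 < min δ 1 := lt_min hδ one_pos
  have hr : 0 < r := by positivity
  have hr1 : r < δ := by have := min_le_left δ 1; simp only [r]; linarith
  have hr2 : r ≤ 1 := by have := min_le_right δ 1; simp only [r]; linarith
  have hanti : StrictAntiOn f (Icc 0 r) := by
    refine strictAntiOn_of_deriv_neg (convex_Icc 0 r)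
      (fun t ht => (hf t ⟨ht.1, ht.2.trans hr2⟩).continuousAt.continuousWithinAt) fun t ht => ?_
    rw [interior_Icc] at ht
    rw [(hf t ⟨ht.1.le, ht.2.le.trans hr2⟩).deriv]
    have := (hI ⟨ht.1, ht.2.trans hr1⟩).1
    rw [slope_def_field, h0', sub_zero, sub_zero, div_lt_iff₀ ht.1] at this
    linarith
  have h1 := hanti (left_mem_Icc.2 hr.le) (right_mem_Icc.2 hr.le) hr
  have h2 := h r ⟨hr.le, hr2⟩
  linarith

namespace IsJacobi

variable {c : ℝ → ℂ × ℂ} {J K : ℝ → ℂ}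

/-- Compatibility of the connection with the metric: the Christoffel terms cancel against the
derivative of the conformal factor. -/
theorem hasDerivAt_normSq (h : IsJacobi c J K) {t : ℝ} (ht : t ∈ Icc (0 : ℝ) 1) :
    HasDerivAt (fun t => Real.exp (‖(c t).1‖ ^ 2) * ‖J t‖ ^ 2)
      (2 * Real.exp (‖(c t).1‖ ^ 2) * inner ℝ (K t) (J t)) t := by
  refine ((h.geodesic t ht).fst_comp.norm_sq.exp.mul (h.deriv_fst t ht).norm_sq).congr_deriv ?_
  simp only [Complex.sq_norm, Complex.normSq_apply]
  simp only [geodesicField, Complex.inner, pow_two, Complex.mul_re, Complex.mul_im,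
    Complex.conj_re, Complex.conj_im, Complex.sub_re, Complex.sub_im]
  ring

/-- The term with the squared imaginary part is the curvature term: Gauss curvature `-2 e^{-|z|²}`
times the squared area spanned by velocity and field, with the sign that makes it nonnegative. -/
theorem hasDerivAt_inner (h : IsJacobi c J K) {t : ℝ} (ht : t ∈ Icc (0 : ℝ) 1) :
    HasDerivAt (fun t => 2 * Real.exp (‖(c t).1‖ ^ 2) * inner ℝ (K t) (J t))
      (2 * Real.exp (‖(c t).1‖ ^ 2) * (‖K t‖ ^ 2 + 2 * (((c t).2 * conj (J t)).im) ^ 2)) t := by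
  refine (((h.geodesic t ht).fst_comp.norm_sq.exp.const_mul 2).mul
    ((h.deriv_snd t ht).inner ℝ (h.deriv_fst t ht))).congr_deriv ?_
  simp only [Complex.sq_norm, Complex.normSq_apply]
  simp only [geodesicField, Complex.inner, pow_two, Complex.mul_re, Complex.mul_im,
    Complex.conj_re, Complex.conj_im, Complex.sub_re, Complex.sub_im, Complex.add_re,
    Complex.add_im, Complex.neg_re, Complex.neg_im]
  ring

theorem sq_inner_le (z K J : ℂ) (w : ℝ) (hw : 0 ≤ w) :
    (2 * Real.exp (‖z‖ ^ 2) * inner ℝ K J) ^ 2 ≤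
      2 * (Real.exp (‖z‖ ^ 2) * ‖J‖ ^ 2) * (2 * Real.exp (‖z‖ ^ 2) * (‖K‖ ^ 2 + 2 * w)) := by
  have h := abs_real_inner_le_norm K J
  have h2 : inner ℝ K J ^ 2 ≤ (‖K‖ * ‖J‖) ^ 2 := sq_le_sq' (by linarith [neg_abs_le (inner ℝ K J)])
    ((le_abs_self _).trans h)
  have h3 : 0 ≤ ‖J‖ ^ 2 * w := by positivity
  have : 0 < Real.exp (‖z‖ ^ 2) ^ 2 := by positivity
  nlinarith [mul_le_mul_of_nonneg_left h2 this.le, mul_nonneg this.le h3]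

/-- In nonpositive curvature the length of a Jacobi field is convex, so a field that vanishes at
time one lies below its chord. -/
theorem normSq_le (h : IsJacobi c J K) (h1 : J 1 = 0) {t : ℝ} (ht : t ∈ Icc (0 : ℝ) 1) :
    Real.exp (‖(c t).1‖ ^ 2) * ‖J t‖ ^ 2 ≤ (1 - t) ^ 2 * (Real.exp (‖(c 0).1‖ ^ 2) * ‖J 0‖ ^ 2) :=
  le_sq_mul_of_sq_deriv_le (fun _ ht => h.hasDerivAt_normSq ht) (fun _ ht => h.hasDerivAt_inner ht)
    (fun _ _ => by positivity) (fun _ _ => by positivity)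
    (fun _ _ => sq_inner_le _ _ _ _ (by positivity)) (by simp [h1]) ht

/-- Comparison of the derivatives at `0` in `normSq_le`, where both sides agree. Geometrically, the
Hessian of half the squared distance to a point is at least the metric. -/
theorem inner_le (h : IsJacobi c J K) (h1 : J 1 = 0) : inner ℝ (K 0) (J 0) ≤ -‖J 0‖ ^ 2 := by
  have h0 : (0 : ℝ) ∈ Icc (0 : ℝ) 1 := left_mem_Icc.2 zero_le_one
  set n₀ := Real.exp (‖(c 0).1‖ ^ 2) * ‖J 0‖ ^ 2 with hn₀
  have hsq : HasDerivAt (fun t : ℝ => (1 - t) ^ 2 * n₀) (-2 * n₀) 0 := by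
    refine ((((hasDerivAt_id (0 : ℝ)).const_sub 1).pow 2).mul_const n₀).congr_deriv ?_
    simp
  have := deriv_nonneg_of_forall_nonneg (hsq.sub (h.hasDerivAt_normSq h0)) (by simp [hn₀])
    (fun t ht => sub_nonneg.2 (h.normSq_le h1 ht))
  have he : 0 < Real.exp (‖(c 0).1‖ ^ 2) := Real.exp_pos _
  rw [hn₀] at this
  by_contra! hlt
  nlinarith [mul_lt_mul_of_pos_left hlt he]

/-- Equality in `inner_le` forces the Jacobi field to be tangential at its starting point. -/
theorem im_eq_zero (h : IsJacobi c J K) (h1 : J 1 = 0) (heq : inner ℝ (K 0) (J 0) = -‖J 0‖ ^ 2) :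
    ((c 0).2 * conj (J 0)).im = 0 := by
  have h0 : (0 : ℝ) ∈ Icc (0 : ℝ) 1 := left_mem_Icc.2 zero_le_one
  set n₀ := Real.exp (‖(c 0).1‖ ^ 2) * ‖J 0‖ ^ 2 with hn₀
  have hd1 : ∀ t : ℝ, HasDerivAt (fun t : ℝ => (1 - t) ^ 2 * n₀) (-2 * (1 - t) * n₀) t := fun t => by
    refine ((((hasDerivAt_id t).const_sub 1).pow 2).mul_const n₀).congr_deriv ?_
    simp
  have hd2 : HasDerivAt (fun t : ℝ => -2 * (1 - t) * n₀) (2 * n₀) 0 := by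
    refine ((((hasDerivAt_id (0 : ℝ)).const_sub 1).const_mul (-2)).mul_const n₀).congr_deriv ?_
    simp
  -- In the case of equality the chord bound is an equality to first order at `0`, so second
  -- derivatives can be compared; Cauchy–Schwarz then leaves no room for the curvature term.
  have key := deriv2_nonneg_of_forall_nonneg
    (fun t ht => (hd1 t).sub (h.hasDerivAt_normSq ht)) (hd2.sub (h.hasDerivAt_inner h0))
    (by simp [hn₀]) (by rw [heq, hn₀]; ring) (fun t ht => sub_nonneg.2 (h.normSq_le h1 ht))
  have he : 0 < Real.exp (‖(c 0).1‖ ^ 2) := Real.exp_pos _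
  have h2 : ‖K 0‖ ^ 2 + 2 * (((c 0).2 * conj (J 0)).im) ^ 2 ≤ ‖J 0‖ ^ 2 := by
    rw [hn₀] at key
    by_contra! hlt
    nlinarith [mul_lt_mul_of_pos_left hlt he]
  have h3 := abs_real_inner_le_norm (K 0) (J 0)
  rw [heq, abs_neg, abs_of_nonneg (sq_nonneg _)] at h3
  rcases (norm_nonneg (J 0)).eq_or_lt' with h4 | h4
  · rw [norm_eq_zero.1 h4]; simp
  · have h5 : ‖J 0‖ ≤ ‖K 0‖ := by
      rw [pow_two] at h3; exact le_of_mul_le_mul_right h3 h4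
    have : ((c 0).2 * conj (J 0)).im ^ 2 ≤ 0 := by nlinarith
    exact pow_eq_zero_iff two_ne_zero |>.1 (le_antisymm this (sq_nonneg _))

/-- Divide the chord bound by `(1 - t)²` and let `t → 1`, where the difference quotients of `J` tend
to `K 1`. This bounds the mixed second derivative of half the squared distance. -/
theorem norm_snd_one_le (h : IsJacobi c J K) (h1 : J 1 = 0) :
    Real.exp (‖(c 1).1‖ ^ 2) * ‖K 1‖ ^ 2 ≤ Real.exp (‖(c 0).1‖ ^ 2) * ‖J 0‖ ^ 2 := by
  have hi : (1 : ℝ) ∈ Icc (0 : ℝ) 1 := right_mem_Icc.2 zero_le_one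
  have hJ : HasDerivAt J (K 1) 1 := by simpa [h1] using h.deriv_fst 1 hi
  have hs := (hasDerivAt_iff_tendsto_slope.1 hJ).mono_left
    (nhdsWithin_mono 1 (fun t (ht : t ∈ Iio (1 : ℝ)) => (ne_of_lt ht : t ≠ 1)))
  have hc : Tendsto (fun t => Real.exp (‖(c t).1‖ ^ 2)) (𝓝[<] 1) (𝓝 (Real.exp (‖(c 1).1‖ ^ 2))) :=
    (h.geodesic 1 hi).fst_comp.norm_sq.exp.continuousAt.mono_left inf_le_left
  refine le_of_tendsto (hc.mul (hs.norm.pow 2)) ?_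
  filter_upwards [Ioo_mem_nhdsLT (zero_lt_one (α := ℝ))] with t ht
  have ht1 : (0 : ℝ) < (1 - t) ^ 2 := by have := ht.2; have : 0 < 1 - t := by linarith
                                         positivity
  have := h.normSq_le h1 (Ioo_subset_Icc_self ht)
  rw [slope_def_module, h1, sub_zero, norm_smul, mul_pow, norm_inv, inv_pow, Real.norm_eq_abs, sq_abs]
  have e : (t - 1) ^ 2 = (1 - t) ^ 2 := by ring
  rw [e]
  have h5 : Real.exp (‖(c t).1‖ ^ 2) * (((1 - t) ^ 2)⁻¹ * ‖J t‖ ^ 2)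
      = (Real.exp (‖(c t).1‖ ^ 2) * ‖J t‖ ^ 2) / (1 - t) ^ 2 := by field_simp
  rw [h5, div_le_iff₀ ht1]
  linarith

/-- There are no conjugate points: the chord bound is zero, so the whole field vanishes. -/
theorem eq_zero_of_eq_zero (h : IsJacobi c J K) (h0 : J 0 = 0) (h1 : J 1 = 0) : K 0 = 0 := by
  have hz : ∀ t ∈ Icc (0 : ℝ) 1, J t = 0 := fun t ht => by
    have := h.normSq_le h1 ht
    rw [h0, norm_zero, zero_pow two_ne_zero, mul_zero, mul_zero] at this
    have h2 : ‖J t‖ ^ 2 ≤ 0 := by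
      by_contra! hlt
      have := mul_pos (Real.exp_pos (‖(c t).1‖ ^ 2)) hlt
      linarith
    simpa using le_antisymm h2 (sq_nonneg _)
  have hi : (0 : ℝ) ∈ Icc (0 : ℝ) 1 := left_mem_Icc.2 zero_le_one
  have hJ : HasDerivAt J (K 0) 0 := by simpa [h0] using h.deriv_fst 0 hi
  have hs := (hasDerivAt_iff_tendsto_slope.1 hJ).mono_left
    (nhdsWithin_mono 0 (fun t (ht : t ∈ Ioi (0 : ℝ)) => (ne_of_gt ht : t ≠ 0)))
  refine tendsto_nhds_unique hs (tendsto_const_nhds.congr' ?_)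
  filter_upwards [Ioo_mem_nhdsGT (zero_lt_one (α := ℝ))] with t ht
  simp [slope_def_module, h0, hz t (Ioo_subset_Icc_self ht)]

end IsJacobi

/-! ### Unique geodesics between pairs of points. -/

/-- An open and closed, locally injective map to a connected space is bijective as soon as one of
its fibres is a singleton. -/
theorem bijective_of_existsUnique {X Y : Type*} [TopologicalSpace X] [TopologicalSpace Y]
    [T2Space X] [PreconnectedSpace Y] {f : X → Y} (ho : IsOpenMap f) (hc : IsClosedMap f)
    (hi : ∀ x, ∃ U, IsOpen U ∧ x ∈ U ∧ InjOn f U) {y₀ : Y} (hy₀ : ∃! x, f x = y₀) :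
    Function.Bijective f := by
  set S : Set Y := {y | ∃! x, f x = y}
  -- Near a point with a single preimage `p`, openness gives a preimage close to `p`, local
  -- injectivity makes it unique there, and closedness excludes preimages far from `p`.
  have hopen : IsOpen S := by
    rw [isOpen_iff_mem_nhds]
    rintro y ⟨p, hp, hu⟩
    obtain ⟨U, hU, hpU, hinj⟩ := hi p
    have h1 : f '' U ∈ 𝓝 y := (ho U hU).mem_nhds ⟨p, hpU, hp⟩
    have h2 : (f '' Uᶜ)ᶜ ∈ 𝓝 y := (hc _ hU.isClosed_compl).isOpen_compl.mem_nhds (by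
      rintro ⟨q, hq, hqy⟩
      exact hq (hu q hqy ▸ hpU))
    filter_upwards [h1, h2] with z ⟨q, hq, hqz⟩ hz
    refine ⟨q, hqz, fun r hr => hinj ?_ hq (hr.trans hqz.symm)⟩
    by_contra hrU
    exact hz ⟨r, hrU, hr⟩
  -- Two distinct preimages persist because the map is open, and an empty fibre persists because the
  -- range is closed.
  have hclosed : IsClosed S := by
    rw [← isOpen_compl_iff, isOpen_iff_mem_nhds]
    intro y hy
    by_cases hr : y ∈ range f
    · obtain ⟨p, hp⟩ := hr
      have : ∃ q, f q = y ∧ q ≠ p := by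
        by_contra! hcon
        exact hy ⟨p, hp, hcon⟩
      obtain ⟨q, hq, hqp⟩ := this
      obtain ⟨U, W, hU, hW, hqU, hpW, hd⟩ := t2_separation hqp
      filter_upwards [(ho U hU).mem_nhds ⟨q, hqU, hq⟩, (ho W hW).mem_nhds ⟨p, hpW, hp⟩]
        with z ⟨a, ha, haz⟩ ⟨b, hb, hbz⟩ ⟨e, _, he⟩
      have hab : a = b := (he a haz).trans (he b hbz).symm
      exact disjoint_left.1 hd ha (hab ▸ hb)
    · have hrc : IsClosed (range f) := by simpa using hc univ isClosed_univ
      filter_upwards [hrc.isOpen_compl.mem_nhds hr] with z hz ⟨e, he, _⟩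
      exact hz ⟨e, he⟩
  have huniv : S = univ := IsClopen.eq_univ ⟨hclosed, hopen⟩ ⟨y₀, hy₀⟩
  have hall : ∀ y, ∃! x, f x = y := fun y => (huniv ▸ mem_univ y : y ∈ S)
  exact (Function.bijective_iff_existsUnique f).2 hall

/-- Along a geodesic of squared speed `ℓ` the function `e^{|z|²}` has second derivative at least
`2ℓ`. Convexity of `e^{|z|²} - ℓ t²`, read at the midpoint where `e^{|z|²} ≥ 1`, bounds `ℓ` by the
end points. The constant is sharp enough to give `ℓ ≤ 0` when both end points are the origin. -/
theorem IsGeodesic.speedSq_le {c : ℝ → ℂ × ℂ} (hc : IsGeodesic c) :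
    speedSq (c 0) ≤ 2 * (Real.exp (‖(c 0).1‖ ^ 2) + Real.exp (‖(c 1).1‖ ^ 2)) - 4 := by
  set ℓ := speedSq (c 0) with hℓ
  have h₁ : ∀ t ∈ Icc (0 : ℝ) 1, HasDerivAt (fun t => Real.exp (‖(c t).1‖ ^ 2) - ℓ * t ^ 2)
      (Real.exp (‖(c t).1‖ ^ 2) * (2 * inner ℝ (c t).1 (c t).2) - ℓ * (2 * t)) t := fun t ht => by
    refine ((hc t ht).fst_comp.norm_sq.exp.sub (((hasDerivAt_id t).pow 2).const_mul ℓ)).congr_deriv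
      ?_
    simp [geodesicField]
  have h₂ : ∀ t ∈ Icc (0 : ℝ) 1, HasDerivAt (fun t =>
      Real.exp (‖(c t).1‖ ^ 2) * (2 * inner ℝ (c t).1 (c t).2) - ℓ * (2 * t))
      (2 * Real.exp (‖(c t).1‖ ^ 2) * (‖(c t).1‖ ^ 2 * ‖(c t).2‖ ^ 2)) t := fun t ht => by
    refine (((hc t ht).fst_comp.norm_sq.exp.mul
      (((hc t ht).fst_comp.inner ℝ (hc t ht).snd_comp).const_mul 2)).sub
      (((hasDerivAt_id t).const_mul 2).const_mul ℓ)).congr_deriv ?_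
    rw [hℓ, ← hc.speedSq_eq ht, speedSq]
    simp only [Complex.sq_norm, Complex.normSq_apply]
    simp only [geodesicField, Complex.inner, pow_two, Complex.mul_re, Complex.mul_im,
      Complex.conj_re, Complex.conj_im, Complex.neg_re, Complex.neg_im]
    ring
  have hconv : ConvexOn ℝ (Icc (0 : ℝ) 1) fun t => Real.exp (‖(c t).1‖ ^ 2) - ℓ * t ^ 2 :=
    convexOn_of_hasDerivWithinAt2_nonneg (convex_Icc 0 1)
      (fun t ht => (h₁ t ht).continuousAt.continuousWithinAt)
      (fun t ht => (h₁ t (interior_subset ht)).hasDerivWithinAt)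
      (fun t ht => (h₂ t (interior_subset ht)).hasDerivWithinAt) fun t _ => by positivity
  have h := hconv.2 (left_mem_Icc.2 zero_le_one) (right_mem_Icc.2 zero_le_one)
    (by norm_num : (0 : ℝ) ≤ 1 / 2) (by norm_num : (0 : ℝ) ≤ 1 / 2) (by norm_num)
  simp only [smul_eq_mul] at h
  have h3 : 1 ≤ Real.exp (‖(c (1 / 2 * 0 + 1 / 2 * 1)).1‖ ^ 2) := Real.one_le_exp (by positivity)
  linarith

/-- The map that sends the initial data of a geodesic to its pair of end points. -/
def geodesicEndpoints (q : ℂ × ℂ) : ℂ × ℂ := (q.1, (geodesicFlow q 1).1)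

/-- The derivative of the end point map is injective because there are no conjugate points, hence
invertible by dimension. The Jacobi fields are returned as well, since they carry the estimates for
the inverse map. -/
theorem exists_linearization_geodesicEndpoints (q : ℂ × ℂ) :
    ∃ (e : (ℂ × ℂ) ≃L[ℝ] ℂ × ℂ) (L : ℂ × ℂ →L[ℝ] ℂ × ℂ),
      HasStrictFDerivAt geodesicEndpoints (e : ℂ × ℂ →L[ℝ] ℂ × ℂ) q ∧
      HasStrictFDerivAt (fun q => geodesicFlow q 1) L q ∧
      ∀ δ, e δ = (δ.1, (L δ).1) ∧ ∃ J K, IsJacobi (geodesicFlow q) J K ∧ J 0 = δ.1 ∧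
        K 0 = δ.2 + conj q.1 * q.2 * δ.1 ∧ J 1 = (L δ).1 ∧
        K 1 = (L δ).2 + conj (geodesicFlow q 1).1 * (geodesicFlow q 1).2 * (L δ).1 := by
  obtain ⟨L, hL0, hL, hd⟩ := exists_hasStrictFDerivAt_geodesicFlow q
  set D : ℂ × ℂ →L[ℝ] ℂ × ℂ :=
    (ContinuousLinearMap.fst ℝ ℂ ℂ).prod ((ContinuousLinearMap.fst ℝ ℂ ℂ).comp (L 1)) with hD
  have hDd : HasStrictFDerivAt geodesicEndpoints D q :=
    hasStrictFDerivAt_fst.prodMk (hasStrictFDerivAt_fst.comp q hd)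
  have hJ := fun δ => isJacobi_of_linearization hL δ
  have hinj : Function.Injective (D : ℂ × ℂ →ₗ[ℝ] ℂ × ℂ) := by
    rw [← LinearMap.ker_eq_bot, LinearMap.ker_eq_bot']
    intro δ hδ
    have h1 : δ.1 = 0 := congrArg Prod.fst hδ
    have h2 : (L 1 δ).1 = 0 := congrArg Prod.snd hδ
    have := (hJ δ).eq_zero_of_eq_zero (by simp [hL0, h1]) h2
    simp only [hL0, ContinuousLinearMap.id_apply, h1, mul_zero, add_zero] at this
    exact Prod.ext h1 this
  refine ⟨(LinearEquiv.ofInjectiveEndo _ hinj).toContinuousLinearEquiv, L 1, ?_, hd,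
    fun δ => ⟨rfl, _, _, hJ δ, by simp [hL0], by simp [hL0], rfl, rfl⟩⟩
  exact hDd

/-- A Cartan–Hadamard argument without covering spaces: the map is a local diffeomorphism, and
`IsGeodesic.speedSq_le` makes it proper. The same estimate shows that only the constant geodesic
joins the origin to itself, which is the singleton fibre needed. -/
theorem bijective_geodesicEndpoints : Function.Bijective geodesicEndpoints := by
  have hcont : Continuous geodesicEndpoints := continuous_iff_continuousAt.2 fun q => by
    obtain ⟨e, L, he, -⟩ := exists_linearization_geodesicEndpoints q
    exact he.continuousAt
  have hopen : IsOpenMap geodesicEndpoints := by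
    rw [isOpenMap_iff_nhds_le]
    intro q
    obtain ⟨e, L, he, -⟩ := exists_linearization_geodesicEndpoints q
    exact he.map_nhds_eq_of_equiv.ge
  have hsp : ∀ q, speedSq q ≤
      2 * (Real.exp (‖q.1‖ ^ 2) + Real.exp (‖(geodesicEndpoints q).2‖ ^ 2)) - 4 := fun q => by
    simpa [geodesicEndpoints] using (isGeodesic_geodesicFlow q).speedSq_le
  have hproper : IsProperMap geodesicEndpoints := by
    refine isProperMap_iff_isCompact_preimage.2 ⟨hcont, fun S hS => ?_⟩
    refine Metric.isCompact_of_isClosed_isBounded (hS.isClosed.preimage hcont) ?_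
    obtain ⟨R, hR⟩ := hS.isBounded.exists_norm_le
    refine isBounded_iff_forall_norm_le.2 ⟨max R √(2 * (Real.exp (R ^ 2) + Real.exp (R ^ 2)) - 4),
      fun q hq => ?_⟩
    have h1 : ‖q.1‖ ≤ R := (norm_fst_le (geodesicEndpoints q)).trans (hR _ hq)
    have h2 : ‖(geodesicEndpoints q).2‖ ≤ R := (norm_snd_le _).trans (hR _ hq)
    refine max_le_max h1 ((norm_snd_le_sqrt_speedSq q).trans (Real.sqrt_le_sqrt ((hsp q).trans ?_)))
    gcongr
  refine bijective_of_existsUnique hopen hproper.isClosedMap (fun q => ?_) (y₀ := 0)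
    ⟨0, ?_, fun q hq => ?_⟩
  · obtain ⟨e, L, he, -⟩ := exists_linearization_geodesicEndpoints q
    exact ⟨_, (he.toOpenPartialHomeomorph _).open_source, he.mem_toOpenPartialHomeomorph_source,
      (he.toOpenPartialHomeomorph _).injOn⟩
  · have hg : IsGeodesic fun _ => (0 : ℂ × ℂ) := fun t _ =>
      (hasDerivAt_const t _).congr_deriv (by simp [geodesicField, Prod.ext_iff])
    have := hg.eq_geodesicFlow
    simp [geodesicEndpoints, ← this]
  · have h1 : q.1 = 0 := congrArg Prod.fst hq
    have h2 : speedSq q ≤ 0 := by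
      have := hsp q
      rw [hq, h1] at this
      norm_num at this
      exact this
    have h3 := norm_snd_le_sqrt_speedSq q
    rw [Real.sqrt_eq_zero_of_nonpos h2] at h3
    exact Prod.ext h1 (norm_le_zero_iff.1 h3)

/-! ### Initial velocities of connecting geodesics and their variation. -/

/-- The pairs of points of the plane are in bijection with the initial data of geodesics. -/
def geodesicData : ℂ × ℂ → ℂ × ℂ := (Equiv.ofBijective _ bijective_geodesicEndpoints).symm

theorem geodesicEndpoints_geodesicData (q : ℂ × ℂ) : geodesicEndpoints (geodesicData q) = q :=
  (Equiv.ofBijective _ bijective_geodesicEndpoints).apply_symm_apply q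

theorem geodesicData_geodesicEndpoints (q : ℂ × ℂ) : geodesicData (geodesicEndpoints q) = q :=
  (Equiv.ofBijective _ bijective_geodesicEndpoints).symm_apply_apply q

theorem hasStrictFDerivAt_geodesicData {q : ℂ × ℂ} {e : (ℂ × ℂ) ≃L[ℝ] ℂ × ℂ}
    (he : HasStrictFDerivAt geodesicEndpoints (e : ℂ × ℂ →L[ℝ] ℂ × ℂ) (geodesicData q)) :
    HasStrictFDerivAt geodesicData (e.symm : ℂ × ℂ →L[ℝ] ℂ × ℂ) q := by
  refine HasStrictFDerivAt.of_local_left_inverse ?_ he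
    (Eventually.of_forall geodesicEndpoints_geodesicData)
  have h := he.map_nhds_eq_of_equiv
  rw [geodesicEndpoints_geodesicData] at h
  rw [ContinuousAt, ← h, tendsto_map'_iff]
  have : geodesicData ∘ geodesicEndpoints = id := funext geodesicData_geodesicEndpoints
  rw [this]
  exact tendsto_id

/-- Initial velocity of the geodesic from `x` to `y`. -/
def geodesicVelocity (x y : ℂ) : ℂ := (geodesicData (x, y)).2

theorem geodesicData_fst (x y : ℂ) : (geodesicData (x, y)).1 = x :=
  congrArg Prod.fst (geodesicEndpoints_geodesicData (x, y))

theorem geodesicData_eq (x y : ℂ) : geodesicData (x, y) = (x, geodesicVelocity x y) :=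
  Prod.ext (geodesicData_fst x y) rfl

theorem geodesicFlow_geodesicVelocity_fst (x y : ℂ) :
    (geodesicFlow (x, geodesicVelocity x y) 1).1 = y := by
  have := congrArg Prod.snd (geodesicEndpoints_geodesicData (x, y))
  rwa [geodesicData_eq] at this

theorem geodesicVelocity_eq_of_fst_eq {x y v : ℂ} (h : (geodesicFlow (x, v) 1).1 = y) :
    geodesicVelocity x y = v := by
  have : geodesicEndpoints (x, v) = (x, y) := Prod.ext rfl h
  rw [geodesicVelocity, ← this, geodesicData_geodesicEndpoints]

theorem geodesicFlow_geodesicVelocity (x y : ℂ) :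
    geodesicFlow (x, geodesicVelocity x y) 1 = (y, -geodesicVelocity y x) := by
  refine Prod.ext (geodesicFlow_geodesicVelocity_fst x y) ?_
  have h := geodesicFlow_reverse (x, geodesicVelocity x y)
  rw [geodesicFlow_geodesicVelocity_fst] at h
  have := geodesicVelocity_eq_of_fst_eq (congrArg Prod.fst h)
  simp [this]

theorem geodesicVelocity_injective (x : ℂ) : Function.Injective (geodesicVelocity x) := by
  intro y z h
  rw [← geodesicFlow_geodesicVelocity_fst x y, h, geodesicFlow_geodesicVelocity_fst]

@[simp] theorem geodesicVelocity_self (x : ℂ) : geodesicVelocity x x = 0 := by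
  apply geodesicVelocity_eq_of_fst_eq
  have hg : IsGeodesic fun _ => (x, (0 : ℂ)) := fun t _ =>
    (hasDerivAt_const t _).congr_deriv (by simp [geodesicField, Prod.ext_iff])
  rw [← hg.eq_geodesicFlow]

theorem geodesicVelocity_eq_zero {x y : ℂ} : geodesicVelocity x y = 0 ↔ x = y :=
  ⟨fun h => (geodesicVelocity_injective x (h.trans (geodesicVelocity_self x).symm)).symm,
    fun h => by rw [h, geodesicVelocity_self]⟩

/-- First variation of the geodesic from a moving point to a fixed point. -/
theorem exists_hasDerivWithinAt_geodesicVelocity {x : ℝ → ℂ} {x' : ℂ} {D : Set ℝ} {s : ℝ}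
    (hx : HasDerivWithinAt x x' D s) (y : ℂ) :
    ∃ v w : ℂ, HasDerivWithinAt (fun s => geodesicVelocity (x s) y) v D s ∧
      HasDerivWithinAt (fun s => geodesicVelocity y (x s)) w D s ∧
      inner ℝ (v + conj (x s) * geodesicVelocity (x s) y * x') x' ≤ -‖x'‖ ^ 2 ∧
      (inner ℝ (v + conj (x s) * geodesicVelocity (x s) y * x') x' = -‖x'‖ ^ 2 →
        (geodesicVelocity (x s) y * conj x').im = 0) ∧
      Real.exp (‖y‖ ^ 2) * ‖w‖ ^ 2 ≤ Real.exp (‖x s‖ ^ 2) * ‖x'‖ ^ 2 := by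
  obtain ⟨e, L, he, hL, hJ⟩ := exists_linearization_geodesicEndpoints (geodesicData (x s, y))
  have hd := (hasStrictFDerivAt_geodesicData he).hasFDerivAt
  have hxy : HasDerivWithinAt (fun s => (x s, y)) (x', 0) D s :=
    hx.prodMk (hasDerivWithinAt_const s D y)
  have h1 : HasDerivWithinAt (fun s => geodesicData (x s, y)) (e.symm (x', 0)) D s :=
    
    HasFDerivAt.comp_hasDerivWithinAt (f := fun s => (x s, y)) (l := geodesicData) s hd hxy
  have h2 : HasDerivWithinAt (fun s => geodesicFlow (geodesicData (x s, y)) 1)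
      (L (e.symm (x', 0))) D s :=
    HasFDerivAt.comp_hasDerivWithinAt (f := fun s => geodesicData (x s, y))
      (l := fun q => geodesicFlow q 1) s hL.hasFDerivAt h1
  obtain ⟨hδ, J, K, hJK, hJ0, hK0, hJ1, hK1⟩ := hJ (e.symm (x', 0))
  set δ := e.symm (x', 0)
  rw [e.apply_symm_apply] at hδ
  have hδ1 : δ.1 = x' := (congrArg Prod.fst hδ).symm
  have hL1 : (L δ).1 = 0 := (congrArg Prod.snd hδ).symm
  rw [hL1] at hJ1 hK1
  rw [hδ1] at hJ0 hK0
  rw [mul_zero, add_zero] at hK1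
  rw [geodesicData_eq] at hK0 hJK
  -- The geodesic from `x` to `y` arrives at `y` with velocity `-geodesicVelocity y x`, hence the
  -- sign of the second derivative.
  refine ⟨δ.2, -(L δ).2, ?_, ?_, ?_, fun h => ?_, ?_⟩
  · exact (ContinuousLinearMap.snd ℝ ℂ ℂ).hasFDerivAt.comp_hasDerivWithinAt s h1
  · have := ((ContinuousLinearMap.snd ℝ ℂ ℂ).hasFDerivAt.comp_hasDerivWithinAt s h2).neg
    refine this.congr_of_eventuallyEq ?_ ?_
    · filter_upwards with s
      simp [geodesicData_eq, geodesicFlow_geodesicVelocity]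
    · simp [geodesicData_eq, geodesicFlow_geodesicVelocity]
  · have := hJK.inner_le hJ1
    rwa [hJ0, hK0] at this
  · have := hJK.im_eq_zero hJ1 (by rw [hJ0, hK0]; exact h)
    rwa [hJ0, geodesicFlow_zero] at this
  · have := hJK.norm_snd_one_le hJ1
    rwa [hJ0, hK1, geodesicFlow_geodesicVelocity, geodesicFlow_zero, ← norm_neg (L δ).2] at this

/-- The left side is the Riemannian distance, and the straight segment, which stays in the ball of
radius `R`, has length at most the right side. The bound is obtained by moving the target along the
segment and integrating the derivative of the initial velocity. -/
theorem norm_exp_mul_geodesicVelocity_le {x y : ℂ} {R : ℝ} (hx : ‖x‖ ≤ R) (hy : ‖y‖ ≤ R) :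
    Real.exp (‖x‖ ^ 2 / 2) * ‖geodesicVelocity x y‖ ≤ Real.exp (R ^ 2 / 2) * ‖y - x‖ := by
  set q : ℝ → ℂ := fun t => x + t • (y - x) with hq
  have hqd : ∀ t, HasDerivWithinAt q (y - x) (Icc 0 1) t := fun t => by
    simpa [hq] using ((((hasDerivAt_id t).smul_const (y - x)).const_add x).hasDerivWithinAt
      (s := Icc 0 1))
  have hqR : ∀ t ∈ Icc (0 : ℝ) 1, ‖q t‖ ≤ R := fun t ht => by
    have : q t ∈ Metric.closedBall (0 : ℂ) R :=
      (convex_closedBall (0 : ℂ) R).segment_subset (mem_closedBall_zero_iff.2 hx)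
        (mem_closedBall_zero_iff.2 hy)
        (segment_eq_image' ℝ x y ▸ mem_image_of_mem (fun t : ℝ => x + t • (y - x)) ht)
    exact mem_closedBall_zero_iff.1 this
  have hsq : ∀ a : ℝ, Real.exp (a ^ 2) = Real.exp (a ^ 2 / 2) ^ 2 := fun a => by
    rw [← Real.exp_nat_mul]; congr 1; push_cast; ring
  choose v w hv hw h1 h2 h3 using fun t => exists_hasDerivWithinAt_geodesicVelocity (hqd t) x
  have hex := Real.exp_pos (‖x‖ ^ 2 / 2)
  have hbound : ∀ t ∈ Icc (0 : ℝ) 1,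
      ‖w t‖ ≤ Real.exp (R ^ 2 / 2) * ‖y - x‖ / Real.exp (‖x‖ ^ 2 / 2) := fun t ht => by
    rw [le_div_iff₀ hex]
    refine abs_le_of_sq_le_sq' ?_ (by positivity) |>.2
    have h5 : Real.exp (‖q t‖ ^ 2) ≤ Real.exp (R ^ 2) := by
      have := hqR t ht; gcongr
    have := h3 t
    rw [hsq] at this
    rw [mul_pow, mul_pow, ← hsq R, mul_comm]
    exact this.trans (mul_le_mul_of_nonneg_right h5 (sq_nonneg _))
  have := (convex_Icc (0 : ℝ) 1).norm_image_sub_le_of_norm_hasDerivWithin_le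
    (fun t _ => hw t) hbound (left_mem_Icc.2 zero_le_one) (right_mem_Icc.2 zero_le_one)
  simp only [hq, one_smul, zero_smul, add_zero, add_sub_cancel, geodesicVelocity_self, sub_zero,
    norm_one, mul_one] at this
  rw [le_div_iff₀ hex] at this
  linarith

/-! ### Expander arcs and the monotonicity of the first variation. -/

/-- An arc, parametrized by the interval `D`, which solves the self-expander equation. -/
structure ExpanderArc (γ : ℝ → ℂ) (D : Set ℝ) : Prop where
  convex : Convex ℝ D
  uniqueDiff : UniqueDiffOn ℝ D
  smooth : ContDiffOn ℝ ∞ γ D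
  immersed : ∀ s ∈ D, derivWithin γ D s ≠ 0
  expander : ∀ s ∈ D, curvatureVector γ D s = normalPart γ D s (γ s)

/-- Derivative of half the squared distance from `x` to `y` in the metric `e^{|z|²} |dz|²` when
`x` and `y` move with unit speed in the directions `τ` and `τ'`. -/
def firstVariation (x τ y τ' : ℂ) : ℝ :=
  -(Real.exp (‖x‖ ^ 2 / 2) * inner ℝ (geodesicVelocity x y) τ +
    Real.exp (‖y‖ ^ 2 / 2) * inner ℝ (geodesicVelocity y x) τ')

theorem firstVariation_comm (x τ y τ' : ℂ) :
    firstVariation x τ y τ' = firstVariation y τ' x τ := by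
  unfold firstVariation; ring

@[simp] theorem firstVariation_self (x τ τ' : ℂ) : firstVariation x τ x τ' = 0 := by
  simp [firstVariation]

theorem abs_firstVariation_le {x τ y τ' : ℂ} {R : ℝ} (hx : ‖x‖ ≤ R) (hy : ‖y‖ ≤ R)
    (hτ : ‖τ‖ ≤ 1) (hτ' : ‖τ'‖ ≤ 1) :
    |firstVariation x τ y τ'| ≤ 2 * (Real.exp (R ^ 2 / 2) * ‖y - x‖) := by
  have key : ∀ {x τ y : ℂ}, ‖x‖ ≤ R → ‖y‖ ≤ R → ‖τ‖ ≤ 1 →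
      |Real.exp (‖x‖ ^ 2 / 2) * inner ℝ (geodesicVelocity x y) τ| ≤
        Real.exp (R ^ 2 / 2) * ‖y - x‖ := fun {x τ y} hx hy hτ => by
    refine le_trans ?_ (norm_exp_mul_geodesicVelocity_le hx hy)
    rw [abs_mul, abs_of_pos (Real.exp_pos _)]
    have := abs_real_inner_le_norm (geodesicVelocity x y) τ
    gcongr
    exact this.trans (mul_le_of_le_one_right (norm_nonneg _) hτ)
  have h1 := key hx hy hτ
  have h2 := key hy hx hτ'
  rw [norm_sub_rev] at h2
  rw [firstVariation, abs_neg]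
  exact (abs_add_le _ _).trans (by linarith)

namespace ExpanderArc

variable {γ : ℝ → ℂ} {D : Set ℝ}

theorem hasDerivWithinAt (h : ExpanderArc γ D) {s : ℝ} (hs : s ∈ D) :
    HasDerivWithinAt γ (derivWithin γ D s) D s :=
  ((h.smooth.differentiableOn (by simp)) s hs).hasDerivWithinAt

theorem continuousOn (h : ExpanderArc γ D) : ContinuousOn γ D := h.smooth.continuousOn

theorem hasDerivWithinAt_derivWithin (h : ExpanderArc γ D) {s : ℝ} (hs : s ∈ D) :
    HasDerivWithinAt (derivWithin γ D) (derivWithin (derivWithin γ D) D s) D s :=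
  (((h.smooth.derivWithin (m := 1) h.uniqueDiff (by norm_cast)).differentiableOn
    one_ne_zero) s hs).hasDerivWithinAt

theorem norm_derivWithin_pos (h : ExpanderArc γ D) {s : ℝ} (hs : s ∈ D) :
    0 < ‖derivWithin γ D s‖ := norm_pos_iff.2 (h.immersed s hs)

theorem norm_unitTangent (h : ExpanderArc γ D) {s : ℝ} (hs : s ∈ D) : ‖unitTangent γ D s‖ = 1 := by
  rw [unitTangent, norm_smul, norm_inv, norm_norm, inv_mul_cancel₀ (h.norm_derivWithin_pos hs).ne']

theorem derivWithin_eq (h : ExpanderArc γ D) {s : ℝ} (hs : s ∈ D) :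
    derivWithin γ D s = ‖derivWithin γ D s‖ • unitTangent γ D s := by
  rw [unitTangent, smul_smul, mul_inv_cancel₀ (h.norm_derivWithin_pos hs).ne', one_smul]

theorem hasDerivWithinAt_unitTangent (h : ExpanderArc γ D) {s : ℝ} (hs : s ∈ D) :
    HasDerivWithinAt (unitTangent γ D) (‖derivWithin γ D s‖ • normalPart γ D s (γ s)) D s := by
  have hm := h.norm_derivWithin_pos hs
  have hd := h.hasDerivWithinAt_derivWithin hs
  have hn : HasDerivWithinAt (fun s => ‖derivWithin γ D s‖)
      (inner ℝ (unitTangent γ D s) (derivWithin (derivWithin γ D) D s)) D s := by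
    have := hd.norm_sq.sqrt (by positivity)
    simp only [Real.sqrt_sq (norm_nonneg _)] at this
    refine this.congr_deriv ?_
    rw [unitTangent, real_inner_smul_left]
    field_simp
  have h1 := (hn.inv hm.ne').smul hd
  refine h1.congr_deriv ?_
  rw [← h.expander s hs, curvatureVector, normalPart, smul_smul]
  nth_rewrite 2 [h.derivWithin_eq hs]
  rw [smul_smul, smul_sub]
  set m := ‖derivWithin γ D s‖
  set i := inner ℝ (unitTangent γ D s) (derivWithin (derivWithin γ D) D s)
  have e1 : m * (m ^ 2)⁻¹ = m⁻¹ := by field_simp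
  have e2 : -i / m ^ 2 * m = -(m⁻¹ * i) := by field_simp
  rw [e1, e2, smul_smul, neg_smul, Pi.inv_apply]
  abel

/-- With `m` the Euclidean speed and `e = e^{|γ|²/2}`, the change of the velocity at `γ s`
contributes at least `e * m`, by the Hessian bound, and the change of the velocity at `y` at least
`-e * m * ‖τ'‖`, by the mixed bound. The expander equation cancels the terms from the turning of the
tangent and the growth of the conformal factor. If the total vanishes, the Hessian bound is an
equality, which forces tangency. -/
theorem exists_hasDerivWithinAt_firstVariation (h : ExpanderArc γ D) {s : ℝ} (hs : s ∈ D)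
    (y : ℂ) {τ' : ℂ} (hτ' : ‖τ'‖ ≤ 1) :
    ∃ a, HasDerivWithinAt (fun s => firstVariation (γ s) (unitTangent γ D s) y τ') a D s ∧
      Real.exp (‖γ s‖ ^ 2 / 2) * ‖derivWithin γ D s‖ * (1 - ‖τ'‖) ≤ a ∧
      (a = 0 → (geodesicVelocity (γ s) y * conj (unitTangent γ D s)).im = 0) := by
  obtain ⟨v, w, hv, hw, h1, h2, h3⟩ :=
    exists_hasDerivWithinAt_geodesicVelocity (h.hasDerivWithinAt hs) y
  have hm := h.norm_derivWithin_pos hs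
  have hd := h.hasDerivWithinAt hs
  have hτ := h.hasDerivWithinAt_unitTangent hs
  have hA := ((((hd.norm_sq.div_const 2).exp).mul (hv.inner ℝ hτ)).add
    ((hw.inner ℝ (hasDerivWithinAt_const s D τ')).const_mul (Real.exp (‖y‖ ^ 2 / 2)))).neg
  set m := ‖derivWithin γ D s‖ with hmdef
  set τ := unitTangent γ D s with hτdef
  have hτ1 : ‖τ‖ = 1 := h.norm_unitTangent hs
  rw [h.derivWithin_eq hs, ← hmdef, ← hτdef] at h1 h2 hA
  rw [normalPart, ← hτdef] at hA
  set e := Real.exp (‖γ s‖ ^ 2 / 2) with he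
  have hepos : 0 < e := Real.exp_pos _
  have hepos' : 0 < Real.exp (‖y‖ ^ 2 / 2) := Real.exp_pos _
  set k : ℝ := inner ℝ (v + conj (γ s) * geodesicVelocity (γ s) y * (m • τ)) τ with hk
  have hτsq : τ.re * τ.re + τ.im * τ.im = 1 := by
    rw [← Complex.normSq_apply, ← Complex.sq_norm, hτ1, one_pow]
  have hkm : inner ℝ (v + conj (γ s) * geodesicVelocity (γ s) y * (m • τ)) (m • τ) = m * k :=
    real_inner_smul_right _ _ _
  rw [hkm] at h1 h2
  have hkle : k ≤ -m := by
    by_contra! hlt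
    nlinarith
  have hwle : Real.exp (‖y‖ ^ 2 / 2) * ‖w‖ ≤ e * m := by
    refine abs_le_of_sq_le_sq' ?_ (by positivity) |>.2
    have hsq : ∀ a : ℝ, Real.exp (a ^ 2 / 2) ^ 2 = Real.exp (a ^ 2) := fun a => by
      rw [← Real.exp_nat_mul]; congr 1; push_cast; ring
    rw [mul_pow, mul_pow, he, hsq, hsq]
    exact h3
  have hwi : Real.exp (‖y‖ ^ 2 / 2) * inner ℝ w τ' ≤ e * m * ‖τ'‖ := by
    have := (le_abs_self _).trans (abs_real_inner_le_norm w τ')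
    calc Real.exp (‖y‖ ^ 2 / 2) * inner ℝ w τ' ≤ Real.exp (‖y‖ ^ 2 / 2) * (‖w‖ * ‖τ'‖) := by gcongr
      _ = (Real.exp (‖y‖ ^ 2 / 2) * ‖w‖) * ‖τ'‖ := by ring
      _ ≤ _ := by gcongr
  refine ⟨-(e * k) - Real.exp (‖y‖ ^ 2 / 2) * inner ℝ w τ', hA.congr_deriv ?_, ?_, fun h0 => ?_⟩
  · simp only [inner_zero_right, zero_add, hk]
    have : e * (2 * inner ℝ (γ s) (m • τ) / 2) * inner ℝ (geodesicVelocity (γ s) y) τ +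
        e * (inner ℝ (geodesicVelocity (γ s) y) (m • (γ s - inner ℝ τ (γ s) • τ)) + inner ℝ v τ)
        = e * inner ℝ (v + conj (γ s) * geodesicVelocity (γ s) y * (m • τ)) τ := by
      rw [mul_assoc, ← mul_add]
      congr 1
      simp only [inner_add_left, inner_sub_right, real_inner_smul_right, real_inner_comm τ (γ s)]
      simp only [Complex.inner, Complex.mul_re, Complex.mul_im, Complex.conj_re, Complex.conj_im,
        Complex.real_smul, Complex.ofReal_re, Complex.ofReal_im, Complex.conj_ofReal, map_mul,
        Complex.conj_conj]
      linear_combination (-m * ((γ s).re * (geodesicVelocity (γ s) y).re +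
        (γ s).im * (geodesicVelocity (γ s) y).im)) * hτsq
    rw [this]
    ring
  · nlinarith [mul_le_mul_of_nonneg_left hkle hepos.le]
  · have hk0 : k = -m := by
      refine le_antisymm hkle ?_
      have : e * m * ‖τ'‖ ≤ e * m * 1 := by gcongr
      by_contra! hlt
      nlinarith [mul_lt_mul_of_pos_left hlt hepos]
    have := h2 (by rw [hk0]; ring)
    rw [Complex.real_smul, map_mul, Complex.conj_ofReal, mul_left_comm, Complex.im_ofReal_mul]
      at this
    exact (mul_eq_zero.1 this).resolve_left hm.ne'

theorem continuousOn_firstVariation (h : ExpanderArc γ D) (y : ℂ) {τ' : ℂ} (hτ' : ‖τ'‖ ≤ 1) :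
    ContinuousOn (fun s => firstVariation (γ s) (unitTangent γ D s) y τ') D := fun s hs => by
  obtain ⟨a, ha, -⟩ := h.exists_hasDerivWithinAt_firstVariation hs y hτ'
  exact ha.continuousWithinAt

theorem monotoneOn_firstVariation (h : ExpanderArc γ D) (y : ℂ) {τ' : ℂ} (hτ' : ‖τ'‖ ≤ 1) :
    MonotoneOn (fun s => firstVariation (γ s) (unitTangent γ D s) y τ') D := by
  have key : ∀ s ∈ interior D, ∃ a,
      HasDerivAt (fun s => firstVariation (γ s) (unitTangent γ D s) y τ') a s ∧ 0 ≤ a := by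
    intro s hs
    obtain ⟨a, ha, hle, -⟩ :=
      h.exists_hasDerivWithinAt_firstVariation (interior_subset hs) y hτ'
    refine ⟨a, ha.hasDerivAt (mem_interior_iff_mem_nhds.1 hs), le_trans ?_ hle⟩
    have : 0 ≤ 1 - ‖τ'‖ := by linarith
    positivity
  refine monotoneOn_of_deriv_nonneg h.convex (h.continuousOn_firstVariation y hτ')
    (fun s hs => ?_) fun s hs => ?_
  · obtain ⟨a, ha, -⟩ := key s hs
    exact ha.differentiableAt.differentiableWithinAt
  · obtain ⟨a, ha, ha0⟩ := key s hs
    rwa [ha.deriv]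

/-- If the first variation is constant along an arc, then the geodesics to the fixed point are
tangent to the arc. -/
theorem im_eq_zero_of_firstVariation_eq (h : ExpanderArc γ D) {y τ' : ℂ} (hτ' : ‖τ'‖ ≤ 1) {k : ℝ}
    (hk : ∀ s ∈ D, firstVariation (γ s) (unitTangent γ D s) y τ' = k) {s : ℝ} (hs : s ∈ D) :
    (geodesicVelocity (γ s) y * conj (unitTangent γ D s)).im = 0 := by
  obtain ⟨a, ha, -, h0⟩ := h.exists_hasDerivWithinAt_firstVariation hs y hτ'
  refine h0 ((h.uniqueDiff s hs).eq_deriv D ha ?_)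
  exact (hasDerivWithinAt_const s D k).congr hk (hk s hs)

/-- With `τ' = 0` the target rests and the mixed term disappears, so the lower bound for the
derivative is positive: half the squared distance to a fixed point is strictly convex along the arc.
-/
theorem strictMonoOn_firstVariation (h : ExpanderArc γ D) (y : ℂ) :
    StrictMonoOn (fun s => firstVariation (γ s) (unitTangent γ D s) y 0) D := by
  have key : ∀ s ∈ interior D, ∃ a,
      HasDerivAt (fun s => firstVariation (γ s) (unitTangent γ D s) y 0) a s ∧ 0 < a := by
    intro s hs
    obtain ⟨a, ha, hle, -⟩ :=
      h.exists_hasDerivWithinAt_firstVariation (interior_subset hs) y (τ' := 0) (by simp)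
    refine ⟨a, ha.hasDerivAt (mem_interior_iff_mem_nhds.1 hs), lt_of_lt_of_le ?_ hle⟩
    have := h.norm_derivWithin_pos (interior_subset hs)
    simp only [norm_zero, sub_zero, mul_one]
    positivity
  refine strictMonoOn_of_deriv_pos h.convex (h.continuousOn_firstVariation y (by simp))
    fun s hs => ?_
  obtain ⟨a, ha, ha0⟩ := key s hs
  rwa [ha.deriv]

/-- Arcs that solve the self-expander equation do not return to the same point. -/
theorem injOn (h : ExpanderArc γ D) : InjOn γ D := by
  intro s hs t ht hst
  refine (h.strictMonoOn_firstVariation (γ t)).injOn hs ht ?_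
  simp only [hst, firstVariation_self]

end ExpanderArc

theorem ContinuousOn.strictMonoOn_or_strictAntiOn {f : ℝ → ℝ} {D : Set ℝ} [hD : D.OrdConnected]
    (hf : ContinuousOn f D) (hi : InjOn f D) : StrictMonoOn f D ∨ StrictAntiOn f D := by
  by_contra! hcon
  obtain ⟨h1, h2⟩ := hcon
  simp only [StrictMonoOn, StrictAntiOn, not_forall, not_lt] at h1 h2
  obtain ⟨a, ha, b, hb, hab, h1⟩ := h1
  obtain ⟨c, hc, d, hd, hcd, h2⟩ := h2
  -- A compact interval containing all four witnesses reduces the claim to the known case of `Icc`.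
  have hm : min a c ∈ D := by rcases min_choice a c with h | h <;> rw [h] <;> assumption
  have hM : max b d ∈ D := by rcases max_choice b d with h | h <;> rw [h] <;> assumption
  have hsub : Icc (min a c) (max b d) ⊆ D := hD.out hm hM
  have e1 : a ∈ Icc (min a c) (max b d) := ⟨min_le_left _ _, hab.le.trans (le_max_left _ _)⟩
  have e2 : b ∈ Icc (min a c) (max b d) := ⟨(min_le_left _ _).trans hab.le, le_max_left _ _⟩
  have e3 : c ∈ Icc (min a c) (max b d) := ⟨min_le_right _ _, hcd.le.trans (le_max_right _ _)⟩
  have e4 : d ∈ Icc (min a c) (max b d) := ⟨(min_le_right _ _).trans hcd.le, le_max_right _ _⟩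
  rcases (hf.mono hsub).strictMonoOn_of_injOn_Icc' (e1.1.trans e1.2) (hi.mono hsub) with h | h
  · exact absurd (h e1 e2 hab) (not_lt.2 h1)
  · exact absurd (h e3 e4 hcd) (not_lt.2 h2)

theorem eq_inner_smul_of_im_eq_zero {v τ : ℂ} (hτ : ‖τ‖ = 1) (h : (v * conj τ).im = 0) :
    v = (inner ℝ v τ : ℝ) • τ := by
  have hτsq : τ.re * τ.re + τ.im * τ.im = 1 := by
    rw [← Complex.normSq_apply, ← Complex.sq_norm, hτ, one_pow]
  simp only [Complex.mul_im, Complex.conj_re, Complex.conj_im] at h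
  apply Complex.ext
  · simp only [Complex.inner, Complex.real_smul, Complex.mul_re, Complex.conj_re, Complex.conj_im,
      Complex.ofReal_re, Complex.ofReal_im]
    linear_combination (-v.re) * hτsq - τ.im * h
  · simp only [Complex.inner, Complex.real_smul, Complex.mul_re, Complex.mul_im, Complex.conj_re,
      Complex.conj_im, Complex.ofReal_re, Complex.ofReal_im]
    linear_combination (-v.im) * hτsq + τ.re * h

theorem continuous_geodesicVelocity : Continuous fun q : ℂ × ℂ => geodesicVelocity q.1 q.2 := by
  refine continuous_snd.comp (continuous_iff_continuousAt.2 fun q => ?_ : Continuous geodesicData)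
  obtain ⟨e, L, he, -⟩ := exists_linearization_geodesicEndpoints (geodesicData q)
  exact (hasStrictFDerivAt_geodesicData he).continuousAt

theorem continuous_geodesicFlow_one : Continuous fun q : ℂ × ℂ => geodesicFlow q 1 :=
  continuous_iff_continuousAt.2 fun q => by
    obtain ⟨L, -, -, h⟩ := exists_hasStrictFDerivAt_geodesicFlow q
    exact h.continuousAt

/-! ### Expander arcs run along geodesics, and when two of them coincide. -/

namespace ExpanderArc

section

variable {γ : ℝ → ℂ} {D : Set ℝ}

theorem derivWithin_reverse {E : Type*} [NormedAddCommGroup E] [NormedSpace ℝ E] {a : ℝ}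
    (hD : ∀ s, a - s ∈ D ↔ s ∈ D) (f : ℝ → E) (s : ℝ) :
    derivWithin (fun s => f (a - s)) D s = -derivWithin f D (a - s) := by
  rw [derivWithin_comp_const_sub]
  congr
  ext t
  rw [Set.mem_vadd_set_iff_neg_vadd_mem, vadd_eq_add, Set.mem_neg, ← hD t]
  ring_nf

theorem unitTangent_reverse {a : ℝ} (hD : ∀ s, a - s ∈ D ↔ s ∈ D) (γ : ℝ → ℂ) (s : ℝ) :
    unitTangent (fun s => γ (a - s)) D s = -unitTangent γ D (a - s) := by
  rw [unitTangent, unitTangent, derivWithin_reverse hD, norm_neg, smul_neg]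

theorem normalPart_reverse {a : ℝ} (hD : ∀ s, a - s ∈ D ↔ s ∈ D) (γ : ℝ → ℂ) (s : ℝ) (v : ℂ) :
    normalPart (fun s => γ (a - s)) D s v = normalPart γ D (a - s) v := by
  simp only [normalPart, unitTangent_reverse hD, inner_neg_left, smul_neg, neg_smul, neg_neg]

theorem reverse {a : ℝ} (hD : ∀ s, a - s ∈ D ↔ s ∈ D) (h : ExpanderArc γ D) :
    ExpanderArc (fun s => γ (a - s)) D where
  convex := h.convex
  uniqueDiff := h.uniqueDiff
  smooth := h.smooth.comp (by fun_prop) fun s hs => (hD s).2 hs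
  immersed := fun s hs => by
    rw [derivWithin_reverse hD, neg_ne_zero]
    exact h.immersed _ ((hD s).2 hs)
  expander := fun s hs => by
    have h1 : derivWithin (derivWithin (fun s => γ (a - s)) D) D s =
        derivWithin (derivWithin γ D) D (a - s) := by
      have : derivWithin (fun s => γ (a - s)) D = fun s => -derivWithin γ D (a - s) :=
        funext (derivWithin_reverse hD γ)
      rw [this, derivWithin.fun_neg, derivWithin_reverse hD, neg_neg]
    rw [curvatureVector, normalPart_reverse hD, normalPart_reverse hD, h1, derivWithin_reverse hD,
      norm_neg]
    exact h.expander _ ((hD s).2 hs)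

/-- The first variation vanishes along a single arc. -/
theorem firstVariation_self_eq_zero (h : ExpanderArc γ D) {s t : ℝ} (hs : s ∈ D) (ht : t ∈ D) :
    firstVariation (γ s) (unitTangent γ D s) (γ t) (unitTangent γ D t) = 0 := by
  have hmono := fun t (ht : t ∈ D) => h.monotoneOn_firstVariation (γ t)
    (τ' := unitTangent γ D t) (h.norm_unitTangent ht).le
  -- The first variation vanishes on the diagonal and increases in each argument, so moving from the
  -- diagonal in the one or the other argument gives both signs.
  have key : ∀ s ∈ D, ∀ t ∈ D, s ≤ t →
      firstVariation (γ s) (unitTangent γ D s) (γ t) (unitTangent γ D t) = 0 := by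
    intro s hs t ht hst
    refine le_antisymm ?_ ?_
    · simpa using hmono t ht hs ht hst
    · have := hmono s hs hs ht hst
      simp only [firstVariation_self] at this
      rwa [firstVariation_comm]
  rcases le_total s t with hst | hst
  · exact key s hs t ht hst
  · rw [firstVariation_comm]
    exact key t ht s hs hst

/-- The coordinate of the points of an arc along the geodesic that it runs along. -/
theorem exp_mul_inner_geodesicVelocity (h : ExpanderArc γ D) {s t : ℝ} (hs : s ∈ D) (ht : t ∈ D) :
    Real.exp (‖γ s‖ ^ 2 / 2) * inner ℝ (geodesicVelocity (γ s) (γ t)) (unitTangent γ D s) =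
      firstVariation (γ t) (unitTangent γ D t) (γ s) 0 := by
  have := h.firstVariation_self_eq_zero hs ht
  simp only [firstVariation, inner_zero_right] at this ⊢
  linarith

/-- An arc lies on the geodesic given by its own tangent. No reparametrization by Riemannian
arclength is needed: the first variation of the arc against itself is constantly zero, and the
equality case gives tangency. -/
theorem geodesicVelocity_eq (h : ExpanderArc γ D) {s t : ℝ} (hs : s ∈ D) (ht : t ∈ D) :
    geodesicVelocity (γ s) (γ t) =
      (inner ℝ (geodesicVelocity (γ s) (γ t)) (unitTangent γ D s) : ℝ) • unitTangent γ D s :=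
  eq_inner_smul_of_im_eq_zero (h.norm_unitTangent hs)
    (h.im_eq_zero_of_firstVariation_eq (h.norm_unitTangent ht).le
      (fun _ hs => h.firstVariation_self_eq_zero hs ht) hs)

theorem strictMonoOn_inner_geodesicVelocity (h : ExpanderArc γ D) {s : ℝ} (hs : s ∈ D) :
    StrictMonoOn (fun t => inner ℝ (geodesicVelocity (γ s) (γ t)) (unitTangent γ D s)) D := by
  intro t ht t' ht' htt'
  have := h.strictMonoOn_firstVariation (γ s) ht ht' htt'
  simp only [← h.exp_mul_inner_geodesicVelocity hs ht,
    ← h.exp_mul_inner_geodesicVelocity hs ht'] at this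
  exact lt_of_mul_lt_mul_left this (Real.exp_pos _).le

theorem continuousOn_inner_geodesicVelocity (h : ExpanderArc γ D) (x τ : ℂ) :
    ContinuousOn (fun t => (inner ℝ (geodesicVelocity x (γ t)) τ : ℝ)) D := by
  have : ContinuousOn (fun t => geodesicVelocity x (γ t)) D :=
    continuous_geodesicVelocity.comp_continuousOn (continuousOn_const.prodMk h.continuousOn)
  exact this.inner continuousOn_const

end

section Pair

variable {γ₀ γ₁ : ℝ → ℂ} {D : Set ℝ}

/-- The point with coordinate `r` on the geodesic with initial data `(x, τ)`. -/
def _root_.geodesicPoint (x τ : ℂ) (r : ℝ) : ℂ := (geodesicFlow (x, r • τ) 1).1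

theorem _root_.continuous_geodesicPoint (x τ : ℂ) : Continuous (geodesicPoint x τ) :=
  continuous_fst.comp (continuous_geodesicFlow_one.comp (by fun_prop))

theorem _root_.geodesicPoint_eq {x y τ : ℂ} {r : ℝ} (h : geodesicVelocity x y = r • τ) :
    geodesicPoint x τ r = y := by
  rw [geodesicPoint, ← h, geodesicFlow_geodesicVelocity_fst]

/-- Points that run to infinity along a geodesic have unbounded coordinates. -/
theorem _root_.tendsto_abs_of_geodesicVelocity_eq {l : Filter ℝ} {x τ : ℂ} {γ : ℝ → ℂ} {ρ : ℝ → ℝ}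
    (h : ∀ᶠ s in l, geodesicVelocity x (γ s) = ρ s • τ)
    (hγ : Tendsto (fun s => ‖γ s‖) l atTop) : Tendsto (fun s => |ρ s|) l atTop := by
  rw [tendsto_atTop]
  intro B
  obtain ⟨M, hM⟩ := (isCompact_Icc (a := -B) (b := B)).exists_bound_of_continuousOn
    (continuous_geodesicPoint x τ).continuousOn
  filter_upwards [h, hγ.eventually_gt_atTop M] with s hs hlt
  by_contra! hB
  have := hM (ρ s) (abs_le.1 hB.le)
  rw [geodesicPoint_eq hs] at this
  linarith

/-- Two arcs with a common starting point and constant first variation have the same initial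
tangent vector. -/
theorem unitTangent_eq_of_firstVariation_eq (h₀ : ExpanderArc γ₀ D) (h₁ : ExpanderArc γ₁ D)
    (hD : 0 ∈ D) (hD' : 1 ∈ D) {k : ℝ}
    (hk : ∀ s ∈ D, ∀ s' ∈ D,
      firstVariation (γ₀ s) (unitTangent γ₀ D s) (γ₁ s') (unitTangent γ₁ D s') = k)
    (hv : γ₀ 0 = γ₁ 0) : unitTangent γ₀ D 0 = unitTangent γ₁ D 0 := by
  have hk0 : k = 0 := by rw [← hk 0 hD 0 hD, hv, firstVariation_self]
  -- From the common start, compare the first variations of the two arcs against the point `γ₁ 1`.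
  -- Both are zero, so the two unit tangents have the same inner product with the direction `V`,
  -- which is a nonzero multiple of the second one.
  have h1 := hk 0 hD 1 hD'
  have h2 := h₁.firstVariation_self_eq_zero hD hD'
  rw [hk0, hv] at h1
  replace h1 := h1.trans h2.symm
  set V := geodesicVelocity (γ₁ 0) (γ₁ 1) with hV
  have hin : inner ℝ V (unitTangent γ₀ D 0) = inner ℝ V (unitTangent γ₁ D 0) := by
    simp only [firstVariation] at h1
    have he := Real.exp_pos (‖γ₁ 0‖ ^ 2 / 2)
    refine mul_left_cancel₀ he.ne' ?_
    rw [← hV] at h1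
    linarith
  have h3 := h₁.geodesicVelocity_eq hD hD'
  rw [← hV] at h3
  have hne : V ≠ 0 := fun h0 => by
    have := h₁.injOn hD hD' (geodesicVelocity_eq_zero.1 h0)
    norm_num at this
  set r := (inner ℝ V (unitTangent γ₁ D 0) : ℝ) with hr
  have hrne : r ≠ 0 := fun h0 => hne (by rw [h3, h0, zero_smul])
  rw [h3, inner_smul_left] at hin
  have hτ₀ := h₀.norm_unitTangent hD
  have hτ₁ := h₁.norm_unitTangent hD
  have h4 : inner ℝ (unitTangent γ₁ D 0) (unitTangent γ₀ D 0) = 1 := by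
    simp only [conj_trivial] at hin
    exact mul_left_cancel₀ hrne (hin.trans (mul_one r).symm)
  exact ((inner_eq_one_iff_of_norm_eq_one hτ₁ hτ₀).1 h4).symm

/-- Both arcs start at the same point with the same tangent and therefore lie on one geodesic. They
coincide once their coordinates on it fill the same set `S`, which is the only point where segments
and rays differ. -/
theorem image_eq_of_common_start (h₀ : ExpanderArc γ₀ D) (h₁ : ExpanderArc γ₁ D)
    (hD : 0 ∈ D) (hD' : 1 ∈ D) {k : ℝ}
    (hk : ∀ s ∈ D, ∀ s' ∈ D,
      firstVariation (γ₀ s) (unitTangent γ₀ D s) (γ₁ s') (unitTangent γ₁ D s') = k)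
    (hv : γ₀ 0 = γ₁ 0) {S : Set ℝ}
    (hS : ∀ γ : ℝ → ℂ, ∀ ρ : ℝ → ℝ, γ = γ₀ ∨ γ = γ₁ → ContinuousOn ρ D → StrictMonoOn ρ D →
      ρ 0 = 0 → (∀ s ∈ D, geodesicVelocity (γ₁ 0) (γ s) = ρ s • unitTangent γ₁ D 0) →
      ρ '' D = S) :
    γ₀ '' D = γ₁ '' D := by
  have hτ := h₀.unitTangent_eq_of_firstVariation_eq h₁ hD hD' hk hv
  have key : ∀ γ : ℝ → ℂ, γ = γ₀ ∨ γ = γ₁ → ExpanderArc γ D → γ 0 = γ₁ 0 →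
      unitTangent γ D 0 = unitTangent γ₁ D 0 →
      γ '' D = geodesicPoint (γ₁ 0) (unitTangent γ₁ D 0) '' S := by
    intro γ hγ h hx hτ
    have h1 := hS γ _ hγ (h.continuousOn_inner_geodesicVelocity (γ 0) (unitTangent γ D 0))
      (h.strictMonoOn_inner_geodesicVelocity hD) (by simp)
      (fun s hs => by rw [← hx, ← hτ]; exact h.geodesicVelocity_eq hD hs)
    rw [← h1, image_image]
    refine image_congr fun s hs => (geodesicPoint_eq ?_).symm
    rw [← hx, ← hτ]; exact h.geodesicVelocity_eq hD hs
  rw [key γ₀ (Or.inl rfl) h₀ hv hτ, key γ₁ (Or.inr rfl) h₁ rfl rfl]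

theorem image_eq_of_segments (h₀ : ExpanderArc γ₀ (Icc 0 1)) (h₁ : ExpanderArc γ₁ (Icc 0 1))
    {k : ℝ} (hk : ∀ s ∈ Icc (0 : ℝ) 1, ∀ s' ∈ Icc (0 : ℝ) 1,
      firstVariation (γ₀ s) (unitTangent γ₀ (Icc 0 1) s) (γ₁ s')
        (unitTangent γ₁ (Icc 0 1) s') = k)
    (hv : γ₀ 0 = γ₁ 0) (hv' : γ₀ 1 = γ₁ 1) : γ₀ '' Icc 0 1 = γ₁ '' Icc 0 1 := by
  have hD' : (1 : ℝ) ∈ Icc (0 : ℝ) 1 := right_mem_Icc.2 zero_le_one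
  have hτne : unitTangent γ₁ (Icc 0 1) 0 ≠ 0 := norm_pos_iff.1 (by
    rw [h₁.norm_unitTangent (left_mem_Icc.2 zero_le_one)]; exact one_pos)
  refine h₀.image_eq_of_common_start h₁ (left_mem_Icc.2 zero_le_one) hD' hk hv
    (S := Icc 0 (inner ℝ (geodesicVelocity (γ₁ 0) (γ₁ 1)) (unitTangent γ₁ (Icc 0 1) 0)))
    fun γ ρ hγ hc hm h0 hρ => ?_
  have h1 : ρ 1 = inner ℝ (geodesicVelocity (γ₁ 0) (γ₁ 1)) (unitTangent γ₁ (Icc 0 1) 0) := by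
    have e : γ 1 = γ₁ 1 := by rcases hγ with rfl | rfl <;> simp [hv']
    have := hρ 1 hD'
    rw [e, h₁.geodesicVelocity_eq (left_mem_Icc.2 zero_le_one) hD'] at this
    exact (smul_left_injective ℝ hτne this).symm
  rw [← h1]
  conv_rhs => rw [← h0]
  exact hc.image_Icc_of_monotoneOn zero_le_one hm.monotoneOn

theorem image_eq_of_rays (h₀ : ExpanderArc γ₀ (Ici 0)) (h₁ : ExpanderArc γ₁ (Ici 0))
    {k : ℝ} (hk : ∀ s ∈ Ici (0 : ℝ), ∀ s' ∈ Ici (0 : ℝ),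
      firstVariation (γ₀ s) (unitTangent γ₀ (Ici 0) s) (γ₁ s') (unitTangent γ₁ (Ici 0) s') = k)
    (hv : γ₀ 0 = γ₁ 0) (ht₀ : Tendsto (fun s => ‖γ₀ s‖) atTop atTop)
    (ht₁ : Tendsto (fun s => ‖γ₁ s‖) atTop atTop) : γ₀ '' Ici 0 = γ₁ '' Ici 0 := by
  refine h₀.image_eq_of_common_start h₁ self_mem_Ici (by simp) hk hv
    (S := Ici 0) fun γ ρ hγ hc hm h0 hρ => ?_
  have ht : Tendsto (fun s => ‖γ s‖) atTop atTop := by rcases hγ with rfl | rfl <;> assumption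
  have hρt := tendsto_abs_of_geodesicVelocity_eq
    ((eventually_ge_atTop 0).mono fun s hs => hρ s hs) ht
  refine Subset.antisymm ?_ fun r hr => ?_
  · rintro _ ⟨s, hs, rfl⟩
    rw [mem_Ici, ← h0]
    exact hm.monotoneOn self_mem_Ici hs hs
  · obtain ⟨s, hs, hrs⟩ := ((eventually_ge_atTop 0).and (hρt.eventually_ge_atTop r)).exists
    have hs' : 0 ≤ ρ s := by
      rw [← h0]; exact hm.monotoneOn self_mem_Ici hs hs
    rw [abs_of_nonneg hs'] at hrs
    have := intermediate_value_Icc hs (hc.mono Icc_subset_Ici_self)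
    rw [h0] at this
    exact image_mono Icc_subset_Ici_self (this ⟨hr, hrs⟩)

theorem _root_.Continuous.surjective_of_injective_of_tendsto_abs {f : ℝ → ℝ} (hc : Continuous f)
    (hi : Function.Injective f) (h1 : Tendsto (fun s => |f s|) atTop atTop)
    (h2 : Tendsto (fun s => |f s|) atBot atTop) : Function.Surjective f := by
  have key : ∀ f : ℝ → ℝ, Continuous f → StrictMono f → Tendsto (fun s => |f s|) atTop atTop →
      Tendsto (fun s => |f s|) atBot atTop → Function.Surjective f := by
    intro f hc hm h1 h2
    refine hc.surjective ?_ ?_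
    · rw [tendsto_atTop]
      intro b
      filter_upwards [h1.eventually_ge_atTop (|f 0| + |b| + 1), eventually_ge_atTop 0] with s hs hs0
      have h3 := hm.monotone hs0
      have := abs_le.1 (le_refl |f 0|)
      rcases abs_cases (f s) with ⟨h, -⟩ | ⟨h, -⟩
      · linarith [le_abs_self b, abs_nonneg (f 0)]
      · linarith [abs_nonneg b]
    · rw [tendsto_atBot]
      intro b
      filter_upwards [h2.eventually_ge_atTop (|f 0| + |b| + 1), eventually_le_atBot 0] with s hs hs0
      have h3 := hm.monotone hs0
      have := abs_le.1 (le_refl |f 0|)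
      rcases abs_cases (f s) with ⟨h, -⟩ | ⟨h, -⟩
      · linarith [abs_nonneg b]
      · linarith [neg_abs_le b, abs_nonneg (f 0)]
  rcases hc.strictMono_of_inj hi with h | h
  · exact key f hc h h1 h2
  · intro y
    obtain ⟨x, hx⟩ := key (fun s => -f s) hc.neg (fun a b hab => neg_lt_neg (h hab))
      (by simpa using h1) (by simpa using h2) (-y)
    exact ⟨x, neg_inj.1 hx⟩

/-- Without a common point, the equality case is applied across the two arcs: the geodesic from `γ₀
0` to any point of `γ₁` is tangent to `γ₀`. Both arcs thus lie on one geodesic, and going to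
infinity in both directions they fill all of it. -/
theorem image_eq_of_lines (h₀ : ExpanderArc γ₀ univ) (h₁ : ExpanderArc γ₁ univ)
    {k : ℝ} (hk : ∀ s s' : ℝ,
      firstVariation (γ₀ s) (unitTangent γ₀ univ s) (γ₁ s') (unitTangent γ₁ univ s') = k)
    (ht₀ : Tendsto (fun s => ‖γ₀ s‖) atTop atTop) (hb₀ : Tendsto (fun s => ‖γ₀ s‖) atBot atTop)
    (ht₁ : Tendsto (fun s => ‖γ₁ s‖) atTop atTop) (hb₁ : Tendsto (fun s => ‖γ₁ s‖) atBot atTop) :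
    γ₀ '' univ = γ₁ '' univ := by
  set x := γ₀ 0
  set τ := unitTangent γ₀ univ 0 with hτ
  have key : ∀ γ : ℝ → ℂ, ExpanderArc γ univ → Tendsto (fun s => ‖γ s‖) atTop atTop →
      Tendsto (fun s => ‖γ s‖) atBot atTop →
      (∀ s, geodesicVelocity x (γ s) = (inner ℝ (geodesicVelocity x (γ s)) τ : ℝ) • τ) →
      γ '' univ = geodesicPoint x τ '' univ := by
    intro γ h ht hb hV
    have hs : Function.Surjective fun s => (inner ℝ (geodesicVelocity x (γ s)) τ : ℝ) := by
      refine Continuous.surjective_of_injective_of_tendsto_abs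
        (continuousOn_univ.1 (h.continuousOn_inner_geodesicVelocity x τ)) (fun s t hst => ?_)
        (tendsto_abs_of_geodesicVelocity_eq (Eventually.of_forall hV) ht)
        (tendsto_abs_of_geodesicVelocity_eq (Eventually.of_forall hV) hb)
      refine h.injOn (mem_univ s) (mem_univ t) (geodesicVelocity_injective x ?_)
      rw [hV s, hV t]
      exact congrArg (· • τ) hst
    conv_rhs => rw [← hs.range_eq, ← image_univ, image_image]
    exact image_congr fun s _ => (geodesicPoint_eq (hV s)).symm
  rw [key γ₀ h₀ ht₀ hb₀ fun s => h₀.geodesicVelocity_eq (mem_univ 0) (mem_univ s),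
    key γ₁ h₁ ht₁ hb₁ fun s => ?_]
  exact eq_inner_smul_of_im_eq_zero (h₀.norm_unitTangent (mem_univ 0))
    (h₀.im_eq_zero_of_firstVariation_eq (h₁.norm_unitTangent (mem_univ s)).le
      (fun t _ => hk t s) (mem_univ 0))

end Pair

end ExpanderArc

/-! ### Decay of expanders along their asymptotic half-lines. -/

theorem monotoneOn_Ici_of_hasDerivAt {f f' : ℝ → ℝ} {a : ℝ}
    (hf : ∀ s ≥ a, HasDerivAt f (f' s) s) (h0 : ∀ s ≥ a, 0 ≤ f' s) : MonotoneOn f (Ici a) := by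
  refine monotoneOn_of_deriv_nonneg (convex_Ici a)
    (fun s hs => (hf s hs).continuousAt.continuousWithinAt)
    (fun s hs => (hf s (interior_subset hs)).differentiableAt.differentiableWithinAt)
    fun s hs => ?_
  rw [(hf s (interior_subset hs)).deriv]
  exact h0 s (interior_subset hs)

/-- A function which is convex with respect to the arclength of a curve that escapes in the
direction of the coordinate `X`, and which tends to zero, is nonnegative. -/
theorem nonneg_of_tendsto_zero {H h₁ X ξ m : ℝ → ℝ} {a : ℝ} (hm : ∀ s ≥ a, 0 < m s)
    (hH : ∀ s ≥ a, HasDerivAt H (m s * h₁ s) s) (hh : MonotoneOn h₁ (Ici a))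
    (hX : ∀ s ≥ a, HasDerivAt X (m s * ξ s) s) (hξ : ∀ s ≥ a, ξ s ≤ 1)
    (hXt : Tendsto X atTop atTop) (hHt : Tendsto H atTop (𝓝 0)) {s : ℝ} (hs : a ≤ s) :
    0 ≤ H s := by
  -- A positive slope at some `b` would persist and make `H` grow at least like `h₁ b * X`. So `H`
  -- is nonincreasing with limit zero.
  have hneg : ∀ s ≥ a, h₁ s ≤ 0 := by
    intro b hb
    by_contra! hpos
    have hmono : MonotoneOn (fun s => H s - h₁ b * X s) (Ici b) :=
      monotoneOn_Ici_of_hasDerivAt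
        (fun s hs => (hH s (hb.trans hs)).sub ((hX s (hb.trans hs)).const_mul (h₁ b)))
        fun s hs => by
          have h1 := hh hb (hb.trans hs) hs
          have h2 := hξ s (hb.trans hs)
          have h3 := hm s (hb.trans hs)
          have h4 : h₁ b * ξ s ≤ h₁ s := (mul_le_of_le_one_right hpos.le h2).trans h1
          nlinarith
    have ht : Tendsto (fun s => H b - h₁ b * X b + h₁ b * X s) atTop atTop :=
      tendsto_atTop_add_const_left _ _ (hXt.const_mul_atTop hpos)
    have : Tendsto H atTop atTop := tendsto_atTop_mono' _
      ((eventually_ge_atTop b).mono fun s hs => by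
        have := hmono self_mem_Ici hs hs
        simp only at this
        linarith) ht
    exact not_tendsto_nhds_of_tendsto_atTop this 0 hHt
  have hanti : MonotoneOn (fun s => -H s) (Ici a) :=
    monotoneOn_Ici_of_hasDerivAt (fun s hs => (hH s hs).neg) fun s hs => by
      nlinarith [hm s hs, hneg s hs]
  refine le_of_tendsto hHt ((eventually_ge_atTop s).mono fun t ht => ?_)
  have := hanti hs (hs.trans ht) ht
  simp only at this
  linarith

/-- A solution of the self-expander equation that approaches a half-line from the origin does so
at a rate faster than `e^{-|γ|²/2}`. -/
theorem tendsto_exp_mul_abs_im {γ τ : ℝ → ℂ} {m : ℝ → ℝ} {a : ℝ} (hm : ∀ s ≥ a, 0 < m s)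
    (hγ : ∀ s ≥ a, HasDerivAt γ (m s • τ s) s)
    (hτ : ∀ s ≥ a, HasDerivAt τ (m s • (γ s - (inner ℝ (τ s) (γ s) : ℝ) • τ s)) s)
    (hτ1 : ∀ s ≥ a, ‖τ s‖ = 1) {e : ℂ} (he : ‖e‖ = 1)
    (hX : Tendsto (fun s => (γ s * conj e).re) atTop atTop)
    (hY : Tendsto (fun s => (γ s * conj e).im) atTop (𝓝 0)) :
    Tendsto (fun s => Real.exp (‖γ s‖ ^ 2 / 2) * |(γ s * conj e).im|) atTop (𝓝 0) := by
  -- `q` and `p` are the tangential and signed normal components of the position; `X`, `Y` and `ξ`,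
  -- `η` are the coordinates of the position and of the tangent in the frame of the half-line. In
  -- arclength, `q' = 1 + p²`, `p' = -p q` and `F' = F q`.
  set q : ℝ → ℝ := fun s => (conj (τ s) * γ s).re with hq
  set p : ℝ → ℝ := fun s => (conj (τ s) * γ s).im with hp
  set X : ℝ → ℝ := fun s => (γ s * conj e).re with hXdef
  set Y : ℝ → ℝ := fun s => (γ s * conj e).im with hYdef
  set ξ : ℝ → ℝ := fun s => (τ s * conj e).re with hξdef
  set η : ℝ → ℝ := fun s => (τ s * conj e).im with hηdef
  set F : ℝ → ℝ := fun s => Real.exp (‖γ s‖ ^ 2 / 2) with hF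
  have hsq : ∀ s ≥ a, (τ s).re * (τ s).re + (τ s).im * (τ s).im = 1 := fun s hs => by
    rw [← Complex.normSq_apply, ← Complex.sq_norm, hτ1 s hs, one_pow]
  have hre : ∀ {f : ℝ → ℂ} {f' : ℂ} {s : ℝ}, HasDerivAt f f' s →
      HasDerivAt (fun s => (f s).re) f'.re s := fun h =>
    Complex.reCLM.hasFDerivAt.comp_hasDerivAt _ h
  have him : ∀ {f : ℝ → ℂ} {f' : ℂ} {s : ℝ}, HasDerivAt f f' s →
      HasDerivAt (fun s => (f s).im) f'.im s := fun h =>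
    Complex.imCLM.hasFDerivAt.comp_hasDerivAt _ h
  have hz := fun s hs =>
    (Complex.conjCLE.hasFDerivAt.comp_hasDerivAt s (hτ s hs)).mul (hγ s hs)
  have hqd : ∀ s ≥ a, HasDerivAt q (m s * (1 + p s ^ 2)) s := fun s hs => by
    refine (hre (hz s hs)).congr_deriv ?_
    simp only [hp, Complex.inner, Complex.conjCLE_apply, Complex.add_re, Complex.mul_re,
      Complex.mul_im, Complex.conj_re, Complex.conj_im, Complex.real_smul, Complex.ofReal_re,
      Complex.ofReal_im, Complex.sub_re, Complex.sub_im, Function.comp_apply,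
      ContinuousLinearEquiv.coe_coe]
    linear_combination (m s * (1 - ((γ s).re ^ 2 + (γ s).im ^ 2))) * hsq s hs
  have hpd : ∀ s ≥ a, HasDerivAt p (-(m s * (p s * q s))) s := fun s hs => by
    refine (him (hz s hs)).congr_deriv ?_
    simp only [hp, hq, Complex.inner, Complex.conjCLE_apply, Complex.add_im, Complex.mul_re,
      Complex.mul_im, Complex.conj_re, Complex.conj_im, Complex.real_smul, Complex.ofReal_re,
      Complex.ofReal_im, Complex.sub_re, Complex.sub_im, Function.comp_apply,
      ContinuousLinearEquiv.coe_coe]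
    ring
  have hXd : ∀ s ≥ a, HasDerivAt X (m s * ξ s) s := fun s hs => by
    refine (hre ((hγ s hs).mul_const (conj e))).congr_deriv ?_
    rw [smul_mul_assoc, Complex.real_smul, Complex.re_ofReal_mul]
  have hYd : ∀ s ≥ a, HasDerivAt Y (m s * η s) s := fun s hs => by
    refine (him ((hγ s hs).mul_const (conj e))).congr_deriv ?_
    rw [smul_mul_assoc, Complex.real_smul, Complex.im_ofReal_mul]
  have hηd : ∀ s ≥ a, HasDerivAt η (m s * (p s * ξ s)) s := fun s hs => by
    refine (him ((hτ s hs).mul_const (conj e))).congr_deriv ?_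
    simp only [hp, hξdef, Complex.inner, Complex.mul_re,
      Complex.mul_im, Complex.conj_re, Complex.conj_im, Complex.real_smul, Complex.ofReal_re,
      Complex.ofReal_im, Complex.sub_re, Complex.sub_im]
    linear_combination (m s * ((γ s).re * e.im - (γ s).im * e.re)) * hsq s hs
  have hFd : ∀ s ≥ a, HasDerivAt F (m s * (F s * q s)) s := fun s hs => by
    refine (((hγ s hs).norm_sq.div_const 2).exp).congr_deriv ?_
    simp only [hF, hq, Complex.inner, Complex.mul_re, Complex.conj_re, Complex.conj_im,
      Complex.real_smul, Complex.ofReal_re, Complex.ofReal_im, Complex.mul_im]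
    ring
  have hFpos : ∀ s, 0 < F s := fun s => Real.exp_pos _
  have hF1 : ∀ s, 1 ≤ F s := fun s => Real.one_le_exp (by positivity)
  have hξ1 : ∀ s ≥ a, |ξ s| ≤ 1 := fun s hs => by
    refine (Complex.abs_re_le_norm _).trans ?_
    rw [norm_mul, hτ1 s hs, Complex.norm_conj, he, one_mul]
  -- the tangential component tends to infinity
  have hqt : Tendsto q atTop atTop := by
    -- In arclength `q` grows at rate `1 + p²` and `X` only at rate `ξ ≤ 1`.
    have hmono : MonotoneOn (fun s => q s - X s) (Ici a) :=
      monotoneOn_Ici_of_hasDerivAt (fun s hs => (hqd s hs).sub (hXd s hs)) fun s hs => by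
        have h1 := (abs_le.1 (hξ1 s hs)).2
        have h2 := hm s hs
        have h3 : 0 ≤ m s * p s ^ 2 := by positivity
        nlinarith
    refine tendsto_atTop_mono' _ ((eventually_ge_atTop a).mono fun s hs => ?_)
      (tendsto_atTop_add_const_left _ (q a - X a) hX)
    have := hmono self_mem_Ici hs hs
    simp only at this
    linarith
  obtain ⟨b, hb⟩ := ((hqt.eventually_ge_atTop 1).and (eventually_ge_atTop a)).exists_forall_of_atTop
  have hba : ∀ s ≥ b, a ≤ s := fun s hs => (hb s hs).2
  have hqpos : ∀ s ≥ b, 0 < q s := fun s hs => one_pos.trans_le (hb s hs).1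
  -- the normal component decays like `e^{-|γ|²/2}`
  have hpF : ∀ s ≥ b, p s * F s = p b * F b := fun s hs => by
    have hd : ∀ s ≥ b, HasDerivAt (fun s => p s * F s) 0 s := fun s hs =>
      ((hpd s (hba s hs)).mul (hFd s (hba s hs))).congr_deriv (by ring)
    have h1 := monotoneOn_Ici_of_hasDerivAt hd (fun _ _ => le_rfl) self_mem_Ici hs hs
    have h2 := monotoneOn_Ici_of_hasDerivAt (fun s hs => (hd s hs).neg) (fun _ _ => by simp)
      self_mem_Ici hs hs
    simp only [Pi.neg_apply] at h1 h2
    linarith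
  set C := |p b * F b| with hC
  have hpC : ∀ s ≥ b, |p s| = C / F s := fun s hs => by
    rw [eq_div_iff (hFpos s).ne', hC, ← hpF s hs, abs_mul, abs_of_pos (hFpos s)]
  -- the barrier
  set B : ℝ → ℝ := fun s => (F s * q s ^ 2)⁻¹ with hB
  set B₁ : ℝ → ℝ := fun s => -((F s)⁻¹ * ((q s)⁻¹ + 2 * (1 + p s ^ 2) * (q s ^ 3)⁻¹)) with hB₁
  have hBd : ∀ s ≥ b, HasDerivAt B (m s * B₁ s) s := fun s hs => by
    have h1 := hqpos s hs
    have h2 := hFpos s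
    refine (((hFd s (hba s hs)).mul ((hqd s (hba s hs)).pow 2)).inv
      (mul_pos h2 (pow_pos h1 2)).ne').congr_deriv ?_
    simp only [hB₁, Pi.mul_apply, Pi.pow_apply]
    field_simp
    ring
  have hB₁d : ∀ s ≥ b, HasDerivAt B₁ (m s * ((F s)⁻¹ * (1 + (3 * (1 + p s ^ 2) + 4 * p s ^ 2) *
      (q s ^ 2)⁻¹ + 6 * (1 + p s ^ 2) ^ 2 * (q s ^ 4)⁻¹))) s := fun s hs => by
    have h1 := hqpos s hs
    have h2 := hFpos s
    refine (((hFd s (hba s hs)).inv h2.ne').mul (((hqd s (hba s hs)).inv h1.ne').add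
      ((((hpd s (hba s hs)).pow 2).const_add 1 |>.const_mul 2).mul
      (((hqd s (hba s hs)).pow 3).inv (pow_pos h1 3).ne')))).neg.congr_deriv ?_
    simp only [Pi.mul_apply, Pi.pow_apply, Pi.inv_apply, Pi.add_apply]
    field_simp
    ring
  have hBt : Tendsto (fun s => (q s ^ 2)⁻¹) atTop (𝓝 0) :=
    ((tendsto_pow_atTop two_ne_zero).comp hqt).inv_tendsto_atTop
  have hBt' : Tendsto B atTop (𝓝 0) := by
    refine squeeze_zero' ((eventually_ge_atTop b).mono fun s hs => ?_)
      ((eventually_ge_atTop b).mono fun s hs => ?_) hBt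
    · have := hFpos s; positivity
    · have h1 := hqpos s hs
      have := hF1 s
      simp only [hB]
      gcongr
      exact le_mul_of_one_le_left (by positivity) this
  -- In arclength `Y'' = p ξ` has absolute value at most `C / F`, while `B'' ≥ 1 / F`. So `C B + Y`
  -- and `C B - Y` are convex and tend to zero, hence nonnegative, and `F |Y| ≤ C / q²` follows.
  have key : ∀ σ : ℝ, |σ| = 1 → ∀ s ≥ b, 0 ≤ C * B s + σ * Y s := by
    intro σ hσ s hs
    refine nonneg_of_tendsto_zero (a := b) (H := fun s => C * B s + σ * Y s)
      (h₁ := fun s => C * B₁ s + σ * η s) (X := X) (ξ := ξ)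
      (fun s hs => hm s (hba s hs)) (fun s hs => ?_) ?_ (fun s hs => hXd s (hba s hs))
      (fun s hs => (abs_le.1 (hξ1 s (hba s hs))).2) hX ?_ hs
    · exact (((hBd s hs).const_mul C).add ((hYd s (hba s hs)).const_mul σ)).congr_deriv (by ring)
    · refine monotoneOn_Ici_of_hasDerivAt
        (fun s hs => ((hB₁d s hs).const_mul C).add ((hηd s (hba s hs)).const_mul σ)) fun s hs => ?_
      have h1 : |σ * (p s * ξ s)| ≤ C * (F s)⁻¹ := by
        rw [abs_mul, hσ, one_mul, abs_mul, hpC s hs, ← div_eq_mul_inv]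
        exact mul_le_of_le_one_right (div_nonneg (abs_nonneg _) (hFpos s).le) (hξ1 s (hba s hs))
      have h2 : (F s)⁻¹ ≤ (F s)⁻¹ * (1 + (3 * (1 + p s ^ 2) + 4 * p s ^ 2) *
          (q s ^ 2)⁻¹ + 6 * (1 + p s ^ 2) ^ 2 * (q s ^ 4)⁻¹) := by
        apply le_mul_of_one_le_right (inv_pos.2 (hFpos s)).le
        have h3 := hqpos s hs
        have : 0 ≤ (3 * (1 + p s ^ 2) + 4 * p s ^ 2) * (q s ^ 2)⁻¹ := by positivity
        have : 0 ≤ 6 * (1 + p s ^ 2) ^ 2 * (q s ^ 4)⁻¹ := by positivity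
        linarith
      have h4 := mul_le_mul_of_nonneg_left h2 (abs_nonneg (p b * F b))
      rw [← hC] at h4
      have h5 := (abs_le.1 h1).1
      have h6 := hm s (hba s hs)
      have h7 := mul_nonneg h6.le (by linarith : 0 ≤ C * ((F s)⁻¹ * (1 + (3 * (1 + p s ^ 2) +
        4 * p s ^ 2) * (q s ^ 2)⁻¹ + 6 * (1 + p s ^ 2) ^ 2 * (q s ^ 4)⁻¹)) + σ * (p s * ξ s))
      linarith
    · simpa using (hBt'.const_mul C).add (hY.const_mul σ)
  refine squeeze_zero' (Eventually.of_forall fun s => by positivity)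
    ((eventually_ge_atTop b).mono fun s hs => ?_) (by simpa using hBt.const_mul C)
  have h1 := key 1 (by simp) s hs
  have h2 := key (-1) (by simp) s hs
  have h3 : |Y s| ≤ C * B s := abs_le.2 ⟨by linarith, by linarith⟩
  have h4 := hFpos s
  have h5 := hqpos s hs
  calc F s * |Y s| ≤ F s * (C * B s) := by gcongr
    _ = C * (q s ^ 2)⁻¹ := by simp only [hB]; field_simp

/-- The curve `c` eventually runs along the half-line in the direction of the unit vector `e`, as
the graph of a function that tends to zero. -/
def RunsAlong (c : ℝ → ℂ) (e : ℂ) : Prop :=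
  ∃ R > 0, ∃ s₀ ≥ 0, ∃ u : ℝ → ℝ,
    c '' Ici s₀ = (fun x : ℝ => x * e + u x * (Complex.I * e)) '' Ici R ∧ Tendsto u atTop (𝓝 0)

theorem re_im_of_eq {e : ℂ} (he : ‖e‖ = 1) (x y : ℝ) :
    ((x * e + y * (Complex.I * e)) * conj e).re = x ∧
      ((x * e + y * (Complex.I * e)) * conj e).im = y := by
  have h : e * conj e = 1 := by rw [Complex.mul_conj, ← Complex.sq_norm, he]; simp
  have : (x * e + y * (Complex.I * e)) * conj e = x + y * Complex.I := by
    linear_combination (x + y * Complex.I) * h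
  rw [this]; simp

theorem eq_of_mul_conj {e : ℂ} (he : ‖e‖ = 1) (z : ℂ) :
    z = ((z * conj e).re : ℂ) * e + ((z * conj e).im : ℂ) * (Complex.I * e) := by
  have h : e * conj e = 1 := by rw [Complex.mul_conj, ← Complex.sq_norm, he]; simp
  have h2 := Complex.re_add_im (z * conj e)
  linear_combination (-e) * h2 - z * h

theorem norm_sq_eq_of_norm_one {e : ℂ} (he : ‖e‖ = 1) (z : ℂ) :
    ‖z‖ ^ 2 = (z * conj e).re ^ 2 + (z * conj e).im ^ 2 := by
  have : ‖z‖ = ‖z * conj e‖ := by rw [norm_mul, Complex.norm_conj, he, mul_one]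
  rw [this, Complex.sq_norm, Complex.normSq_apply]; ring

namespace ExpanderArc

variable {γ : ℝ → ℂ} {D : Set ℝ}

/-- `RunsAlong` only describes a tail as a set. Since the tail is a graph and the arc is injective,
the coordinate along `e` is injective in the parameter, hence monotone; it cannot decrease because
it takes arbitrarily large values. -/
theorem tendsto_of_runsAlong (h : ExpanderArc γ D) (hD : Ici 0 ⊆ D) {e : ℂ} (he : ‖e‖ = 1)
    (hr : RunsAlong γ e) :
    Tendsto (fun s => (γ s * conj e).re) atTop atTop ∧
      Tendsto (fun s => (γ s * conj e).im) atTop (𝓝 0) ∧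
      Tendsto (fun s => Real.exp (‖γ s‖ ^ 2 / 2) * |(γ s * conj e).im|) atTop (𝓝 0) := by
  obtain ⟨R, hR, s₀, hs₀, u, himg, hu⟩ := hr
  have hpt : ∀ s ≥ s₀, R ≤ (γ s * conj e).re ∧ (γ s * conj e).im = u (γ s * conj e).re := by
    intro s hs
    have : γ s ∈ γ '' Ici s₀ := mem_image_of_mem _ hs
    rw [himg] at this
    obtain ⟨x, hx, hxe⟩ := this
    simp only at hxe
    rw [← hxe, (re_im_of_eq he x (u x)).1, (re_im_of_eq he x (u x)).2]
    exact ⟨hx, rfl⟩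
  have hsurj : ∀ x ≥ R, ∃ s ≥ s₀, (γ s * conj e).re = x := by
    intro x hx
    have : (x * e + u x * (Complex.I * e) : ℂ) ∈ γ '' Ici s₀ := himg ▸ mem_image_of_mem _ hx
    obtain ⟨s, hs, hse⟩ := this
    exact ⟨s, hs, by rw [hse, (re_im_of_eq he x (u x)).1]⟩
  have hsub : Ici s₀ ⊆ D := (Ici_subset_Ici.2 hs₀).trans hD
  have hinj : InjOn (fun s => (γ s * conj e).re) (Ici s₀) := by
    intro s hs t ht hst
    simp only at hst
    refine h.injOn (hsub hs) (hsub ht) ?_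
    rw [eq_of_mul_conj he (γ s), eq_of_mul_conj he (γ t), (hpt s hs).2, (hpt t ht).2, hst]
  have hcont : ContinuousOn (fun s => (γ s * conj e).re) (Ici s₀) :=
    Complex.continuous_re.comp_continuousOn ((h.continuousOn.mono hsub).mul continuousOn_const)
  have hX : Tendsto (fun s => (γ s * conj e).re) atTop atTop := by
    rcases hcont.strictMonoOn_or_strictAntiOn hinj with hm | hm
    · rw [tendsto_atTop]
      intro b
      obtain ⟨t, ht, htb⟩ := hsurj (max b R) (le_max_right _ _)
      filter_upwards [eventually_ge_atTop t] with s hs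
      have := hm.monotoneOn ht (le_trans ht hs) hs
      simp only [htb] at this
      exact (le_max_left _ _).trans this
    · obtain ⟨t, ht, htb⟩ := hsurj ((γ s₀ * conj e).re + 1) (by linarith [(hpt s₀ le_rfl).1])
      have := hm.antitoneOn self_mem_Ici ht ht
      simp only [htb] at this
      linarith
  have hY : Tendsto (fun s => (γ s * conj e).im) atTop (𝓝 0) :=
    (hu.comp hX).congr' ((eventually_ge_atTop s₀).mono fun s hs => (hpt s hs).2.symm)
  refine ⟨hX, hY, ?_⟩
  have hnhds : ∀ s ≥ (1 : ℝ), D ∈ 𝓝 s := fun s hs =>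
    mem_of_superset (Ici_mem_nhds (by linarith)) hD
  have hmem : ∀ s ≥ (1 : ℝ), s ∈ D := fun s hs => mem_of_mem_nhds (hnhds s hs)
  -- From parameter `1` on, `D` is a neighbourhood, so derivatives within `D` are genuine
  -- derivatives.
  refine tendsto_exp_mul_abs_im (τ := unitTangent γ D) (m := fun s => ‖derivWithin γ D s‖)
    (a := 1) (fun s hs => h.norm_derivWithin_pos (hmem s hs)) (fun s hs => ?_) (fun s hs => ?_)
    (fun s hs => h.norm_unitTangent (hmem s hs)) he hX hY
  · exact ((h.hasDerivWithinAt (hmem s hs)).hasDerivAt (hnhds s hs)).congr_deriv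
      (h.derivWithin_eq (hmem s hs))
  · exact (h.hasDerivWithinAt_unitTangent (hmem s hs)).hasDerivAt (hnhds s hs)

/-- Along two ends that run along the same half-line there are points with arbitrarily small first
variation. -/
theorem exists_abs_firstVariation_le {γ₀ γ₁ : ℝ → ℂ} {D : Set ℝ} (h₀ : ExpanderArc γ₀ D)
    (h₁ : ExpanderArc γ₁ D) (hD : Ici 0 ⊆ D) {e : ℂ} (he : ‖e‖ = 1) (hr₀ : RunsAlong γ₀ e)
    (hr₁ : RunsAlong γ₁ e) {ε : ℝ} (hε : 0 < ε) (S : ℝ) :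
    ∃ s ≥ S, ∃ s' ≥ S, 0 ≤ s ∧ 0 ≤ s' ∧
      |firstVariation (γ₀ s) (unitTangent γ₀ D s) (γ₁ s') (unitTangent γ₁ D s')| ≤ ε := by
  obtain ⟨hX₀, hY₀, hE₀⟩ := h₀.tendsto_of_runsAlong hD he hr₀
  obtain ⟨hX₁, hY₁, hE₁⟩ := h₁.tendsto_of_runsAlong hD he hr₁
  -- Chosen so that `2 * e^{1/2} * (δ + δ) = ε`; the factor `e^{1/2}` comes from enclosing both
  -- points in the disc of radius `√(x² + 1)`.
  set δ := ε / (4 * Real.exp (1 / 2)) with hδ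
  have hδ0 : 0 < δ := by positivity
  have hev : ∀ γ : ℝ → ℂ, Tendsto (fun s => (γ s * conj e).im) atTop (𝓝 0) →
      Tendsto (fun s => Real.exp (‖γ s‖ ^ 2 / 2) * |(γ s * conj e).im|) atTop (𝓝 0) →
      ∃ T ≥ max S 0, ∀ s ≥ T, |(γ s * conj e).im| ≤ 1 ∧
        Real.exp (‖γ s‖ ^ 2 / 2) * |(γ s * conj e).im| ≤ δ := by
    intro γ hY hE
    have h1 : ∀ᶠ s in atTop, |(γ s * conj e).im| ≤ 1 := by
      have := hY.abs
      rw [abs_zero] at this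
      exact (this.eventually_lt_const one_pos).mono fun s hs => hs.le
    have h2 := (hE.eventually_lt_const hδ0).mono fun s hs => hs.le
    obtain ⟨T, hT⟩ := (h1.and (h2.and (eventually_ge_atTop (max S 0)))).exists_forall_of_atTop
    exact ⟨T, (hT T le_rfl).2.2, fun s hs => ⟨(hT s hs).1, (hT s hs).2.1⟩⟩
  obtain ⟨T₀, hT₀, hT₀'⟩ := hev γ₀ hY₀ hE₀
  obtain ⟨T₁, hT₁, hT₁'⟩ := hev γ₁ hY₁ hE₁
  have hc : ∀ (γ : ℝ → ℂ), ExpanderArc γ D → ∀ T ≥ max S 0,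
      ContinuousOn (fun s => (γ s * conj e).re) (Ici T) := fun γ h T hT =>
    Complex.continuous_re.comp_continuousOn ((h.continuousOn.mono ((Ici_subset_Ici.2
      ((le_max_right S 0).trans hT)).trans hD)).mul continuousOn_const)
  have hiv : ∀ (γ : ℝ → ℂ), ExpanderArc γ D → Tendsto (fun s => (γ s * conj e).re) atTop atTop →
      ∀ T ≥ max S 0, ∀ x ≥ (γ T * conj e).re, ∃ s ≥ T, (γ s * conj e).re = x := by
    intro γ h hX T hT x hx
    obtain ⟨t, ht, htx⟩ := ((eventually_ge_atTop T).and (hX.eventually_ge_atTop x)).exists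
    obtain ⟨s, hs, hsx⟩ := intermediate_value_Icc ht
      ((hc γ h T hT).mono Icc_subset_Ici_self) ⟨hx, htx⟩
    exact ⟨s, hs.1, hsx⟩
  -- The two points are taken over the same point `x e` of the half-line, so their distance is at
  -- most the sum of their distances from it.
  set x := max (γ₀ T₀ * conj e).re (γ₁ T₁ * conj e).re
  obtain ⟨s, hs, hsx⟩ := hiv γ₀ h₀ hX₀ T₀ hT₀ x (le_max_left _ _)
  obtain ⟨s', hs', hsx'⟩ := hiv γ₁ h₁ hX₁ T₁ hT₁ x (le_max_right _ _)
  have hs0 : 0 ≤ s := ((le_max_right S 0).trans hT₀).trans hs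
  have hs0' : 0 ≤ s' := ((le_max_right S 0).trans hT₁).trans hs'
  refine ⟨s, ((le_max_left S 0).trans hT₀).trans hs, s', ((le_max_left S 0).trans hT₁).trans hs',
    hs0, hs0', ?_⟩
  obtain ⟨ha, hb⟩ := hT₀' s hs
  obtain ⟨ha', hb'⟩ := hT₁' s' hs'
  set y := (γ₀ s * conj e).im
  set y' := (γ₁ s' * conj e).im
  have hn := norm_sq_eq_of_norm_one he (γ₀ s)
  have hn' := norm_sq_eq_of_norm_one he (γ₁ s')
  rw [hsx] at hn
  rw [hsx'] at hn'
  have hx2 : 0 ≤ x ^ 2 + 1 := by positivity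
  have hle : ∀ {z : ℂ} {y : ℝ}, ‖z‖ ^ 2 = x ^ 2 + y ^ 2 → |y| ≤ 1 → ‖z‖ ≤ √(x ^ 2 + 1) := by
    intro z y hz hy
    refine Real.le_sqrt_of_sq_le ?_
    have := sq_le_one_iff_abs_le_one y |>.2 hy
    linarith
  refine (abs_firstVariation_le (hle hn ha) (hle hn' ha') (h₀.norm_unitTangent (hD hs0)).le
    (h₁.norm_unitTangent (hD hs0')).le).trans ?_
  have hdiff : ‖γ₁ s' - γ₀ s‖ ≤ |y| + |y'| := by
    have : γ₁ s' - γ₀ s = ((y' - y : ℝ) : ℂ) * (Complex.I * e) := by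
      rw [eq_of_mul_conj he (γ₁ s'), eq_of_mul_conj he (γ₀ s), hsx, hsx']
      push_cast
      ring
    rw [this, norm_mul, norm_mul, he, Complex.norm_I, Complex.norm_real, Real.norm_eq_abs, mul_one,
      mul_one]
    exact (abs_sub _ _).trans (by linarith)
  have hexp : Real.exp (√(x ^ 2 + 1) ^ 2 / 2) = Real.exp (1 / 2) * Real.exp (x ^ 2 / 2) := by
    rw [Real.sq_sqrt hx2, ← Real.exp_add]; congr 1; ring
  have hy : ∀ {z : ℂ} {y : ℝ}, ‖z‖ ^ 2 = x ^ 2 + y ^ 2 → Real.exp (‖z‖ ^ 2 / 2) * |y| ≤ δ →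
      Real.exp (x ^ 2 / 2) * |y| ≤ δ := by
    intro z y hz hyδ
    refine le_trans ?_ hyδ
    have : x ^ 2 ≤ ‖z‖ ^ 2 := by rw [hz]; nlinarith [sq_nonneg y]
    gcongr
  have h5 := hy hn hb
  have h6 := hy hn' hb'
  have hpos := Real.exp_pos (1 / 2 : ℝ)
  calc 2 * (Real.exp (√(x ^ 2 + 1) ^ 2 / 2) * ‖γ₁ s' - γ₀ s‖)
      ≤ 2 * (Real.exp (1 / 2) * Real.exp (x ^ 2 / 2) * (|y| + |y'|)) := by
        rw [hexp]; gcongr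
    _ = 2 * (Real.exp (1 / 2) * (Real.exp (x ^ 2 / 2) * |y| + Real.exp (x ^ 2 / 2) * |y'|)) := by
        ring
    _ ≤ 2 * (Real.exp (1 / 2) * (δ + δ)) := by gcongr
    _ = ε := by rw [hδ]; field_simp; norm_num

end ExpanderArc

/-! ### The contribution of a pair of corresponding branches. -/

/-- Sum over the end points of an arc of the pairing of a vector field with the exterior unit
tangent vector. -/
def endSum (Φ : ℂ → ℂ) (k : BranchKind) (γ : ℝ → ℂ) : ℝ :=
  ∑ᶠ e ∈ k.endpoints, inner ℝ (Φ (γ e)) (exteriorTangent γ k.dom e)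

theorem endSum_segment (Φ : ℂ → ℂ) (γ : ℝ → ℂ) : endSum Φ .segment γ =
    inner ℝ (Φ (γ 1)) (unitTangent γ (Icc 0 1) 1) -
      inner ℝ (Φ (γ 0)) (unitTangent γ (Icc 0 1) 0) := by
  unfold endSum
  simp only [BranchKind.endpoints, BranchKind.dom]
  rw [finsum_mem_pair zero_ne_one]
  simp [exteriorTangent]
  ring

theorem endSum_ray (Φ : ℂ → ℂ) (γ : ℝ → ℂ) : endSum Φ .ray γ =
    -inner ℝ (Φ (γ 0)) (unitTangent γ (Ici 0) 0) := by
  unfold endSum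
  simp only [BranchKind.endpoints, BranchKind.dom]
  rw [finsum_mem_singleton]
  simp [exteriorTangent]

theorem endSum_line (Φ : ℂ → ℂ) (γ : ℝ → ℂ) : endSum Φ .line γ = 0 := by
  simp [endSum, BranchKind.endpoints]

/-- The arc `γ₁` corresponds to the arc `γ₀` of the same kind: the map `F` sends end points to end
points, and the ends run along the same half-lines. -/
def Matched (F : ℂ → ℂ) (γ₀ γ₁ : ℝ → ℂ) : BranchKind → Prop
  | .segment => (γ₁ 0 = F (γ₀ 0) ∧ γ₁ 1 = F (γ₀ 1)) ∨ (γ₁ 1 = F (γ₀ 0) ∧ γ₁ 0 = F (γ₀ 1))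
  | .ray => γ₁ 0 = F (γ₀ 0) ∧ ∃ e, ‖e‖ = 1 ∧ RunsAlong γ₀ e ∧ RunsAlong γ₁ e
  | .line => ∃ e e', ‖e‖ = 1 ∧ ‖e'‖ = 1 ∧ RunsAlong γ₀ e ∧ RunsAlong (fun s => γ₀ (0 - s)) e' ∧
      ((RunsAlong γ₁ e ∧ RunsAlong (fun s => γ₁ (0 - s)) e') ∨
        (RunsAlong γ₁ e' ∧ RunsAlong (fun s => γ₁ (0 - s)) e))

/-- Gradient at `x` of minus half the squared distance to `y`, in the metric `e^{|z|²} |dz|²`. -/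
def towards (x y : ℂ) : ℂ := Real.exp (‖x‖ ^ 2 / 2) • geodesicVelocity x y

theorem inner_towards (x y τ : ℂ) :
    inner ℝ (towards x y) τ = Real.exp (‖x‖ ^ 2 / 2) * inner ℝ (geodesicVelocity x y) τ :=
  real_inner_smul_left _ _ _

theorem one_sub_mem_Icc (s : ℝ) : 1 - s ∈ Icc (0 : ℝ) 1 ↔ s ∈ Icc (0 : ℝ) 1 := by
  constructor <;> rintro ⟨h1, h2⟩ <;> constructor <;> linarith

namespace ExpanderArc

variable {γ₀ γ₁ : ℝ → ℂ} {D : Set ℝ}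

theorem firstVariation_mono (h₀ : ExpanderArc γ₀ D) (h₁ : ExpanderArc γ₁ D) {s s' t t' : ℝ}
    (hs : s ∈ D) (hs' : s' ∈ D) (ht : t ∈ D) (ht' : t' ∈ D) (hst : s ≤ t) (hst' : s' ≤ t') :
    firstVariation (γ₀ s) (unitTangent γ₀ D s) (γ₁ s') (unitTangent γ₁ D s') ≤
      firstVariation (γ₀ t) (unitTangent γ₀ D t) (γ₁ t') (unitTangent γ₁ D t') := by
  have h1 := h₀.monotoneOn_firstVariation (γ₁ s') (h₁.norm_unitTangent hs').le hs ht hst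
  have h2 := h₁.monotoneOn_firstVariation (γ₀ t) (h₀.norm_unitTangent ht).le hs' ht' hst'
  simp only [firstVariation_comm (γ₁ _)] at h2
  exact h1.trans h2

/-- The first variation increases towards the end in both parameters, and far out it takes values
arbitrarily close to zero. -/
theorem firstVariation_nonpos (h₀ : ExpanderArc γ₀ D) (h₁ : ExpanderArc γ₁ D) (hD : Ici 0 ⊆ D)
    {e : ℂ} (he : ‖e‖ = 1) (hr₀ : RunsAlong γ₀ e) (hr₁ : RunsAlong γ₁ e) {s s' : ℝ} (hs : s ∈ D)
    (hs' : s' ∈ D) :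
    firstVariation (γ₀ s) (unitTangent γ₀ D s) (γ₁ s') (unitTangent γ₁ D s') ≤ 0 := by
  refine le_of_forall_pos_le_add fun ε hε => ?_
  obtain ⟨t, ht, t', ht', ht0, ht0', hle⟩ :=
    h₀.exists_abs_firstVariation_le h₁ hD he hr₀ hr₁ hε (max s s')
  have := h₀.firstVariation_mono h₁ hs hs' (hD ht0) (hD ht0') ((le_max_left _ _).trans ht)
    ((le_max_right _ _).trans ht')
  linarith [(abs_le.1 hle).2]

theorem tendsto_norm_of_runsAlong {γ : ℝ → ℂ} (h : ExpanderArc γ D) (hD : Ici 0 ⊆ D) {e : ℂ}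
    (he : ‖e‖ = 1) (hr : RunsAlong γ e) : Tendsto (fun s => ‖γ s‖) atTop atTop := by
  refine tendsto_atTop_mono (fun s => ?_) (h.tendsto_of_runsAlong hD he hr).1
  refine (Complex.re_le_norm _).trans ?_
  rw [norm_mul, Complex.norm_conj, he, mul_one]

/-- The two end sums regroup into the first variation at the pair of starting points minus that at
the pair of final points. Equality squeezes the first variation to a constant on the whole parameter
square. -/
theorem segment_conclusion (h₀ : ExpanderArc γ₀ (Icc 0 1)) (h₁ : ExpanderArc γ₁ (Icc 0 1))
    {F G : ℂ → ℂ} (h0 : γ₁ 0 = F (γ₀ 0)) (h1 : γ₁ 1 = F (γ₀ 1)) (hG0 : G (γ₁ 0) = γ₀ 0)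
    (hG1 : G (γ₁ 1) = γ₀ 1) :
    endSum (fun x => towards x (F x)) .segment γ₀ + endSum (fun x => towards x (G x)) .segment γ₁
      ≤ 0 ∧
    (endSum (fun x => towards x (F x)) .segment γ₀ + endSum (fun x => towards x (G x)) .segment γ₁
      = 0 →
      (∀ t ∈ BranchKind.segment.endpoints,
        (geodesicVelocity (γ₀ t) (F (γ₀ t)) * conj (unitTangent γ₀ (Icc 0 1) t)).im = 0) ∧
      ((∀ t ∈ BranchKind.segment.endpoints, F (γ₀ t) = γ₀ t) →
        γ₀ '' Icc 0 1 = γ₁ '' Icc 0 1)) := by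
  have z0 : (0 : ℝ) ∈ Icc (0 : ℝ) 1 := left_mem_Icc.2 zero_le_one
  have z1 : (1 : ℝ) ∈ Icc (0 : ℝ) 1 := right_mem_Icc.2 zero_le_one
  have hsum : endSum (fun x => towards x (F x)) .segment γ₀ +
      endSum (fun x => towards x (G x)) .segment γ₁ =
      firstVariation (γ₀ 0) (unitTangent γ₀ (Icc 0 1) 0) (γ₁ 0) (unitTangent γ₁ (Icc 0 1) 0) -
      firstVariation (γ₀ 1) (unitTangent γ₀ (Icc 0 1) 1) (γ₁ 1) (unitTangent γ₁ (Icc 0 1) 1) := by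
    rw [endSum_segment, endSum_segment]
    simp only [firstVariation, inner_towards, hG0, hG1, ← h0, ← h1]
    ring
  have hle := h₀.firstVariation_mono h₁ z0 z0 z1 z1 zero_le_one zero_le_one
  rw [hsum]
  refine ⟨by linarith, fun heq => ?_⟩
  have hconst : ∀ s ∈ Icc (0 : ℝ) 1, ∀ s' ∈ Icc (0 : ℝ) 1,
      firstVariation (γ₀ s) (unitTangent γ₀ (Icc 0 1) s) (γ₁ s') (unitTangent γ₁ (Icc 0 1) s') =
      firstVariation (γ₀ 0) (unitTangent γ₀ (Icc 0 1) 0) (γ₁ 0) (unitTangent γ₁ (Icc 0 1) 0) := by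
    intro s hs s' hs'
    have e1 := h₀.firstVariation_mono h₁ z0 z0 hs hs' hs.1 hs'.1
    have e2 := h₀.firstVariation_mono h₁ hs hs' z1 z1 hs.2 hs'.2
    linarith
  refine ⟨?_, fun hF => h₀.image_eq_of_segments h₁ hconst ?_ ?_⟩
  · rintro t (rfl | rfl)
    · rw [← h0]
      exact h₀.im_eq_zero_of_firstVariation_eq (h₁.norm_unitTangent z0).le
        (fun s hs => hconst s hs 0 z0) z0
    · rw [← h1]
      exact h₀.im_eq_zero_of_firstVariation_eq (h₁.norm_unitTangent z1).le
        (fun s hs => hconst s hs 1 z1) z1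
  · rw [h0, hF 0 (Or.inl rfl)]
  · rw [h1, hF 1 (Or.inr rfl)]

theorem image_reverse {γ : ℝ → ℂ} {a : ℝ} (hD : ∀ s, a - s ∈ D ↔ s ∈ D) :
    (fun s => γ (a - s)) '' D = γ '' D := by
  ext z
  constructor
  · rintro ⟨s, hs, rfl⟩; exact ⟨a - s, (hD s).2 hs, rfl⟩
  · rintro ⟨s, hs, rfl⟩; exact ⟨a - s, (hD s).2 hs, by simp⟩

/-- The contribution of a pair of corresponding arcs to the first variation is nonpositive, and
only vanishes for arcs that run along the same geodesic. -/
theorem conclusion_of_matched {k : BranchKind} (h₀ : ExpanderArc γ₀ k.dom)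
    (h₁ : ExpanderArc γ₁ k.dom) {F G : ℂ → ℂ} (hm : Matched F γ₀ γ₁ k)
    (hG : ∀ t ∈ k.endpoints, G (F (γ₀ t)) = γ₀ t) :
    endSum (fun x => towards x (F x)) k γ₀ + endSum (fun x => towards x (G x)) k γ₁ ≤ 0 ∧
    (endSum (fun x => towards x (F x)) k γ₀ + endSum (fun x => towards x (G x)) k γ₁ = 0 →
      (∀ t ∈ k.endpoints,
        (geodesicVelocity (γ₀ t) (F (γ₀ t)) * conj (unitTangent γ₀ k.dom t)).im = 0) ∧
      ((∀ t ∈ k.endpoints, F (γ₀ t) = γ₀ t) → γ₀ '' k.dom = γ₁ '' k.dom)) := by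
  cases k with
  | segment =>
    have g0 := hG 0 (Or.inl rfl)
    have g1 := hG 1 (Or.inr rfl)
    rcases hm with ⟨h0, h1⟩ | ⟨h1, h0⟩
    · exact h₀.segment_conclusion h₁ h0 h1 (by rw [h0, g0]) (by rw [h1, g1])
    -- If the end points correspond crosswise, reversing the second arc changes neither its image
    -- nor its end sum.
    · have h₁' := h₁.reverse one_sub_mem_Icc
      have := h₀.segment_conclusion h₁' (F := F) (G := G) (by simp [h1]) (by simp [h0])
        (by simp [h1, g0]) (by simp [h0, g1])
      have hend : endSum (fun x => towards x (G x)) .segment (fun s => γ₁ (1 - s)) =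
          endSum (fun x => towards x (G x)) .segment γ₁ := by
        rw [endSum_segment, endSum_segment, unitTangent_reverse one_sub_mem_Icc,
          unitTangent_reverse one_sub_mem_Icc]
        simp only [sub_self, sub_zero, inner_neg_right]
        ring
      rw [image_reverse one_sub_mem_Icc, hend] at this
      exact this
  | ray =>
    simp only [BranchKind.dom] at h₀ h₁ ⊢
    obtain ⟨h0, e, he, hr₀, hr₁⟩ := hm
    have hle := fun s hs s' hs' => h₀.firstVariation_nonpos h₁ Subset.rfl he hr₀ hr₁
      (s := s) (s' := s') hs hs'
    have z0 : (0 : ℝ) ∈ Ici (0 : ℝ) := self_mem_Ici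
    have g0 : G (γ₁ 0) = γ₀ 0 := by rw [h0]; exact hG 0 rfl
    have hsum : endSum (fun x => towards x (F x)) .ray γ₀ +
        endSum (fun x => towards x (G x)) .ray γ₁ =
        firstVariation (γ₀ 0) (unitTangent γ₀ (Ici 0) 0) (γ₁ 0) (unitTangent γ₁ (Ici 0) 0) := by
      rw [endSum_ray, endSum_ray]
      simp only [firstVariation, inner_towards, g0, ← h0]
      ring
    rw [hsum]
    refine ⟨hle 0 z0 0 z0, fun heq => ?_⟩
    have hconst : ∀ s ∈ Ici (0 : ℝ), ∀ s' ∈ Ici (0 : ℝ),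
        firstVariation (γ₀ s) (unitTangent γ₀ (Ici 0) s) (γ₁ s') (unitTangent γ₁ (Ici 0) s') = 0 := by
      intro s hs s' hs'
      have e1 := h₀.firstVariation_mono h₁ z0 z0 hs hs' hs hs'
      exact le_antisymm (hle s hs s' hs') (heq.symm.le.trans e1)
    refine ⟨?_, fun hF => h₀.image_eq_of_rays h₁ hconst ?_
      (h₀.tendsto_norm_of_runsAlong Subset.rfl he hr₀)
      (h₁.tendsto_norm_of_runsAlong Subset.rfl he hr₁)⟩
    · rintro t rfl
      rw [← h0]
      exact h₀.im_eq_zero_of_firstVariation_eq (h₁.norm_unitTangent z0).le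
        (fun s hs => hconst s hs 0 z0) z0
    · rw [h0, hF 0 rfl]
  | line =>
    simp only [BranchKind.dom] at h₀ h₁ ⊢
    have hu : ∀ s : ℝ, 0 - s ∈ (univ : Set ℝ) ↔ s ∈ (univ : Set ℝ) := by simp
    have hrev := h₀.reverse hu
    have key : ∀ γ : ℝ → ℂ, ExpanderArc γ univ → ∀ e e' : ℂ, ‖e‖ = 1 → ‖e'‖ = 1 →
        RunsAlong γ₀ e → RunsAlong (fun s => γ₀ (0 - s)) e' → RunsAlong γ e →
        RunsAlong (fun s => γ (0 - s)) e' → γ₀ '' univ = γ '' univ := by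
      intro γ h e e' he he' hr₀ hr₀' hr hr'
      have hb : ∀ γ : ℝ → ℂ, ExpanderArc γ univ → RunsAlong (fun s => γ (0 - s)) e' →
          Tendsto (fun s => ‖γ s‖) atBot atTop := fun γ h hr => by
        have := ((h.reverse hu).tendsto_norm_of_runsAlong (subset_univ _) he' hr).comp
          tendsto_neg_atBot_atTop
        simpa [Function.comp_def] using this
      -- The end at `+∞` gives one sign. Reversing both lines negates the first variation, so the
      -- end at `-∞` gives the other.
      refine h₀.image_eq_of_lines h (k := 0) (fun s s' => le_antisymm
        (h₀.firstVariation_nonpos h (subset_univ _) he hr₀ hr (mem_univ s) (mem_univ s')) ?_)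
        (h₀.tendsto_norm_of_runsAlong (subset_univ _) he hr₀) (hb γ₀ h₀ hr₀')
        (h.tendsto_norm_of_runsAlong (subset_univ _) he hr) (hb γ h hr')
      have := hrev.firstVariation_nonpos (h.reverse hu) (subset_univ _) he' hr₀' hr'
        (mem_univ (0 - s)) (mem_univ (0 - s'))
      simp only [unitTangent_reverse hu, sub_sub_cancel, firstVariation, inner_neg_right] at this ⊢
      linarith
    rw [endSum_line, endSum_line]
    refine ⟨by simp, fun _ => ⟨by simp [BranchKind.endpoints], fun _ => ?_⟩⟩
    obtain ⟨e, e', he, he', hr₀, hr₀', h | h⟩ := hm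
    · exact key γ₁ h₁ e e' he he' hr₀ hr₀' h.1 h.2
    · rw [← image_reverse (γ := γ₁) hu]
      exact key _ (h₁.reverse hu) e e' he he' hr₀ hr₀' h.2 (by simpa using h.1)

end ExpanderArc

/-! ### Balancing at the triple junctions. -/

theorem BranchKind.convex_dom (k : BranchKind) : Convex ℝ k.dom := by
  cases k
  exacts [convex_Icc 0 1, convex_Ici 0, convex_univ]

theorem BranchKind.uniqueDiffOn_dom (k : BranchKind) : UniqueDiffOn ℝ k.dom := by
  cases k
  exacts [uniqueDiffOn_Icc zero_lt_one, uniqueDiffOn_Ici 0, uniqueDiffOn_univ]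

theorem BranchKind.endpoints_subset (k : BranchKind) : k.endpoints ⊆ k.dom := by
  cases k
  · rintro t (rfl | rfl) <;> simp [dom]
  · rintro t rfl; simp [dom]
  · exact empty_subset _

theorem BranchKind.finite_endpoints (k : BranchKind) : k.endpoints.Finite := by
  cases k <;> simp [endpoints]

/-- Three unit vectors with sum zero are not collinear. -/
theorem eq_zero_of_im_eq_zero_of_add_eq_zero {v a b c : ℂ} (ha : ‖a‖ = 1) (hb : ‖b‖ = 1)
    (hc : ‖c‖ = 1) (h : a + b + c = 0) (hva : (v * conj a).im = 0) (hvb : (v * conj b).im = 0)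
    (hvc : (v * conj c).im = 0) : v = 0 := by
  by_contra hv
  have hsq : ∀ {a : ℂ}, ‖a‖ = 1 → (v * conj a).im = 0 → (v * conj a).re ^ 2 = ‖v‖ ^ 2 := by
    intro a ha h
    have := norm_sq_eq_of_norm_one ha v
    rw [h] at this
    rw [this]; ring
  have hsum : (v * conj a).re + (v * conj b).re + (v * conj c).re = 0 := by
    rw [← Complex.add_re, ← Complex.add_re, ← mul_add, ← mul_add, ← map_add, ← map_add, h]
    simp
  have h1 := hsq ha hva
  have h2 := hsq hb hvb
  have h3 := hsq hc hvc
  have hpos : 0 < ‖v‖ := norm_pos_iff.2 hv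
  rcases sq_eq_sq_iff_eq_or_eq_neg.1 h1 with e1 | e1 <;>
  rcases sq_eq_sq_iff_eq_or_eq_neg.1 h2 with e2 | e2 <;>
  rcases sq_eq_sq_iff_eq_or_eq_neg.1 h3 with e3 | e3 <;>
  rw [e1, e2, e3] at hsum <;> linarith

namespace RegularNetwork

variable {N M : RegularNetwork}

theorem IsSelfExpander.expanderArc (h : N.IsSelfExpander) (b : Fin N.n) :
    ExpanderArc (N.curve b) (N.kind b).dom :=
  ⟨(N.kind b).convex_dom, (N.kind b).uniqueDiffOn_dom, N.smooth b, N.immersed b, h b⟩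

/-- Group the ends of all branches by the point they sit at. The field `Φ` depends on that point
only, so it factors out of the sum of the three tangents, which is zero. -/
theorem sum_endSum_eq_zero (N : RegularNetwork) (Φ : ℂ → ℂ) :
    ∑ b, endSum Φ (N.kind b) (N.curve b) = 0 := by
  classical
  have hfin : ∀ b, Finite (N.kind b).endpoints := fun b => (N.kind b).finite_endpoints
  have hft : ∀ b, Fintype (N.kind b).endpoints := fun b => Fintype.ofFinite _
  set f : (j : Fin N.n) × (N.kind j).endpoints → ℝ := fun x =>
    inner ℝ (Φ (N.curve x.1 x.2)) (exteriorTangent (N.curve x.1) (N.kind x.1).dom x.2) with hf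
  have h1 : ∑ b, endSum Φ (N.kind b) (N.curve b) = ∑ x, f x := by
    rw [Fintype.sum_sigma]
    refine Finset.sum_congr rfl fun b _ => ?_
    rw [endSum, ← finsum_set_coe_eq_finsum_mem, finsum_eq_sum_of_fintype]
  rw [h1, ← Finset.sum_fiberwise_of_maps_to (s := Finset.univ)
    (t := Finset.univ.image fun x : (j : Fin N.n) × (N.kind j).endpoints => N.curve x.1 x.2)
    (g := fun x => N.curve x.1 x.2) (fun x _ => Finset.mem_image_of_mem _ (Finset.mem_univ x))]
  refine Finset.sum_eq_zero fun z hz => ?_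
  obtain ⟨x, -, rfl⟩ := Finset.mem_image.1 hz
  obtain ⟨p, q, r, hpq, hpr, hqr, hiff, hsum⟩ := N.triple x.1 x.2 x.2.2
  have hfil : (Finset.univ.filter fun y : (j : Fin N.n) × (N.kind j).endpoints =>
      N.curve y.1 y.2 = N.curve x.1 x.2) = {p, q, r} := by
    ext y
    simp [hiff]
  have hpt : ∀ y, (y = p ∨ y = q ∨ y = r) → f y = inner ℝ (Φ (N.curve x.1 x.2))
      (exteriorTangent (N.curve y.1) (N.kind y.1).dom y.2) := fun y hy => by
    rw [hf]; simp only; rw [(hiff y).2 hy]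
  rw [hfil, Finset.sum_insert (by simp [hpq, hpr]), Finset.sum_insert (by simp [hqr]),
    Finset.sum_singleton, hpt p (by simp), hpt q (by simp), hpt r (by simp), ← inner_add_right,
    ← inner_add_right, ← add_assoc, hsum, inner_zero_right]

/-- Two self-expanders whose branches correspond to each other coincide. -/
theorem carrier_eq_of_matched (h₀ : N.IsSelfExpander) (h₁ : M.IsSelfExpander) {F G : ℂ → ℂ}
    (g : Fin N.n ≃ Fin M.n) (hk : ∀ b, M.kind (g b) = N.kind b)
    (hm : ∀ b, Matched F (N.curve b) (M.curve (g b)) (N.kind b))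
    (hG : ∀ b, ∀ t ∈ (N.kind b).endpoints, G (F (N.curve b t)) = N.curve b t) :
    N.carrier = M.carrier := by
  have harc : ∀ b, ExpanderArc (M.curve (g b)) (N.kind b).dom := fun b => hk b ▸ h₁.expanderArc (g b)
  have hc := fun b => (h₀.expanderArc b).conclusion_of_matched (harc b) (hm b) (hG b)
  have hsum : ∑ b, (endSum (fun x => towards x (F x)) (N.kind b) (N.curve b) +
      endSum (fun x => towards x (G x)) (N.kind b) (M.curve (g b))) = 0 := by
    rw [Finset.sum_add_distrib, N.sum_endSum_eq_zero, zero_add,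
      ← M.sum_endSum_eq_zero (fun x => towards x (G x)), ← g.sum_comp]
    exact Finset.sum_congr rfl fun b _ => by rw [hk b]
  -- The total vanishes by balancing in both networks, and every summand is nonpositive, so every
  -- summand is zero.
  have hzero := fun b => (Finset.sum_eq_zero_iff_of_nonpos fun b _ => (hc b).1).1 hsum b
    (Finset.mem_univ b)
  have hpar := fun b => ((hc b).2 (hzero b)).1
  have hext : ∀ y : (j : Fin N.n) × (N.kind j).endpoints,
      ‖exteriorTangent (N.curve y.1) (N.kind y.1).dom y.2‖ = 1 ∧
      (geodesicVelocity (N.curve y.1 y.2) (F (N.curve y.1 y.2)) *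
        conj (exteriorTangent (N.curve y.1) (N.kind y.1).dom y.2)).im = 0 := by
    intro y
    have e1 := (h₀.expanderArc y.1).norm_unitTangent ((N.kind y.1).endpoints_subset y.2.2)
    have e2 := hpar y.1 y.2 y.2.2
    unfold exteriorTangent
    split_ifs
    · rw [norm_neg, map_neg, mul_neg, Complex.neg_im, e2, neg_zero]
      exact ⟨e1, rfl⟩
    · exact ⟨e1, e2⟩
  -- The velocity towards the image of a junction is parallel to three tangents with sum zero, hence
  -- zero.
  have hfix : ∀ b, ∀ t ∈ (N.kind b).endpoints, F (N.curve b t) = N.curve b t := by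
    intro b t ht
    obtain ⟨p, q, r, -, -, -, hiff, hs⟩ := N.triple b t ht
    have hp := hext p
    have hq := hext q
    have hr := hext r
    rw [(hiff p).2 (by simp)] at hp
    rw [(hiff q).2 (by simp)] at hq
    rw [(hiff r).2 (by simp)] at hr
    exact (geodesicVelocity_eq_zero.1 (eq_zero_of_im_eq_zero_of_add_eq_zero hp.1 hq.1 hr.1 hs
      hp.2 hq.2 hr.2)).symm
  have himg := fun b => ((hc b).2 (hzero b)).2 (hfix b)
  unfold carrier
  rw [← g.surjective.iUnion_comp]
  exact iUnion_congr fun b => by rw [hk b]; exact himg b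

end RegularNetwork

/-! ### Topology of branches and networks. -/

namespace BranchKind

/-- The parameters of a branch that are not parameters of end points. -/
def core (k : BranchKind) : Set ℝ := k.dom \ k.endpoints

theorem core_subset (k : BranchKind) : k.core ⊆ k.dom := sdiff_subset

theorem core_segment : core .segment = Ioo 0 1 := Icc_sdiff_both

theorem core_ray : core .ray = Ioi 0 := Ici_sdiff_left

theorem core_line : core .line = univ := sdiff_empty

theorem isClosed_dom (k : BranchKind) : IsClosed k.dom := by
  cases k
  exacts [isClosed_Icc, isClosed_Ici, isClosed_univ]

theorem isPreconnected_core (k : BranchKind) : IsPreconnected k.core := by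
  cases k
  exacts [core_segment ▸ isPreconnected_Ioo, core_ray ▸ isPreconnected_Ioi,
    core_line ▸ isPreconnected_univ]

theorem half_mem_core (k : BranchKind) : (1 / 2 : ℝ) ∈ k.core := by
  cases k
  · rw [core_segment]; norm_num
  · rw [core_ray]; norm_num
  · rw [core_line]; trivial

theorem dom_subset_closure_core (k : BranchKind) : k.dom ⊆ closure k.core := by
  cases k
  · rw [core_segment, closure_Ioo zero_ne_one]; exact Subset.rfl
  · rw [core_ray, closure_Ioi]; exact Subset.rfl
  · rw [core_line, closure_univ]; exact Subset.rfl

theorem eq_zero_or_eq_one_of_mem_endpoints {k : BranchKind} {e : ℝ} (he : e ∈ k.endpoints) :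
    e = 0 ∨ e = 1 := by
  cases k
  exacts [he, Or.inl he, he.elim]

/-- The expression `|e - t|` moves inwards from either end point: it is `t` for `e = 0` and `1 - t`
for `e = 1`. With `t < 1/2` the pieces from the two ends stay disjoint. -/
theorem abs_sub_mem_core {k : BranchKind} {e t : ℝ} (he : e ∈ k.endpoints) (h0 : 0 < t)
    (h1 : t < 1 / 2) : |e - t| ∈ k.core := by
  cases k
  · rw [core_segment]
    rcases he with rfl | rfl
    · rw [zero_sub, abs_neg, abs_of_pos h0]; constructor <;> linarith
    · rw [abs_of_pos (by linarith)]; constructor <;> linarith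
  · rw [core_ray]
    obtain rfl : e = 0 := he
    rw [zero_sub, abs_neg, abs_of_pos h0]; exact h0
  · exact he.elim

theorem abs_sub_mem_dom {k : BranchKind} {e t : ℝ} (he : e ∈ k.endpoints) (h0 : 0 ≤ t)
    (h1 : t < 1 / 2) : |e - t| ∈ k.dom := by
  rcases h0.eq_or_lt with rfl | h0
  · rw [sub_zero, abs_of_nonneg]
    · exact k.endpoints_subset he
    · rcases eq_zero_or_eq_one_of_mem_endpoints he with rfl | rfl <;> norm_num
  · exact (abs_sub_mem_core he h0 h1).1

theorem eq_of_abs_sub_eq {k k' : BranchKind} {e e' t t' : ℝ} (he : e ∈ k.endpoints)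
    (he' : e' ∈ k'.endpoints) (h0 : 0 < t) (h1 : t < 1 / 2) (h0' : 0 < t') (h1' : t' < 1 / 2)
    (h : |e - t| = |e' - t'|) : e = e' := by
  rcases eq_zero_or_eq_one_of_mem_endpoints he with rfl | rfl <;>
    rcases eq_zero_or_eq_one_of_mem_endpoints he' with rfl | rfl
  · rfl
  · rw [zero_sub, abs_neg, abs_of_pos h0, abs_of_pos (by linarith)] at h; linarith
  · rw [zero_sub, abs_neg, abs_of_pos h0', abs_of_pos (by linarith)] at h; linarith
  · rfl

theorem eq_of_ncard_endpoints_eq {k k' : BranchKind} (h : k.endpoints.ncard = k'.endpoints.ncard) :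
    k = k' := by
  have h2 : (endpoints .segment).ncard = 2 := ncard_pair zero_ne_one
  have h1 : (endpoints .ray).ncard = 1 := ncard_singleton 0
  have h0 : (endpoints .line).ncard = 0 := ncard_empty ℝ
  cases k <;> cases k' <;> first | rfl | omega

theorem exists_forall_lt_norm {k : BranchKind} {c : ℝ → ℂ}
    (hinf : ∀ σ ∈ k.directions, Tendsto (fun s : ℝ => ‖c (σ * s)‖) atTop atTop) (R : ℝ) :
    ∃ T, ∀ s ∈ k.dom, T < |s| → R < ‖c s‖ := by
  have key : ∀ σ ∈ k.directions, ∃ T, ∀ s > T, R < ‖c (σ * s)‖ := fun σ hσ => by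
    obtain ⟨T, hT⟩ := eventually_atTop.1 ((hinf σ hσ).eventually_gt_atTop R)
    exact ⟨T, fun s hs => hT s hs.le⟩
  cases k with
  | segment => exact ⟨1, fun s hs h => absurd h (abs_of_nonneg hs.1 ▸ hs.2).not_gt⟩
  | ray =>
    obtain ⟨T, hT⟩ := key 1 rfl
    refine ⟨T, fun s hs h => ?_⟩
    rw [abs_of_nonneg hs] at h
    simpa using hT s h
  | line =>
    obtain ⟨T, hT⟩ := key 1 (Or.inl rfl)
    obtain ⟨T', hT'⟩ := key (-1) (Or.inr rfl)
    refine ⟨max T T', fun s _ h => ?_⟩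
    obtain ⟨h1, h2⟩ := max_lt_iff.1 h
    rcases le_total 0 s with hs | hs
    · rw [abs_of_nonneg hs] at h1
      simpa using hT s h1
    · rw [abs_of_nonpos hs] at h2
      simpa using hT' (-s) h2

/-- Arcs that run to infinity map closed sets of parameters to closed sets. -/
theorem isClosed_image {k : BranchKind} {c : ℝ → ℂ} (hc : ContinuousOn c k.dom)
    (hinf : ∀ σ ∈ k.directions, Tendsto (fun s : ℝ => ‖c (σ * s)‖) atTop atTop) {S : Set ℝ}
    (hS : IsClosed S) (hSk : S ⊆ k.dom) : IsClosed (c '' S) := by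
  refine isClosed_of_closure_subset fun y hy => ?_
  obtain ⟨T, hT⟩ := exists_forall_lt_norm hinf (‖y‖ + 1)
  have hcpt : IsClosed (c '' (S ∩ Icc (-T) T)) :=
    ((isCompact_Icc.inter_left hS).image_of_continuousOn
      (hc.mono (inter_subset_left.trans hSk))).isClosed
  have h1 : y ∈ closure (Metric.ball 0 (‖y‖ + 1) ∩ c '' S) :=
    Metric.isOpen_ball.inter_closure ⟨by simp, hy⟩
  have h2 : Metric.ball 0 (‖y‖ + 1) ∩ c '' S ⊆ c '' (S ∩ Icc (-T) T) := by
    rintro _ ⟨hb, s, hs, rfl⟩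
    refine ⟨s, ⟨hs, abs_le.1 (not_lt.1 fun h => ?_)⟩, rfl⟩
    have := hT s (hSk hs) h
    rw [mem_ball_zero_iff] at hb
    linarith
  exact image_mono inter_subset_left (hcpt.closure_subset_iff.2 h2 h1)

end BranchKind

namespace RegularNetwork

variable {N M : RegularNetwork}

theorem mem_carrier (N : RegularNetwork) {b : Fin N.n} {s : ℝ} (hs : s ∈ (N.kind b).dom) :
    N.curve b s ∈ N.carrier := mem_iUnion.2 ⟨b, s, hs, rfl⟩

theorem continuousOn_curve (N : RegularNetwork) (b : Fin N.n) :
    ContinuousOn (N.curve b) (N.kind b).dom := (N.smooth b).continuousOn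

theorem isClosed_image_curve (N : RegularNetwork) (b : Fin N.n) {S : Set ℝ} (hS : IsClosed S)
    (hSk : S ⊆ (N.kind b).dom) : IsClosed (N.curve b '' S) :=
  BranchKind.isClosed_image (N.continuousOn_curve b) (fun σ hσ => (N.approaches b σ hσ).1) hS hSk

theorem isClosed_carrier (N : RegularNetwork) : IsClosed N.carrier :=
  isClosed_iUnion_of_finite fun b => N.isClosed_image_curve b (N.kind b).isClosed_dom Subset.rfl

/-- A branch without its end points is relatively open in the network. -/
theorem exists_isOpen_image_core_eq (N : RegularNetwork) (b : Fin N.n) :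
    ∃ O : Set ℂ, IsOpen O ∧ N.curve b '' (N.kind b).core = O ∩ N.carrier := by
  classical
  -- The open set is the complement of all other branches and of the end points of `b`, a finite
  -- union of closed sets.
  set S : Fin N.n → Set ℝ := fun j => if j = b then (N.kind j).endpoints else (N.kind j).dom with hS
  have hSd : ∀ j, S j ⊆ (N.kind j).dom := fun j => by
    rw [hS]; dsimp only; split_ifs
    exacts [(N.kind j).endpoints_subset, Subset.rfl]
  have hSc : ∀ j, IsClosed (S j) := fun j => by
    rw [hS]; dsimp only; split_ifs
    exacts [(N.kind j).finite_endpoints.isClosed, (N.kind j).isClosed_dom]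
  refine ⟨(⋃ j, N.curve j '' S j)ᶜ, (isClosed_iUnion_of_finite fun j =>
    N.isClosed_image_curve j (hSc j) (hSd j)).isOpen_compl, Subset.antisymm ?_ ?_⟩
  · rintro _ ⟨s, hs, rfl⟩
    refine ⟨fun hmem => ?_, N.mem_carrier hs.1⟩
    obtain ⟨j, t, ht, hts⟩ := mem_iUnion.1 hmem
    obtain ⟨rfl, rfl⟩ := N.embedded b j s hs t (hSd j ht) hts.symm
    simp only [hS, if_true] at ht
    exact hs.2 ht
  · rintro x ⟨hx, hxc⟩
    obtain ⟨j, t, ht, rfl⟩ := mem_iUnion.1 hxc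
    have hn : t ∉ S j := fun h => hx (mem_iUnion.2 ⟨j, t, h, rfl⟩)
    simp only [hS] at hn
    split_ifs at hn with hj
    · subst hj
      exact ⟨t, ⟨ht, hn⟩, rfl⟩
    · exact (hn ht).elim

theorem notMem_junctions_of_mem_core (N : RegularNetwork) {b : Fin N.n} {s : ℝ}
    (hs : s ∈ (N.kind b).core) : N.curve b s ∉ N.junctions := fun h => by
  obtain ⟨j, e, he, hes⟩ := mem_iUnion.1 h
  obtain ⟨rfl, rfl⟩ := N.embedded b j s hs e ((N.kind j).endpoints_subset he) hes.symm
  exact hs.2 he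

/-- The parameter of a point of the branch `b`. -/
def param (N : RegularNetwork) (b : Fin N.n) : ℂ → ℝ :=
  Function.invFunOn (N.curve b) (N.kind b).dom

theorem param_mem (N : RegularNetwork) {b : Fin N.n} {x : ℂ}
    (hx : x ∈ N.curve b '' (N.kind b).dom) : N.param b x ∈ (N.kind b).dom :=
  Function.invFunOn_mem hx

theorem curve_param (N : RegularNetwork) {b : Fin N.n} {x : ℂ}
    (hx : x ∈ N.curve b '' (N.kind b).dom) : N.curve b (N.param b x) = x :=
  Function.invFunOn_eq hx

theorem param_curve (hN : N.IsSelfExpander) {b : Fin N.n} {s : ℝ} (hs : s ∈ (N.kind b).dom) :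
    N.param b (N.curve b s) = s :=
  (hN.expanderArc b).injOn (N.param_mem (mem_image_of_mem _ hs)) hs
    (N.curve_param (mem_image_of_mem _ hs))

/-- A branch maps closed parameter sets to closed sets because it runs to infinity properly, so its
inverse is continuous. -/
theorem continuousOn_param (hN : N.IsSelfExpander) (b : Fin N.n) :
    ContinuousOn (N.param b) (N.curve b '' (N.kind b).dom) := by
  refine continuousOn_iff_isClosed.2 fun t ht => ⟨N.curve b '' (t ∩ (N.kind b).dom),
    N.isClosed_image_curve b (ht.inter (N.kind b).isClosed_dom) inter_subset_right, ?_⟩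
  ext x
  constructor
  · rintro ⟨hxt, s, hs, rfl⟩
    rw [mem_preimage, param_curve hN hs] at hxt
    exact ⟨⟨s, ⟨hxt, hs⟩, rfl⟩, s, hs, rfl⟩
  · rintro ⟨⟨s, ⟨hst, hs⟩, rfl⟩, h⟩
    refine ⟨?_, h⟩
    rwa [mem_preimage, param_curve hN hs]

/-! ### Homeomorphisms between networks. -/

/-- A homeomorphism between the carriers of two networks, with inverse `g`, that approaches the
identity at infinity. -/
structure CarrierHomeo (N M : RegularNetwork) (f g : ℂ → ℂ) : Prop where
  continuousOn : ContinuousOn f N.carrier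
  mapsTo : MapsTo f N.carrier M.carrier
  leftInv : LeftInvOn g f N.carrier
  near : ∀ ε > 0, ∃ r : ℝ, ∀ x ∈ N.carrier, r ≤ ‖x‖ → ‖f x - x‖ ≤ ε
  continuousOn_inv : ContinuousOn g M.carrier
  mapsTo_inv : MapsTo g M.carrier N.carrier
  rightInv : LeftInvOn f g M.carrier
  near_inv : ∀ ε > 0, ∃ r : ℝ, ∀ y ∈ M.carrier, r ≤ ‖y‖ → ‖g y - y‖ ≤ ε

namespace CarrierHomeo

variable {f g : ℂ → ℂ}

theorem symm (h : CarrierHomeo N M f g) : CarrierHomeo M N g f :=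
  ⟨h.5, h.6, h.7, h.8, h.1, h.2, h.3, h.4⟩

end CarrierHomeo

/-- Integrating the velocity in time shows that the time-one map approaches the identity at
infinity. Therefore the images of non-compact branches still run to infinity, the map is closed on
each branch, and its inverse is continuous. -/
theorem exists_carrierHomeo (F : ℝ → ℂ → ℂ)
    (hsm : ∀ b, ContDiffOn ℝ ∞ (fun p : ℝ × ℝ => F p.1 (N.curve b p.2)) (Icc 0 1 ×ˢ (N.kind b).dom))
    (h0 : EqOn (F 0) id N.carrier) (h1 : BijOn (F 1) N.carrier M.carrier)
    (hv : ∀ ε > 0, ∃ r : ℝ, ∀ t ∈ Icc (0 : ℝ) 1, ∀ x ∈ N.carrier, r ≤ ‖x‖ →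
      ‖derivWithin (fun τ => F τ x) (Icc 0 1) t‖ ≤ ε) :
    ∃ g, CarrierHomeo N M (F 1) g := by
  have hone : (1 : ℝ) ∈ Icc (0 : ℝ) 1 := ⟨zero_le_one, le_rfl⟩
  have hzero : (0 : ℝ) ∈ Icc (0 : ℝ) 1 := ⟨le_rfl, zero_le_one⟩
  have hnear : ∀ ε > 0, ∃ r : ℝ, ∀ x ∈ N.carrier, r ≤ ‖x‖ → ‖F 1 x - x‖ ≤ ε := by
    intro ε hε
    obtain ⟨r, hr⟩ := hv ε hε
    refine ⟨r, fun x hx hxr => ?_⟩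
    have hd : DifferentiableOn ℝ (fun τ => F τ x) (Icc 0 1) := by
      obtain ⟨b, s, hs, rfl⟩ := mem_iUnion.1 hx
      have := (hsm b).comp (s := Icc (0 : ℝ) 1) (f := fun τ : ℝ => (τ, s))
        (contDiff_id.prodMk contDiff_const).contDiffOn fun τ hτ => ⟨hτ, hs⟩
      exact this.differentiableOn (by simp)
    have := (convex_Icc (0 : ℝ) 1).norm_image_sub_le_of_norm_derivWithin_le hd
      (fun t ht => hr t ht x hx hxr) hzero hone
    simpa [h0 hx] using this
  have hcb : ∀ b, ContinuousOn (fun s => F 1 (N.curve b s)) (N.kind b).dom := fun b =>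
    (hsm b).continuousOn.comp (f := fun s : ℝ => ((1 : ℝ), s)) (by fun_prop) fun s hs => ⟨hone, hs⟩
  have hinf : ∀ b, ∀ σ ∈ (N.kind b).directions,
      Tendsto (fun s : ℝ => ‖F 1 (N.curve b (σ * s))‖) atTop atTop := by
    intro b σ hσ
    obtain ⟨r, hr⟩ := hnear 1 one_pos
    have ht := (N.approaches b σ hσ).1
    refine tendsto_atTop_mono' _ ?_ (tendsto_atTop_add_const_right _ (-1) ht)
    filter_upwards [ht.eventually_ge_atTop r, eventually_ge_atTop 0] with s hs hs0
    have hd : σ * s ∈ (N.kind b).dom := by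
      revert hσ
      generalize N.kind b = k
      intro hσ
      cases k
      · exact hσ.elim
      · obtain rfl : σ = 1 := hσ
        rw [one_mul]; exact hs0
      · trivial
    have := hr _ (N.mem_carrier hd) hs
    have h2 := norm_sub_norm_le (N.curve b (σ * s)) (F 1 (N.curve b (σ * s)))
    rw [norm_sub_rev] at h2
    linarith
  have hcont : ContinuousOn (F 1) N.carrier := by
    refine continuousOn_iff_isClosed.2 fun t ht => ⟨_, isClosed_iUnion_of_finite fun b =>
      N.isClosed_image_curve b ((hcb b).preimage_isClosed_of_isClosed (N.kind b).isClosed_dom ht)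
        inter_subset_left, ?_⟩
    ext x
    constructor
    · rintro ⟨hxt, hx⟩
      obtain ⟨b, s, hs, rfl⟩ := mem_iUnion.1 hx
      exact ⟨mem_iUnion.2 ⟨b, s, ⟨hs, hxt⟩, rfl⟩, hx⟩
    · rintro ⟨hx', hx⟩
      obtain ⟨b, s, ⟨hs, hst⟩, rfl⟩ := mem_iUnion.1 hx'
      exact ⟨hst, hx⟩
  have hinv := h1.invOn_invFunOn
  have hgm : MapsTo (Function.invFunOn (F 1) N.carrier) M.carrier N.carrier :=
    fun y hy => Function.invFunOn_mem (h1.surjOn hy)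
  refine ⟨Function.invFunOn (F 1) N.carrier, hcont, h1.mapsTo, hinv.1, hnear, ?_, hgm, hinv.2, ?_⟩
  · refine continuousOn_iff_isClosed.2 fun t ht => ⟨_, isClosed_iUnion_of_finite fun b =>
      BranchKind.isClosed_image (hcb b) (hinf b)
        ((N.continuousOn_curve b).preimage_isClosed_of_isClosed (N.kind b).isClosed_dom ht)
        inter_subset_left, ?_⟩
    ext y
    constructor
    · rintro ⟨hyt, hy⟩
      refine ⟨?_, hy⟩
      obtain ⟨b, s, hs, hsy⟩ := mem_iUnion.1 (hgm hy)
      refine mem_iUnion.2 ⟨b, s, ⟨hs, ?_⟩, ?_⟩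
      · rw [mem_preimage, hsy]; exact hyt
      · simp only [hsy]; exact hinv.2 hy
    · rintro ⟨hy', hy⟩
      obtain ⟨b, s, ⟨hs, hst⟩, rfl⟩ := mem_iUnion.1 hy'
      refine ⟨?_, hy⟩
      rw [mem_preimage, hinv.1 (N.mem_carrier hs)]
      exact hst
  · intro ε hε
    obtain ⟨r, hr⟩ := hnear ε hε
    -- The part of the network in the ball of radius `r` has bounded image, so points beyond that
    -- image come from outside the ball.
    obtain ⟨B, hB⟩ := (((isCompact_closedBall (0 : ℂ) r).inter_left
      N.isClosed_carrier).image_of_continuousOn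
        (hcont.mono inter_subset_left)).isBounded.exists_norm_le
    refine ⟨B + 1, fun y hy hyB => ?_⟩
    have hle : r ≤ ‖Function.invFunOn (F 1) N.carrier y‖ := by
      by_contra! hlt
      have := hB (F 1 (Function.invFunOn (F 1) N.carrier y))
        (mem_image_of_mem _ ⟨hgm hy, by simpa using hlt.le⟩)
      rw [hinv.2 hy] at this
      linarith
    have := hr _ (hgm hy) hle
    rwa [hinv.2 hy, norm_sub_rev] at this

end RegularNetwork

theorem exists_common_value_of_lt {h₁ h₂ : ℝ → ℝ} {ε₁ ε₂ c : ℝ} (hε₁ : 0 < ε₁) (hε₂ : 0 < ε₂)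
    (hc₁ : ContinuousOn h₁ (Icc 0 ε₁)) (hc₂ : ContinuousOn h₂ (Icc 0 ε₂)) (h₁0 : h₁ 0 = c)
    (h₂0 : h₂ 0 = c) (hlt₁ : c < h₁ ε₁) (hlt₂ : c < h₂ ε₂) :
    ∃ t ∈ Ioc 0 ε₁, ∃ t' ∈ Ioc 0 ε₂, h₁ t = h₂ t' := by
  have hm : c < min (h₁ ε₁) (h₂ ε₂) := lt_min hlt₁ hlt₂
  obtain ⟨t, ht, e⟩ := intermediate_value_Ioc hε₁.le hc₁ ⟨h₁0 ▸ hm, min_le_left _ _⟩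
  obtain ⟨t', ht', e'⟩ := intermediate_value_Ioc hε₂.le hc₂ ⟨h₂0 ▸ hm, min_le_right _ _⟩
  exact ⟨t, ht, t', ht', e.trans e'.symm⟩

/-- Two paths on the real line that leave a point to the same side meet again. -/
theorem exists_common_value {h₁ h₂ : ℝ → ℝ} {ε₁ ε₂ c : ℝ} (hε₁ : 0 < ε₁) (hε₂ : 0 < ε₂)
    (hc₁ : ContinuousOn h₁ (Icc 0 ε₁)) (hc₂ : ContinuousOn h₂ (Icc 0 ε₂)) (h₁0 : h₁ 0 = c)
    (h₂0 : h₂ 0 = c) (hpos : 0 < (h₁ ε₁ - c) * (h₂ ε₂ - c)) :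
    ∃ t ∈ Ioc 0 ε₁, ∃ t' ∈ Ioc 0 ε₂, h₁ t = h₂ t' := by
  rcases pos_and_pos_or_neg_and_neg_of_mul_pos hpos with ⟨h1, h2⟩ | ⟨h1, h2⟩
  · exact exists_common_value_of_lt hε₁ hε₂ hc₁ hc₂ h₁0 h₂0 (by linarith) (by linarith)
  · obtain ⟨t, ht, t', ht', e⟩ := exists_common_value_of_lt (c := -c) hε₁ hε₂ hc₁.neg hc₂.neg
      (by simp [h₁0]) (by simp [h₂0]) (by simp; linarith) (by simp; linarith)
    exact ⟨t, ht, t', ht', by simpa using e⟩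

/-- Three arcs leaving a point of a line use one of its two sides twice: the product of the three
pairwise products is a square, so they cannot all be negative. -/
theorem exists_mul_pos {a b c : ℝ} (ha : a ≠ 0) (hb : b ≠ 0) (hc : c ≠ 0) :
    0 < a * b ∨ 0 < a * c ∨ 0 < b * c := by
  by_contra! h
  have h1 := lt_of_le_of_ne h.1 (mul_ne_zero ha hb)
  have h2 := lt_of_le_of_ne h.2.1 (mul_ne_zero ha hc)
  have h3 := lt_of_le_of_ne h.2.2 (mul_ne_zero hb hc)
  have h4 := mul_neg_of_pos_of_neg (mul_pos_of_neg_of_neg h1 h2) h3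
  nlinarith [sq_nonneg (a * b * c)]

namespace RegularNetwork

variable {N M : RegularNetwork} {f g : ℂ → ℂ}

theorem exists_core_of_notMem_junctions {x : ℂ} (hx : x ∈ N.carrier) (hn : x ∉ N.junctions) :
    ∃ b, x ∈ N.curve b '' (N.kind b).core := by
  obtain ⟨b, s, hs, rfl⟩ := mem_iUnion.1 hx
  exact ⟨b, s, ⟨hs, fun he => hn (mem_iUnion.2 ⟨b, s, he, rfl⟩)⟩, rfl⟩

theorem junctions_subset_carrier : N.junctions ⊆ N.carrier :=
  iUnion_mono fun b => image_mono (N.kind b).endpoints_subset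

namespace CarrierHomeo

/-- If an end of a branch were sent to an interior point of a branch `b`, then, interiors being
relatively open, a short piece of that end would become a path in the parameter line of `b` leaving
`s`. -/
theorem exists_arc (h : CarrierHomeo N M f g) (hN : N.IsSelfExpander) (hM : M.IsSelfExpander)
    {b : Fin M.n} {s : ℝ} (hs : s ∈ (M.kind b).core) {j : Fin N.n} {e : ℝ}
    (he : e ∈ (N.kind j).endpoints) (hes : f (N.curve j e) = M.curve b s) :
    ∃ ε > 0, ε < 1 / 2 ∧
      ContinuousOn (fun t => M.param b (f (N.curve j |e - t|))) (Icc 0 ε) ∧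
      M.param b (f (N.curve j |e - 0|)) = s ∧ M.param b (f (N.curve j |e - ε|)) - s ≠ 0 ∧
      ∀ t ∈ Icc 0 ε, f (N.curve j |e - t|) ∈ M.curve b '' (M.kind b).dom := by
  obtain ⟨O, hO, hOe⟩ := M.exists_isOpen_image_core_eq b
  have hdom : ∀ t ∈ Ico (0 : ℝ) (1 / 2), |e - t| ∈ (N.kind j).dom := fun t ht =>
    BranchKind.abs_sub_mem_dom he ht.1 ht.2
  have hc : ContinuousOn (fun t => f (N.curve j |e - t|)) (Ico 0 (1 / 2)) :=
    h.continuousOn.comp ((N.continuousOn_curve j).comp (f := fun t : ℝ => |e - t|)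
      (by fun_prop) hdom) fun t ht => N.mem_carrier (hdom t ht)
  have he0 : |e - 0| = e := by
    rw [sub_zero, abs_of_nonneg]
    rcases BranchKind.eq_zero_or_eq_one_of_mem_endpoints he with rfl | rfl <;> norm_num
  have h0 : f (N.curve j |e - 0|) ∈ O := by
    rw [he0, hes]
    have : M.curve b s ∈ O ∩ M.carrier := hOe ▸ mem_image_of_mem _ hs
    exact this.1
  have hev := (hc 0 ⟨le_rfl, by norm_num⟩).preimage_mem_nhdsWithin (hO.mem_nhds h0)
  obtain ⟨δ, hδ, hsub⟩ := Metric.mem_nhdsWithin_iff.1 hev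
  have hε : 0 < min (δ / 2) (1 / 4) := lt_min (by linarith) (by norm_num)
  have hε2 : min (δ / 2) (1 / 4) < 1 / 2 := (min_le_right _ _).trans_lt (by norm_num)
  have hIcc : ∀ t ∈ Icc 0 (min (δ / 2) (1 / 4)), t ∈ Ico (0 : ℝ) (1 / 2) := fun t ht =>
    ⟨ht.1, ht.2.trans_lt hε2⟩
  have himg : ∀ t ∈ Icc 0 (min (δ / 2) (1 / 4)),
      f (N.curve j |e - t|) ∈ M.curve b '' (M.kind b).dom := by
    intro t ht
    have h1 : f (N.curve j |e - t|) ∈ O := by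
      refine hsub ⟨?_, hIcc t ht⟩
      rw [mem_ball_zero_iff, Real.norm_of_nonneg ht.1]
      exact ht.2.trans_lt ((min_le_left _ _).trans_lt (by linarith))
    have h2 : f (N.curve j |e - t|) ∈ O ∩ M.carrier :=
      ⟨h1, h.mapsTo (N.mem_carrier (hdom t (hIcc t ht)))⟩
    rw [← hOe] at h2
    exact image_mono (M.kind b).core_subset h2
  refine ⟨_, hε, hε2, (continuousOn_param hM b).comp (hc.mono hIcc) himg, ?_, fun hne => ?_, himg⟩
  · rw [he0, hes, param_curve hM hs.1]
  · have h1 := himg _ (right_mem_Icc.2 hε.le)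
    have h2 := M.curve_param h1
    rw [sub_eq_zero.1 hne, ← hes] at h2
    have hcore := BranchKind.abs_sub_mem_core he hε hε2
    have h3 := h.leftInv.injOn (N.mem_carrier ((N.kind j).endpoints_subset he))
      (N.mem_carrier hcore.1) h2
    have h4 := (hN.expanderArc j).injOn ((N.kind j).endpoints_subset he) hcore.1 h3
    exact hcore.2 (h4 ▸ he)

/-- A triod does not embed in a line. If a junction went to an interior point, its three ends would
give three paths on the real line from one point, two of them to the same side; these meet again,
against injectivity. -/
theorem apply_mem_junctions (h : CarrierHomeo N M f g) (hN : N.IsSelfExpander)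
    (hM : M.IsSelfExpander) {x : ℂ} (hx : x ∈ N.junctions) : f x ∈ M.junctions := by
  by_contra hn
  obtain ⟨b', s, hs, hfx⟩ := exists_core_of_notMem_junctions
    (h.mapsTo (junctions_subset_carrier hx)) hn
  obtain ⟨b, e, he, rfl⟩ := mem_iUnion.1 hx
  obtain ⟨p, q, r, hpq, hpr, hqr, hiff, -⟩ := N.triple b e he
  have harc := fun y hy => h.exists_arc hN hM hs (j := Sigma.fst y) y.2.2
    ((congrArg f ((hiff y).2 hy)).trans hfx.symm)
  obtain ⟨εp, hp0, hp1, hpc, hps, hpn, hpi⟩ := harc p (Or.inl rfl)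
  obtain ⟨εq, hq0, hq1, hqc, hqs, hqn, hqi⟩ := harc q (Or.inr (Or.inl rfl))
  obtain ⟨εr, hr0, hr1, hrc, hrs, hrn, hri⟩ := harc r (Or.inr (Or.inr rfl))
  -- Meeting in the parameter line forces the same point of the network; interior points are passed
  -- only once, and parameters within `1/2` of an end determine that end.
  have key : ∀ {y z : (j : Fin N.n) × (N.kind j).endpoints} {t t' : ℝ}, 0 < t → t < 1 / 2 →
      0 < t' → t' < 1 / 2 →
      f (N.curve y.1 |y.2 - t|) ∈ M.curve b' '' (M.kind b').dom →
      f (N.curve z.1 |z.2 - t'|) ∈ M.curve b' '' (M.kind b').dom →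
      M.param b' (f (N.curve y.1 |y.2 - t|)) = M.param b' (f (N.curve z.1 |z.2 - t'|)) → y = z := by
    rintro ⟨j, e, he⟩ ⟨j', e', he'⟩ t t' h0 h1 h0' h1' hy hz heq
    have h2 : f (N.curve j |e - t|) = f (N.curve j' |e' - t'|) := by
      rw [← M.curve_param hy, ← M.curve_param hz, heq]
    have hcy := BranchKind.abs_sub_mem_core he h0 h1
    have hcz := BranchKind.abs_sub_mem_core he' h0' h1'
    obtain ⟨rfl, h3⟩ := N.embedded j j' _ hcy _ hcz.1
      (h.leftInv.injOn (N.mem_carrier hcy.1) (N.mem_carrier hcz.1) h2)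
    obtain rfl := BranchKind.eq_of_abs_sub_eq he he' h0 h1 h0' h1' h3
    rfl
  rcases exists_mul_pos hpn hqn hrn with hpos | hpos | hpos
  · obtain ⟨t, ht, t', ht', heq⟩ := exists_common_value hp0 hq0 hpc hqc hps hqs hpos
    exact hpq (key ht.1 (ht.2.trans_lt hp1) ht'.1 (ht'.2.trans_lt hq1) (hpi t (Ioc_subset_Icc_self ht))
      (hqi t' (Ioc_subset_Icc_self ht')) heq)
  · obtain ⟨t, ht, t', ht', heq⟩ := exists_common_value hp0 hr0 hpc hrc hps hrs hpos
    exact hpr (key ht.1 (ht.2.trans_lt hp1) ht'.1 (ht'.2.trans_lt hr1) (hpi t (Ioc_subset_Icc_self ht))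
      (hri t' (Ioc_subset_Icc_self ht')) heq)
  · obtain ⟨t, ht, t', ht', heq⟩ := exists_common_value hq0 hr0 hqc hrc hqs hrs hpos
    exact hqr (key ht.1 (ht.2.trans_lt hq1) ht'.1 (ht'.2.trans_lt hr1) (hqi t (Ioc_subset_Icc_self ht))
      (hri t' (Ioc_subset_Icc_self ht')) heq)

/-- Interior points avoid the junctions, since the inverse preserves junctions. The index of the
target branch is then locally constant on the connected interior of `b`. -/
theorem exists_branch (h : CarrierHomeo N M f g) (hN : N.IsSelfExpander) (hM : M.IsSelfExpander)
    (b : Fin N.n) :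
    ∃ b', ∀ s ∈ (N.kind b).core, f (N.curve b s) ∈ M.curve b' '' (M.kind b').core := by
  have hcore : ∀ s : (N.kind b).core, ∃ b', f (N.curve b s) ∈ M.curve b' '' (M.kind b').core := by
    rintro ⟨s, hs⟩
    refine exists_core_of_notMem_junctions (h.mapsTo (N.mem_carrier hs.1)) fun hj => ?_
    have := h.symm.apply_mem_junctions hM hN hj
    rw [h.leftInv (N.mem_carrier hs.1)] at this
    exact N.notMem_junctions_of_mem_core hs this
  choose j hj using hcore
  have hcont : Continuous fun s : (N.kind b).core => f (N.curve b s) :=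
    continuousOn_iff_continuous_domRestrict.1 (h.continuousOn.comp
      ((N.continuousOn_curve b).mono (N.kind b).core_subset) fun s hs => N.mem_carrier hs.1)
  have hloc : IsLocallyConstant j := by
    refine (IsLocallyConstant.iff_eventually_eq j).2 fun s => ?_
    obtain ⟨O, hO, hOe⟩ := M.exists_isOpen_image_core_eq (j s)
    have h1 : f (N.curve b s) ∈ O ∩ M.carrier := hOe ▸ hj s
    filter_upwards [hcont.continuousAt.preimage_mem_nhds (hO.mem_nhds h1.1)] with s' hs'
    have h2 : f (N.curve b s') ∈ O ∩ M.carrier := ⟨hs', h.mapsTo (N.mem_carrier s'.2.1)⟩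
    rw [← hOe] at h2
    obtain ⟨t, ht, e⟩ := h2
    obtain ⟨t', ht', e'⟩ := hj s'
    exact (M.embedded _ _ t' ht' t ht.1 (e'.trans e.symm)).1
  have : PreconnectedSpace (N.kind b).core :=
    isPreconnected_iff_preconnectedSpace.1 (N.kind b).isPreconnected_core
  refine ⟨j ⟨1 / 2, (N.kind b).half_mem_core⟩, fun s hs => ?_⟩
  rw [← hloc.apply_eq_of_preconnectedSpace ⟨s, hs⟩ ⟨1 / 2, (N.kind b).half_mem_core⟩]
  exact hj ⟨s, hs⟩

/-- A homeomorphism of networks maps branches to branches. -/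
theorem exists_equiv (h : CarrierHomeo N M f g) (hN : N.IsSelfExpander) (hM : M.IsSelfExpander) :
    ∃ φ : Fin N.n ≃ Fin M.n, ∀ b,
      (∀ s ∈ (N.kind b).core, f (N.curve b s) ∈ M.curve (φ b) '' (M.kind (φ b)).core) ∧
      ∀ s ∈ (M.kind (φ b)).core, g (M.curve (φ b) s) ∈ N.curve b '' (N.kind b).core := by
  choose φ hφ using h.exists_branch hN hM
  choose χ hχ using h.symm.exists_branch hM hN
  have key : ∀ {N M : RegularNetwork} {f g : ℂ → ℂ}, CarrierHomeo N M f g →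
      ∀ {φ : Fin N.n → Fin M.n} {χ : Fin M.n → Fin N.n},
      (∀ b, ∀ s ∈ (N.kind b).core, f (N.curve b s) ∈ M.curve (φ b) '' (M.kind (φ b)).core) →
      (∀ b, ∀ s ∈ (M.kind b).core, g (M.curve b s) ∈ N.curve (χ b) '' (N.kind (χ b)).core) →
      ∀ b, χ (φ b) = b := by
    intro N M f g h φ χ hφ hχ b
    -- The parameter `1/2` is interior for every kind of branch; following it there and back
    -- identifies the branch.
    have hm := (N.kind b).half_mem_core
    obtain ⟨s, hs, e⟩ := hφ b _ hm
    obtain ⟨t, ht, e'⟩ := hχ _ s hs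
    rw [e, h.leftInv (N.mem_carrier hm.1)] at e'
    exact (N.embedded _ _ t ht _ hm.1 e').1
  have hl := key h hφ hχ
  refine ⟨⟨φ, χ, hl, key h.symm hχ hφ⟩, fun b => ⟨hφ b, ?_⟩⟩
  have := hχ (φ b)
  rwa [hl b] at this

variable {b : Fin N.n} {b' : Fin M.n}

theorem apply_mem_image_dom (h : CarrierHomeo N M f g)
    (hb : ∀ s ∈ (N.kind b).core, f (N.curve b s) ∈ M.curve b' '' (M.kind b').core) {s : ℝ}
    (hs : s ∈ (N.kind b).dom) : f (N.curve b s) ∈ M.curve b' '' (M.kind b').dom := by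
  have hcl := (h.continuousOn.comp (N.continuousOn_curve b) fun s hs =>
    N.mem_carrier hs).preimage_isClosed_of_isClosed (N.kind b).isClosed_dom
      (M.isClosed_image_curve b' (M.kind b').isClosed_dom Subset.rfl)
  exact (hcl.closure_subset_iff.2 (fun t ht => ⟨ht.1, image_mono (M.kind b').core_subset (hb t ht)⟩)
    ((N.kind b).dom_subset_closure_core hs)).2

theorem param_mem_endpoints (h : CarrierHomeo N M f g) (hN : N.IsSelfExpander)
    (hM : M.IsSelfExpander)
    (hb : ∀ s ∈ (N.kind b).core, f (N.curve b s) ∈ M.curve b' '' (M.kind b').core) {s : ℝ}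
    (hs : s ∈ (N.kind b).endpoints) : M.param b' (f (N.curve b s)) ∈ (M.kind b').endpoints := by
  have hmem := h.apply_mem_image_dom hb ((N.kind b).endpoints_subset hs)
  by_contra hn
  have := M.notMem_junctions_of_mem_core (b := b') ⟨M.param_mem hmem, hn⟩
  rw [M.curve_param hmem] at this
  exact this (h.apply_mem_junctions hN hM (mem_iUnion.2 ⟨b, s, hs, rfl⟩))

theorem param_param (h : CarrierHomeo N M f g) (hN : N.IsSelfExpander)
    (hb : ∀ s ∈ (N.kind b).core, f (N.curve b s) ∈ M.curve b' '' (M.kind b').core) {s : ℝ}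
    (hs : s ∈ (N.kind b).dom) :
    N.param b (g (M.curve b' (M.param b' (f (N.curve b s))))) = s := by
  rw [M.curve_param (h.apply_mem_image_dom hb hs), h.leftInv (N.mem_carrier hs), param_curve hN hs]

/-- The number of end points (two, one or none) determines the kind, and the homeomorphism and its
inverse embed the end points of either branch into those of the other. -/
theorem kind_eq (h : CarrierHomeo N M f g) (hN : N.IsSelfExpander) (hM : M.IsSelfExpander)
    (hb : ∀ s ∈ (N.kind b).core, f (N.curve b s) ∈ M.curve b' '' (M.kind b').core)
    (hb' : ∀ s ∈ (M.kind b').core, g (M.curve b' s) ∈ N.curve b '' (N.kind b).core) :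
    M.kind b' = N.kind b := by
  refine BranchKind.eq_of_ncard_endpoints_eq (le_antisymm ?_ ?_)
  · exact ncard_le_ncard_of_injOn _ (fun s hs => h.symm.param_mem_endpoints hM hN hb' hs)
      (LeftInvOn.injOn (f₁' := fun t => M.param b' (f (N.curve b t)))
        fun s hs => h.symm.param_param hM hb' ((M.kind b').endpoints_subset hs))
      (N.kind b).finite_endpoints
  · exact ncard_le_ncard_of_injOn _ (fun s hs => h.param_mem_endpoints hN hM hb hs)
      (LeftInvOn.injOn (f₁' := fun t => N.param b (g (M.curve b' t)))
        fun s hs => h.param_param hN hb ((N.kind b).endpoints_subset hs))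
      (M.kind b').finite_endpoints

end CarrierHomeo

end RegularNetwork

/-! ### Corresponding ends and branches. -/

/-- Arcs that run along two half-lines and approach each other run along the same half-line. -/
theorem ExpanderArc.eq_of_runsAlong {γ₀ γ₁ : ℝ → ℂ} {D₀ D₁ : Set ℝ} {e₀ e₁ : ℂ} {ρ : ℝ → ℝ}
    (h₀ : ExpanderArc γ₀ D₀) (hD₀ : Ici 0 ⊆ D₀) (h₁ : ExpanderArc γ₁ D₁) (hD₁ : Ici 0 ⊆ D₁)
    (he₀ : ‖e₀‖ = 1) (he₁ : ‖e₁‖ = 1) (hr₀ : RunsAlong γ₀ e₀) (hr₁ : RunsAlong γ₁ e₁)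
    (hρ : Tendsto ρ atTop atTop) (hd : Tendsto (fun s => γ₁ (ρ s) - γ₀ s) atTop (𝓝 0)) :
    e₁ = e₀ := by
  obtain ⟨hX₀, hY₀, -⟩ := h₀.tendsto_of_runsAlong hD₀ he₀ hr₀
  obtain ⟨hX₁, hY₁, -⟩ := h₁.tendsto_of_runsAlong hD₁ he₁ hr₁
  replace hX₁ := hX₁.comp hρ
  replace hY₁ := hY₁.comp hρ
  -- `k` is the rotation from `e₀` to `e₁`. A nonzero imaginary part would make the arcs diverge
  -- sideways, and a negative real part would send them in opposite directions.
  set k := e₁ * conj e₀ with hk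
  have hke : k * e₀ = e₁ := by
    rw [hk, mul_assoc, mul_comm (conj e₀), Complex.mul_conj, Complex.normSq_eq_norm_sq, he₀]
    simp
  have hknorm : k.re ^ 2 + k.im ^ 2 = 1 := by
    have : ‖k‖ = 1 := by rw [hk, norm_mul, RCLike.norm_conj, he₀, he₁, one_mul]
    rw [← one_pow 2, ← this, ← Complex.normSq_eq_norm_sq, Complex.normSq_apply]
    ring
  have hw : ∀ s, γ₁ (ρ s) * conj e₀ = γ₁ (ρ s) * conj e₁ * k := fun s => by
    rw [hk]
    have : conj e₁ * e₁ = 1 := by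
      rw [mul_comm, Complex.mul_conj, Complex.normSq_eq_norm_sq, he₁]; simp
    linear_combination -(γ₁ (ρ s) * conj e₀) * this
  have hd' : Tendsto (fun s => γ₁ (ρ s) * conj e₀ - γ₀ s * conj e₀) atTop (𝓝 0) := by
    simpa [sub_mul] using hd.mul_const (conj e₀)
  have him : Tendsto (fun s => (γ₁ (ρ s) * conj e₁).re * k.im) atTop (𝓝 0) := by
    have h1 := ((Complex.continuous_im.tendsto _).comp hd').add (hY₀.sub (hY₁.mul_const k.re))
    simp only [Complex.zero_im, zero_mul, sub_zero, add_zero] at h1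
    refine h1.congr fun s => ?_
    simp only [Function.comp_apply, Complex.sub_im, hw, Complex.mul_im (γ₁ (ρ s) * conj e₁) k]
    ring
  have hk0 : k.im = 0 := by
    by_contra hne
    have h1 := hX₁.atTop_mul_pos (abs_pos.2 hne) tendsto_const_nhds
    have h2 := him.abs
    simp only [abs_mul, abs_zero] at h2
    refine not_tendsto_nhds_of_tendsto_atTop (tendsto_atTop_mono (fun s => ?_) h1) 0 h2
    exact mul_le_mul_of_nonneg_right (le_abs_self _) (abs_nonneg _)
  have hkre : 0 < k.re := by
    by_contra! hle
    have h1 : Tendsto (fun s => (γ₁ (ρ s) * conj e₀).re) atTop atTop := by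
      have h2 := ((Complex.continuous_re.tendsto _).comp hd').add_atTop hX₀
      refine h2.congr fun s => ?_
      simp
    obtain ⟨s, hs1, hs2⟩ := ((h1.eventually_gt_atTop 0).and (hX₁.eventually_gt_atTop 0)).exists
    rw [hw, Complex.mul_re, hk0, mul_zero, sub_zero] at hs1
    exact absurd hs1 (mul_nonpos_of_nonneg_of_nonpos hs2.le hle).not_gt
  have hk1 : k = 1 := by
    rw [hk0] at hknorm
    refine Complex.ext ?_ hk0
    rw [Complex.one_re]
    nlinarith
  rw [← hke, hk1, one_mul]

theorem StrictMonoOn.tendsto_atTop_of_surjOn {ρ : ℝ → ℝ} (hm : StrictMonoOn ρ (Ici 0))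
    (hs : SurjOn ρ (Ici 0) (Ici 0)) : Tendsto ρ atTop atTop := by
  refine tendsto_atTop.2 fun A => ?_
  obtain ⟨s, hs0, hsA⟩ := hs (le_max_right A 0)
  filter_upwards [eventually_ge_atTop s] with t ht
  exact (le_max_left A 0).trans (hsA ▸ hm.monotoneOn hs0 (hs0.trans ht) ht)

/-- Two arcs of the same kind match each other if one is mapped to the other by a map that
approaches the identity at infinity. -/
theorem matched_of_reparametrization {F : ℂ → ℂ} {γ₀ γ₁ : ℝ → ℂ} {k : BranchKind}
    (h₀ : ExpanderArc γ₀ k.dom) (h₁ : ExpanderArc γ₁ k.dom) {ρ : ℝ → ℝ}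
    (hρ : ContinuousOn ρ k.dom) (hbij : BijOn ρ k.dom k.dom)
    (hep : MapsTo ρ k.endpoints k.endpoints) (heq : ∀ s ∈ k.dom, γ₁ (ρ s) = F (γ₀ s))
    (hinf : ∀ σ ∈ k.directions, Tendsto (fun s : ℝ => ‖γ₀ (σ * s)‖) atTop atTop)
    (hnear : ∀ ε > 0, ∃ r : ℝ, ∀ s ∈ k.dom, r ≤ ‖γ₀ s‖ → ‖γ₁ (ρ s) - γ₀ s‖ ≤ ε)
    (he₀ : ∀ σ ∈ k.directions, ∃ e, ‖e‖ = 1 ∧ RunsAlong (fun s => γ₀ (σ * s)) e)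
    (he₁ : ∀ σ ∈ k.directions, ∃ e, ‖e‖ = 1 ∧ RunsAlong (fun s => γ₁ (σ * s)) e) :
    Matched F γ₀ γ₁ k := by
  have hd : ∀ σ ∈ k.directions, (∀ s ≥ 0, σ * s ∈ k.dom) →
      Tendsto (fun s : ℝ => γ₁ (ρ (σ * s)) - γ₀ (σ * s)) atTop (𝓝 0) := by
    intro σ hσ hdom
    rw [Metric.tendsto_nhds]
    intro ε hε
    obtain ⟨r, hr⟩ := hnear (ε / 2) (half_pos hε)
    filter_upwards [(hinf σ hσ).eventually_ge_atTop r, eventually_ge_atTop 0] with s hs hs0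
    rw [dist_zero_right]
    exact (hr _ (hdom s hs0) hs).trans_lt (half_lt_self hε)
  cases k with
  | segment =>
    have m0 : (0 : ℝ) ∈ Icc (0 : ℝ) 1 := ⟨le_rfl, zero_le_one⟩
    have m1 : (1 : ℝ) ∈ Icc (0 : ℝ) 1 := ⟨zero_le_one, le_rfl⟩
    have hne : ρ 0 ≠ ρ 1 := fun h => zero_ne_one (hbij.injOn m0 m1 h)
    have e0 := heq 0 m0
    have e1 := heq 1 m1
    rcases hep (show (0 : ℝ) ∈ BranchKind.endpoints .segment from Or.inl rfl) with h0 | h0 <;>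
      rcases hep (show (1 : ℝ) ∈ BranchKind.endpoints .segment from Or.inr rfl) with h1 | h1
    · exact (hne (h0.trans h1.symm)).elim
    · rw [h0] at e0
      rw [h1] at e1
      exact Or.inl ⟨e0, e1⟩
    · rw [h0] at e0
      rw [h1] at e1
      exact Or.inr ⟨e0, e1⟩
    · exact (hne (h0.trans h1.symm)).elim
  | ray =>
    have m0 : (0 : ℝ) ∈ Ici (0 : ℝ) := self_mem_Ici
    have m1 : (1 : ℝ) ∈ Ici (0 : ℝ) := zero_le_one' ℝ
    have h0 : ρ 0 = 0 := hep rfl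
    have e0 := heq 0 m0
    rw [h0] at e0
    -- The reparametrization is injective and continuous, hence monotone; it fixes `0` and stays
    -- nonnegative, so it cannot decrease.
    have hmono : StrictMonoOn ρ (Ici 0) := by
      rcases ContinuousOn.strictMonoOn_or_strictAntiOn (D := Ici 0) hρ hbij.injOn with h | h
      · exact h
      · have h1 := h m0 m1 zero_lt_one
        rw [h0] at h1
        exact absurd (hbij.mapsTo m1) h1.not_ge
    obtain ⟨e, he, hr⟩ := he₀ 1 rfl
    obtain ⟨e', he', hr'⟩ := he₁ 1 rfl
    have hd1 := hd 1 rfl fun s hs => by rw [one_mul]; exact hs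
    simp only [one_mul] at hr hr' hd1
    obtain rfl := h₀.eq_of_runsAlong Subset.rfl h₁ Subset.rfl he he' hr hr'
      (hmono.tendsto_atTop_of_surjOn hbij.surjOn) hd1
    exact ⟨e0, e', he, hr, hr'⟩
  | line =>
    have hr0 : ∀ {γ : ℝ → ℂ}, ExpanderArc γ univ → ExpanderArc (fun s => γ (0 - s)) univ :=
      fun h => h.reverse fun _ => Iff.rfl
    obtain ⟨e, he, hr⟩ := he₀ 1 (Or.inl rfl)
    obtain ⟨e', he', hr'⟩ := he₀ (-1) (Or.inr rfl)
    obtain ⟨d, hd1, hs⟩ := he₁ 1 (Or.inl rfl)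
    obtain ⟨d', hd1', hs'⟩ := he₁ (-1) (Or.inr rfl)
    have hlim := hd 1 (Or.inl rfl) fun _ _ => trivial
    have hlim' := hd (-1) (Or.inr rfl) fun _ _ => trivial
    have hneg : ∀ s : ℝ, 0 - s = -s := zero_sub
    have hmul : ∀ s : ℝ, -1 * s = 0 - s := fun s => by ring
    simp only [one_mul, hmul] at hr hr' hs hs' hlim hlim'
    have hsub : Tendsto (fun s : ℝ => 0 - s) atTop atBot := by
      simpa only [hneg] using tendsto_neg_atTop_atBot
    refine ⟨e, e', he, he', hr, hr', ?_⟩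
    -- An increasing reparametrization preserves the two ends of the line and a decreasing one
    -- exchanges them; these are the two alternatives of `Matched`.
    rcases ContinuousOn.strictMonoOn_or_strictAntiOn (D := univ) hρ hbij.injOn with hm | hm
    · have hsurj : Function.Surjective ρ := surjOn_univ.1 hbij.surjOn
      have hm' := strictMonoOn_univ.1 hm
      have ht := (hm'.orderIsoOfSurjective _ hsurj).tendsto_atTop
      have hb := (hm'.orderIsoOfSurjective _ hsurj).tendsto_atBot
      obtain rfl := h₀.eq_of_runsAlong (subset_univ _) h₁ (subset_univ _) he hd1 hr hs ht hlim
      obtain rfl := (hr0 h₀).eq_of_runsAlong (subset_univ _) (hr0 h₁) (subset_univ _) he' hd1' hr' hs'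
        (ρ := fun s => -ρ (0 - s)) (tendsto_neg_atBot_atTop.comp (hb.comp hsub))
        (hlim'.congr fun s => by rw [hneg (-ρ (0 - s)), neg_neg])
      exact Or.inl ⟨hs, hs'⟩
    · have hsurj : Function.Surjective fun s => -ρ s :=
        neg_surjective.comp (surjOn_univ.1 hbij.surjOn)
      have hm' : StrictMono fun s => -ρ s := (strictAntiOn_univ.1 hm).neg
      have ht := (hm'.orderIsoOfSurjective _ hsurj).tendsto_atTop
      have hb := (hm'.orderIsoOfSurjective _ hsurj).tendsto_atBot
      obtain rfl := h₀.eq_of_runsAlong (subset_univ _) (hr0 h₁) (subset_univ _) he hd1' hr hs' ht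
        (hlim.congr fun s => by
          show _ = γ₁ (0 - -ρ s) - _
          rw [hneg, neg_neg])
      obtain rfl := (hr0 h₀).eq_of_runsAlong (subset_univ _) h₁ (subset_univ _) he' hd1 hr' hs
        (ρ := fun s => ρ (0 - s))
        ((tendsto_neg_atBot_atTop.comp (hb.comp hsub)).congr fun s => neg_neg (ρ (0 - s))) hlim'
      exact Or.inr ⟨hs, hs'⟩

namespace RegularNetwork

variable {N M : RegularNetwork} {f g : ℂ → ℂ}

theorem EndAsymptotic.runsAlong {b : Fin N.n} {σ α : ℝ} (h : N.EndAsymptotic b σ α) :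
    ∃ e, ‖e‖ = 1 ∧ RunsAlong (fun s => N.curve b (σ * s)) e := by
  refine ⟨Complex.exp (Complex.I * α), by rw [mul_comm, Complex.norm_exp_ofReal_mul_I], ?_⟩
  obtain ⟨R, hR, s₀, hs₀, u, himg, hu⟩ := h
  refine ⟨R, hR, s₀, hs₀, u, himg.trans ?_, hu⟩
  have : Complex.exp (Complex.I * (α + Real.pi / 2)) =
      Complex.I * Complex.exp (Complex.I * α) := by
    rw [mul_add, Complex.exp_add, mul_comm Complex.I (Real.pi / 2 : ℂ), Complex.exp_pi_div_two_mul_I,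
      mul_comm]
  simp only [this]

/-- The homeomorphism read in the parameters of the two branches is a continuous bijection of the
common parameter interval that preserves end points. Closeness to the identity at infinity decides
which half-lines correspond. -/
theorem CarrierHomeo.matched (h : CarrierHomeo N M f g) (hN : N.IsSelfExpander)
    (hM : M.IsSelfExpander) {b : Fin N.n} {b' : Fin M.n}
    (hb : ∀ s ∈ (N.kind b).core, f (N.curve b s) ∈ M.curve b' '' (M.kind b').core)
    (hb' : ∀ s ∈ (M.kind b').core, g (M.curve b' s) ∈ N.curve b '' (N.kind b).core)
    (hNe : ∀ σ ∈ (N.kind b).directions, ∃ e, ‖e‖ = 1 ∧ RunsAlong (fun s => N.curve b (σ * s)) e)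
    (hMe : ∀ σ ∈ (M.kind b').directions, ∃ e, ‖e‖ = 1 ∧ RunsAlong (fun s => M.curve b' (σ * s)) e) :
    Matched f (N.curve b) (M.curve b') (N.kind b) := by
  have hk := h.kind_eq hN hM hb hb'
  have himg : ∀ s ∈ (N.kind b).dom, f (N.curve b s) ∈ M.curve b' '' (M.kind b').dom :=
    fun s hs => h.apply_mem_image_dom hb hs
  have himg' : ∀ s ∈ (M.kind b').dom, g (M.curve b' s) ∈ N.curve b '' (N.kind b).dom :=
    fun s hs => h.symm.apply_mem_image_dom hb' hs
  refine matched_of_reparametrization (ρ := fun s => M.param b' (f (N.curve b s)))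
    (hN.expanderArc b) (hk ▸ hM.expanderArc b') ?_ ?_ ?_ (fun s hs => M.curve_param (himg s hs))
    (fun σ hσ => (N.approaches b σ hσ).1) ?_ hNe (hk ▸ hMe)
  · exact (continuousOn_param hM b').comp (h.continuousOn.comp (N.continuousOn_curve b)
      fun s hs => N.mem_carrier hs) himg
  · refine InvOn.bijOn (f' := fun s => N.param b (g (M.curve b' s)))
      ⟨fun s hs => h.param_param hN hb hs, fun s hs => h.symm.param_param hM hb' (hk ▸ hs)⟩
      (fun s hs => ?_) fun s hs => N.param_mem (himg' s (hk ▸ hs))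
    rw [← hk]
    exact M.param_mem (himg s hs)
  · intro s hs
    have := h.param_mem_endpoints hN hM hb hs
    rwa [hk] at this
  · intro ε hε
    obtain ⟨r, hr⟩ := h.near ε hε
    refine ⟨r, fun s hs hsr => ?_⟩
    rw [M.curve_param (himg s hs)]
    exact hr _ (N.mem_carrier hs) hsr

end RegularNetwork

end

theorem mainTheorem5 (ψ₀ ψ₁ : RegularNetwork)
    (h₀ : ψ₀.IsSelfExpander) (h₁ : ψ₁.IsSelfExpander)
    (hasym : ψ₀.AsymptoticToEachOther ψ₁)
    (hclass : ψ₀.SameTopologicalClass ψ₁) :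
    ψ₀.carrier = ψ₁.carrier := by
  obtain ⟨F, hsm, hF0, hF1, -, hv⟩ := hclass
  obtain ⟨g, h⟩ := RegularNetwork.exists_carrierHomeo F hsm hF0 hF1 hv
  obtain ⟨φ, hφ⟩ := h.exists_equiv h₀ h₁
  refine RegularNetwork.carrier_eq_of_matched (F := F 1) (G := g) h₀ h₁ φ
    (fun b => h.kind_eq h₀ h₁ (hφ b).1 (hφ b).2)
    (fun b => h.matched h₀ h₁ (hφ b).1 (hφ b).2 ?_ ?_)
    fun b t ht => h.leftInv (ψ₀.mem_carrier ((ψ₀.kind b).endpoints_subset ht))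
  · intro σ hσ
    obtain ⟨α, hα, -⟩ := hasym.1 b σ hσ
    exact hα.runsAlong
  · intro σ hσ
    obtain ⟨α, hα, -⟩ := hasym.2 (φ b) σ hσ
    exact hα.runsAlong
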